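/- **Theorem.** Let $X$ be a compact connected Riemann surface with an antiholomorphic involution $\sigma$, let $x_0\in X$ and $n\ge 0$. Let $\Gamma=\pi_1(X,x_0)\sqcup \mathrm{Path}(X,x_0)$ be the orbifold fundamental group of $X/\sigma$, where $\mathrm{Path}(X,x_0)$ is the set of homotopy classes (with fixed end points) of paths from $x_0$ to $\sigma(x_0)$, with the product $\gamma_2\gamma_1=\gamma_2\circ\gamma_1$ (first $\gamma_1$, then $\gamma_2$) if $\gamma_1\in\pi_1(X,x_0)$ and $\gamma_2\gamma_1=\sigma(\gamma_2)\circ\gamma_1$ if $\gamma_1\in\mathrm{Path}(X,x_0)$. Let $\xi:\Gamma\to\mathbb Z/2=\{0,1\}$ be the homomorphism that is $0$ on $\pi_1(X,x_0)$ and $1$ on $\mathrm{Path}(X,x_0)$, and let $\widetilde{\mathrm U}_n=\mathrm U_n\rtimes\mathrm{Gal}(\mathbb C/\mathbb R)$, where $\mathrm{Gal}(\mathbb C/\mathbb R)=\mathbb Z/2$ acts by complex conjugation; it acts on $\mathbb C^n$ by unitary and antiunitary maps. A real (respectively, quaternionic) unitary representation of $\Gamma$ is a map $\rho:\Gamma\to\widetilde{\mathrm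 U}_n$ over $\mathbb Z/2$ with $\rho(a)\rho(b)=\rho(ab)$ (respectively, $\rho(a)\rho(b)=(-1)^{\xi(a)\xi(b)}\rho(ab)$) for all $a,b\in\Gamma$. Two of them, $\rho$ and $\rho'$, are equivalent if $\rho'(g)=A\rho(g)A^{-1}$ for all $g\in\Gamma$, for some $A\in\mathrm U_n$. Consider triples $(V,\nabla,\widetilde\sigma)$, where $V$ is a smooth complex vector bundle of rank $n$ on $X$, $\nabla$ is a flat unitary connection on $V$ (a smooth connection with zero curvature that preserves a smooth hermitian metric $h$ on $V$), and $\widetilde\sigma:V\to V$ is a real (respectively, quaternionic) structure, that is, a smooth lift of $\sigma$, antilinear on the fibers, with $\widetilde\sigma^2=\mathrm{Id}$ (respectively, $\widetilde\sigma^2=-\mathrm{Id}$), such that $\nabla$ is $\widetilde\sigma$-equivariant: $\nabla_{d\sigma(v)}(\widetilde\sigma s\sigma)=\widetilde\sigma(\nabla_v s)$ for all sections $s$ and all tangent vectors $v$. An isomorphism of triples is an isomorphism of smooth complex vector bundles over $X$ that preserves the connections and intertwines the lifts of $\sigma$. Then there is a bijection between the set of equivalence classes of real (respectively, quaternionic)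 unitary representations $\rho:\Gamma\to\widetilde{\mathrm U}_n$ and the set of isomorphism classes of triples $(V,\nabla,\widetilde\sigma)$ of rank $n$ with $\widetilde\sigma$ real (respectively, quaternionic). It is natural: the class of $\rho$ corresponds to the class of $(V,\nabla,\widetilde\sigma)$ if and only if there is a linear isomorphism $\varphi:\mathbb C^n\to V_{x_0}$ such that, with $T_\gamma$ the parallel transport along $\gamma$, $\varphi\rho(\gamma)\varphi^{-1}=T_\gamma$ for $\gamma\in\pi_1(X,x_0)$ and $\varphi\rho(\gamma)\varphi^{-1}=\widetilde\sigma_{x_0}^{-1}T_\gamma$ for $\gamma\in\mathrm{Path}(X,x_0)$. The same holds in the unitary category, that is, if the metric $h$ is part of the data, $\widetilde\sigma$ is antiunitary for $h$, isomorphisms are isometric, and $\varphi$ is unitary. -/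

import Mathlib

open Bundle Manifold Topology ContDiff Matrix Filter

/-- A one-dimensional complex manifold is a smooth real manifold (of dimension two). -/
instance RealCurve.instIsManifoldReal (X : Type*) [TopologicalSpace X] [ChartedSpace ℂ X]
    [IsManifold 𝓘(ℂ, ℂ) ω X] : IsManifold 𝓘(ℝ, ℂ) ω X := by
  refine isManifold_of_contDiffOn _ _ _ fun e e' he he' => ?_
  have h := (contDiffGroupoid ω 𝓘(ℂ, ℂ)).compatible he he'
  rw [contDiffGroupoid, mem_groupoid_of_pregroupoid] at h
  have h' : ContDiffOn ℂ ω (𝓘(ℂ, ℂ) ∘ (e.symm.trans e') ∘ 𝓘(ℂ, ℂ).symm)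
      (𝓘(ℂ, ℂ).symm ⁻¹' (e.symm.trans e').source ∩ Set.range 𝓘(ℂ, ℂ)) := h.1
  exact h'.restrict_scalars ℝ

section Involution

/-- An antiholomorphic involution `σ` of a Riemann surface `X`: a continuous map with
`σ ∘ σ = id` whose expression in holomorphic charts is the conjugate of a holomorphic map. -/
structure AntiholInvolution (X : Type*) [TopologicalSpace X] [ChartedSpace ℂ X] where
  toFun : X → X
  continuous_toFun : Continuous toFun
  involutive : ∀ x, toFun (toFun x) = x
  antiholomorphic : ∀ x, ContMDiffAt 𝓘(ℂ, ℂ) 𝓘(ℂ, ℂ) ω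
    (fun z => (starRingEnd ℂ) (chartAt ℂ (toFun x) (toFun z))) x

variable {X : Type*} [TopologicalSpace X] [ChartedSpace ℂ X]

instance : CoeFun (AntiholInvolution X) fun _ => X → X := ⟨AntiholInvolution.toFun⟩

/-- The involution as a continuous map. -/
def AntiholInvolution.toContinuousMap (σ : AntiholInvolution X) : C(X, X) :=
  ⟨σ, σ.continuous_toFun⟩

end Involution

section OrbifoldGroup

variable {X : Type*} [TopologicalSpace X] [ChartedSpace ℂ X]

/-- The orbifold fundamental group `Γ` of `X/σ` based at `x₀`: the disjoint union of `π₁(X, x₀)`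
and of the set `Path(X, x₀)` of homotopy classes, relative to the end points, of paths from `x₀`
to `σ x₀`. -/
inductive OrbifoldGroup (σ : AntiholInvolution X) (x₀ : X) where
  | loop (γ : Path.Homotopic.Quotient x₀ x₀) : OrbifoldGroup σ x₀
  | path (γ : Path.Homotopic.Quotient x₀ (σ x₀)) : OrbifoldGroup σ x₀

namespace OrbifoldGroup

variable {σ : AntiholInvolution X} {x₀ : X}

/-- The image `σ(γ)` of a class of loops at `x₀`; it is a class of loops at `σ x₀`. -/
def mapLoop (γ : Path.Homotopic.Quotient x₀ x₀) : Path.Homotopic.Quotient (σ x₀) (σ x₀) :=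
  γ.map σ.toContinuousMap

/-- The image `σ(γ)` of a class of paths from `x₀` to `σ x₀`; it goes from `σ x₀` to `x₀`. -/
def mapPath (γ : Path.Homotopic.Quotient x₀ (σ x₀)) : Path.Homotopic.Quotient (σ x₀) x₀ :=
  (γ.map σ.toContinuousMap).cast rfl (σ.involutive x₀).symm

theorem mapLoop_trans (a b : Path.Homotopic.Quotient x₀ x₀) :
    mapLoop (σ := σ) (a.trans b) = (mapLoop a).trans (mapLoop b) := by
  induction a with | mk a
  induction b with | mk b
  refine congrArg Path.Homotopic.Quotient.mk (Path.ext (funext fun t => ?_))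
  exact congrFun (congrArg DFunLike.coe (Path.map_trans a b σ.continuous_toFun)) t

theorem mapPath_trans (a : Path.Homotopic.Quotient x₀ x₀)
    (b : Path.Homotopic.Quotient x₀ (σ x₀)) :
    mapPath (a.trans b) = (mapLoop a).trans (mapPath b) := by
  induction a with | mk a
  induction b with | mk b
  refine congrArg Path.Homotopic.Quotient.mk (Path.ext (funext fun t => ?_))
  exact congrFun (congrArg DFunLike.coe (Path.map_trans a b σ.continuous_toFun)) t

theorem mapPath_trans_mapLoop (a : Path.Homotopic.Quotient x₀ (σ x₀))
    (b : Path.Homotopic.Quotient x₀ x₀) :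
    mapPath (a.trans (mapLoop b)) = (mapPath a).trans b := by
  induction a with | mk a
  induction b with | mk b
  refine congrArg Path.Homotopic.Quotient.mk (Path.ext (funext fun t => ?_))
  have h := congrFun (congrArg DFunLike.coe (Path.map_trans a (b.map σ.continuous_toFun)
    σ.continuous_toFun)) t
  refine Eq.trans h ?_
  simp only [Path.trans_apply]
  split_ifs
  · rfl
  · exact σ.involutive _

theorem mapLoop_trans_mapPath (a b : Path.Homotopic.Quotient x₀ (σ x₀)) :
    mapLoop (a.trans (mapPath b)) = (mapPath a).trans b := by
  induction a with | mk a
  induction b with | mk b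
  refine congrArg Path.Homotopic.Quotient.mk (Path.ext (funext fun t => ?_))
  have h := congrFun (congrArg DFunLike.coe (Path.map_trans a
    ((b.map σ.continuous_toFun).cast rfl (σ.involutive x₀).symm) σ.continuous_toFun)) t
  refine Eq.trans h ?_
  refine Eq.trans ?_ (Path.trans_apply _ b t).symm
  rw [Path.trans_apply]
  split_ifs
  · rfl
  · exact σ.involutive _

theorem mapPath_symm_mapPath (a : Path.Homotopic.Quotient x₀ (σ x₀)) :
    mapPath (mapPath a).symm = a.symm := by
  induction a with | mk a
  exact congrArg Path.Homotopic.Quotient.mk (Path.ext (funext fun t => σ.involutive _))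

/-- The product `γ₂ γ₁` is `γ₂ ∘ γ₁` (first `γ₁`, then `γ₂`) if `γ₁` ends at `x₀`, and
`σ(γ₂) ∘ γ₁` if `γ₁` ends at `σ x₀`. In Mathlib `γ₁.trans γ₂` is first `γ₁`, then `γ₂`. -/
noncomputable instance : Mul (OrbifoldGroup σ x₀) where
  mul
    | loop γ₂, loop γ₁ => loop (γ₁.trans γ₂)
    | path γ₂, loop γ₁ => path (γ₁.trans γ₂)
    | loop γ₂, path γ₁ => path (γ₁.trans (mapLoop γ₂))
    | path γ₂, path γ₁ => loop (γ₁.trans (mapPath γ₂))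

noncomputable instance : One (OrbifoldGroup σ x₀) := ⟨loop (Path.Homotopic.Quotient.refl x₀)⟩

/-- The inverse of a class `γ` of paths from `x₀` to `σ x₀` is the class of `t ↦ σ(γ(1 - t))`. -/
noncomputable instance : Inv (OrbifoldGroup σ x₀) where
  inv
    | loop γ => loop γ.symm
    | path γ => path (mapPath γ).symm

theorem loop_mul_loop (a b : Path.Homotopic.Quotient x₀ x₀) :
    (loop a * loop b : OrbifoldGroup σ x₀) = loop (b.trans a) := rfl

theorem path_mul_loop (a : Path.Homotopic.Quotient x₀ (σ x₀))
    (b : Path.Homotopic.Quotient x₀ x₀) : path a * loop b = path (b.trans a) := rfl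

theorem loop_mul_path (a : Path.Homotopic.Quotient x₀ x₀)
    (b : Path.Homotopic.Quotient x₀ (σ x₀)) :
    loop a * path b = path (b.trans (mapLoop a)) := rfl

theorem path_mul_path (a b : Path.Homotopic.Quotient x₀ (σ x₀)) :
    path a * path b = loop (b.trans (mapPath a)) := rfl

noncomputable instance : Group (OrbifoldGroup σ x₀) :=
  Group.ofLeftAxioms
    (by
      rintro (a | a) (b | b) (c | c) <;>
      simp only [loop_mul_loop, path_mul_loop, loop_mul_path, path_mul_path,
        Path.Homotopic.Quotient.trans_assoc, mapLoop_trans, mapPath_trans,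
        mapPath_trans_mapLoop, mapLoop_trans_mapPath])
    (by
      have h : mapLoop (σ := σ) (Path.Homotopic.Quotient.refl x₀)
          = Path.Homotopic.Quotient.refl (σ x₀) := rfl
      rintro (a | a)
      · exact congrArg loop a.trans_refl
      · refine congrArg path ?_
        rw [h, Path.Homotopic.Quotient.trans_refl])
    (by
      rintro (a | a)
      · exact congrArg loop a.trans_symm
      · refine congrArg loop ?_
        rw [mapPath_symm_mapPath, Path.Homotopic.Quotient.trans_symm])

/-- The projection `ξ : Γ → ℤ/2`, which is `0` on `π₁(X, x₀)` and `1` on `Path(X, x₀)`. -/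
noncomputable def deg : OrbifoldGroup σ x₀ →* Multiplicative (ZMod 2) :=
  MonoidHom.mk'
    (fun | loop _ => Multiplicative.ofAdd 0 | path _ => Multiplicative.ofAdd 1)
    (by
      rintro (a | a) (b | b)
      · rfl
      · rfl
      · rfl
      · exact (by decide : Multiplicative.ofAdd (0 : ZMod 2)
          = Multiplicative.ofAdd 1 * Multiplicative.ofAdd 1))

end OrbifoldGroup

end OrbifoldGroup

section ExtendedUnitaryGroup

/-- Entrywise complex conjugation `A ↦ τ A τ` of unitary matrices. -/
def conjUnitary (n : ℕ) : MulAut (unitaryGroup (Fin n) ℂ) :=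
  have h : ∀ A : unitaryGroup (Fin n) ℂ,
      (A : Matrix (Fin n) (Fin n) ℂ).map (starRingEnd ℂ) ∈ unitaryGroup (Fin n) ℂ := fun A => by
    have hc : star ((A : Matrix (Fin n) (Fin n) ℂ).map (starRingEnd ℂ))
        = (star (A : Matrix (Fin n) (Fin n) ℂ)).map (starRingEnd ℂ) := by
      ext i j
      simp [star_apply]
    rw [mem_unitaryGroup_iff, hc, ← Matrix.map_mul]
    simp
  { toFun := fun A => ⟨_, h A⟩
    invFun := fun A => ⟨_, h A⟩
    left_inv := fun A => by ext; simp
    right_inv := fun A => by ext; simp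
    map_mul' := fun A B => Subtype.ext (by simp [Matrix.map_mul]) }

/-- The action of `Gal(ℂ/ℝ) = ℤ/2` on `U(n)` by complex conjugation. -/
def galAction (n : ℕ) : Multiplicative (ZMod 2) →* MulAut (unitaryGroup (Fin n) ℂ) :=
  MonoidHom.mk' (fun a => conjUnitary n ^ (Multiplicative.toAdd a).val) <| by
    have h : conjUnitary n * conjUnitary n = 1 := by
      ext A i j
      simp [conjUnitary]
    intro a b
    change conjUnitary n ^ (Multiplicative.toAdd a + Multiplicative.toAdd b).val = _
    rw [ZMod.val_add, ← pow_eq_pow_mod _ (by rw [pow_two, h]), pow_add]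

/-- The extended unitary group `Ũ(n) = U(n) ⋊ Gal(ℂ/ℝ) = U(n) ∪ U(n) τ`. -/
abbrev ExtUnitary (n : ℕ) : Type :=
  unitaryGroup (Fin n) ℂ ⋊[galAction n] Multiplicative (ZMod 2)

/-- The action of `Ũ(n)` on `ℂⁿ`: the element `A` acts by `z ↦ A z` and `A τ` by `z ↦ A z̄`. -/
noncomputable def ExtUnitary.act {n : ℕ} (u : ExtUnitary n) (z : EuclideanSpace ℂ (Fin n)) :
    EuclideanSpace ℂ (Fin n) :=
  WithLp.toLp 2 ((u.left : Matrix (Fin n) (Fin n) ℂ) *ᵥ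
    (if u.right = 1 then z.ofLp else fun i => starRingEnd ℂ (z i)))

end ExtendedUnitaryGroup

section Representations

/-- The two kinds of structures. -/
inductive StructureKind where
  | real
  | quaternionic

/-- The sign `+1` (real) or `-1` (quaternionic), as an element of `U(n)`. -/
noncomputable def StructureKind.signU (k : StructureKind) (n : ℕ) : unitaryGroup (Fin n) ℂ :=
  match k with
  | real => 1
  | quaternionic => -1

/-- The sign `+1` (real) or `-1` (quaternionic), as a complex number. -/
noncomputable def StructureKind.sign (k : StructureKind) : ℂ :=
  match k with
  | real => 1
  | quaternionic => -1

variable {X : Type*} [TopologicalSpace X] [ChartedSpace ℂ X]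

/-- Real (`k = real`) or quaternionic (`k = quaternionic`) unitary representations of `Γ`: maps
`ρ : Γ → Ũ(n)` over `ℤ/2` with `ρ(a) ρ(b) = ρ(ab)` in the real case, and
`ρ(a) ρ(b) = (-1)^{ξ(a) ξ(b)} ρ(ab)` in the quaternionic case. -/
structure ExtRep (σ : AntiholInvolution X) (x₀ : X) (k : StructureKind) (n : ℕ) where
  toFun : OrbifoldGroup σ x₀ → ExtUnitary n
  right_eq : ∀ a, (toFun a).right = OrbifoldGroup.deg a
  mul_eq : ∀ a b, toFun a * toFun b =
    SemidirectProduct.inl (k.signU n ^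
      ((Multiplicative.toAdd (OrbifoldGroup.deg a)).val *
        (Multiplicative.toAdd (OrbifoldGroup.deg b)).val)) * toFun (a * b)

/-- Equivalence of representations: `ρ'(g) = A ρ(g) A⁻¹` for some `A ∈ U(n)`. -/
def ExtRep.setoid (σ : AntiholInvolution X) (x₀ : X) (k : StructureKind) (n : ℕ) :
    Setoid (ExtRep σ x₀ k n) where
  r ρ ρ' := ∃ A : unitaryGroup (Fin n) ℂ, ∀ g,
    ρ'.toFun g = SemidirectProduct.inl A * ρ.toFun g * (SemidirectProduct.inl A)⁻¹
  iseqv := by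
    refine ⟨fun ρ => ⟨1, fun g => by simp⟩, ?_, ?_⟩
    · rintro ρ ρ' ⟨A, h⟩
      refine ⟨A⁻¹, fun g => ?_⟩
      rw [h, map_inv]
      group
    · rintro ρ ρ' ρ'' ⟨A, h⟩ ⟨B, h'⟩
      refine ⟨B * A, fun g => ?_⟩
      rw [h', h, map_mul]
      group

/-- The set of equivalence classes of real (or quaternionic) unitary representations. -/
abbrev ExtRepClass (σ : AntiholInvolution X) (x₀ : X) (k : StructureKind) (n : ℕ) :=
  Quotient (ExtRep.setoid σ x₀ k n)

end Representations

section Bundles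

/-- A smooth hermitian vector bundle of rank `n` over `X`: smoothness is with respect to the real
manifold underlying `X`, the trivializations are `ℂ`-linear on fibers, and the hermitian metric is
the family of inner products of the fibers (conjugate-linear in the first variable). -/
structure HermBundle (X : Type*) [TopologicalSpace X] [ChartedSpace ℂ X] (n : ℕ) where
  E : X → Type
  [instNormed : ∀ x, NormedAddCommGroup (E x)]
  [instInner : ∀ x, InnerProductSpace ℂ (E x)]
  [instTop : TopologicalSpace (TotalSpace (EuclideanSpace ℂ (Fin n)) E)]
  [instFiber : FiberBundle (EuclideanSpace ℂ (Fin n)) E]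
  [instComplex : VectorBundle ℂ (EuclideanSpace ℂ (Fin n)) E]
  [instReal : VectorBundle ℝ (EuclideanSpace ℂ (Fin n)) E]
  [instSmooth : ContMDiffVectorBundle ∞ (EuclideanSpace ℂ (Fin n)) E 𝓘(ℝ, ℂ)]
  metric_smooth : ∀ s t : ∀ x, E x,
    ContMDiff 𝓘(ℝ, ℂ) (𝓘(ℝ, ℂ).prod 𝓘(ℝ, EuclideanSpace ℂ (Fin n))) ∞
      (fun z => TotalSpace.mk' (EuclideanSpace ℂ (Fin n)) z (s z)) →
    ContMDiff 𝓘(ℝ, ℂ) (𝓘(ℝ, ℂ).prod 𝓘(ℝ, EuclideanSpace ℂ (Fin n))) ∞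
      (fun z => TotalSpace.mk' (EuclideanSpace ℂ (Fin n)) z (t z)) →
    ContMDiff 𝓘(ℝ, ℂ) 𝓘(ℝ, ℂ) ∞ (fun z => inner ℂ (s z) (t z))

attribute [instance] HermBundle.instNormed HermBundle.instInner HermBundle.instTop
  HermBundle.instFiber HermBundle.instComplex HermBundle.instReal HermBundle.instSmooth

variable {X : Type*} [TopologicalSpace X] [ChartedSpace ℂ X] {n : ℕ}

namespace HermBundle

/-- The total space. -/
abbrev Total (V : HermBundle X n) : Type _ := TotalSpace (EuclideanSpace ℂ (Fin n)) V.E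

/-- The point `v ∈ E x` of the total space. -/
abbrev pt (V : HermBundle X n) (x : X) (v : V.E x) : V.Total := ⟨x, v⟩

/-- The model with corners of the total space as a real manifold. -/
noncomputable abbrev totalModel (n : ℕ) := 𝓘(ℝ, ℂ).prod 𝓘(ℝ, EuclideanSpace ℂ (Fin n))

/-- The section `s` is (real) differentiable at `x`. -/
def DiffAt (V : HermBundle X n) (s : ∀ x, V.E x) (x : X) : Prop :=
  MDifferentiableAt 𝓘(ℝ, ℂ) (totalModel n) (fun z => V.pt z (s z)) x

/-- The section `s` is smooth. -/
def Smooth (V : HermBundle X n) (s : ∀ x, V.E x) : Prop :=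
  ContMDiff 𝓘(ℝ, ℂ) (totalModel n) ∞ (fun z => V.pt z (s z))

end HermBundle

variable [IsManifold 𝓘(ℂ, ℂ) ω X]

/-- A smooth vector field on `X`. -/
def IsSmoothVectorField (U : ∀ x : X, TangentSpace 𝓘(ℝ, ℂ) x) : Prop :=
  ContMDiff 𝓘(ℝ, ℂ) 𝓘(ℝ, ℂ).tangent ∞ (fun z => (⟨z, U z⟩ : TangentBundle 𝓘(ℝ, ℂ) X))

/-- A flat unitary vector bundle `(V, ∇)` of rank `n` over `X`: a smooth hermitian bundle with a
smooth `ℂ`-linear connection which preserves the hermitian metric and has zero curvature. In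
`conn s x v`, which is `(∇_v s)(x)`, the value is significant when `s` is differentiable at `x`. -/
structure FlatUnitaryBundle (X : Type*) [TopologicalSpace X] [ChartedSpace ℂ X]
    [IsManifold 𝓘(ℂ, ℂ) ω X] (n : ℕ) extends HermBundle X n where
  conn : CovariantDerivative 𝓘(ℝ, ℂ) (EuclideanSpace ℂ (Fin n)) E
  conn_smooth : CovariantDerivative.ContMDiffCovariantDerivative conn ∞
  conn_smul : ∀ (c : ℂ) (s : ∀ x, E x) (x : X), toHermBundle.DiffAt s x →
    ∀ v : TangentSpace 𝓘(ℝ, ℂ) x, conn (fun z => c • s z) x v = c • conn s x v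
  conn_unitary : ∀ (s t : ∀ x, E x) (x : X), toHermBundle.DiffAt s x → toHermBundle.DiffAt t x →
    ∀ v : TangentSpace 𝓘(ℝ, ℂ) x,
      mvfderiv 𝓘(ℝ, ℂ) (fun z => inner ℂ (s z) (t z)) x v
        = inner ℂ (conn s x v) (t x) + inner ℂ (s x) (conn t x v)
  conn_flat : ∀ (U W : ∀ x : X, TangentSpace 𝓘(ℝ, ℂ) x) (s : ∀ x, E x),
    IsSmoothVectorField U → IsSmoothVectorField W → toHermBundle.Smooth s → ∀ x : X,
      conn (fun z => conn s z (W z)) x (U x) - conn (fun z => conn s z (U z)) x (W x)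
        - conn s x (VectorField.mlieBracket 𝓘(ℝ, ℂ) U W x) = 0

namespace FlatUnitaryBundle

/-- The section `s` is parallel (differentiable with `∇ s = 0`) in a neighbourhood of `x`. -/
def ParallelNear (V : FlatUnitaryBundle X n) (s : ∀ x, V.E x) (x : X) : Prop :=
  ∀ᶠ z in 𝓝 x, V.DiffAt s z ∧ V.conn s z = 0

/-- `w ∈ E y` is the parallel transport `T_γ v` of `v ∈ E x` along the continuous path `γ` from
`x` to `y`: some lift `c` of `γ` goes from `v` to `w` and is locally of the form `s ∘ γ` for a
local parallel section `s`. (For a flat connection such local sections exist through every vector,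
and along smooth paths this is the usual parallel transport.) -/
def Transport (V : FlatUnitaryBundle X n) {x y : X} (γ : Path x y) (v : V.E x) (w : V.E y) :
    Prop :=
  ∃ c : ∀ t : unitInterval, V.E (γ t),
    V.pt (γ 0) (c 0) = V.pt x v ∧ V.pt (γ 1) (c 1) = V.pt y w ∧
    ∀ t, ∃ s : ∀ z, V.E z, V.ParallelNear s (γ t) ∧ ∀ᶠ t' in 𝓝 t, c t' = s (γ t')

end FlatUnitaryBundle

/-- A triple `(V, ∇, σ̃)`: a flat unitary bundle `(V, ∇)` of rank `n`, and a real (`k = real`,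
`σ̃² = 1`) or quaternionic (`k = quaternionic`, `σ̃² = -1`) structure `σ̃` on `V`, that is a smooth
lift of `σ` to `V`, antilinear on fibers, for which `∇` is equivariant: if the section `t` is the
image `σ̃ ∘ s ∘ σ` of the section `s`, then `∇_{dσ(v)} t = σ̃ (∇_v s)`. -/
structure FlatTriple (σ : AntiholInvolution X) (k : StructureKind) (n : ℕ)
    extends FlatUnitaryBundle X n where
  lift : ∀ x, E x →ₛₗ[starRingEnd ℂ] E (σ x)
  lift_smooth : ContMDiff (HermBundle.totalModel n) (HermBundle.totalModel n) ∞
    (fun p : toHermBundle.Total => toHermBundle.pt (σ p.proj) (lift p.proj p.snd))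
  lift_lift : ∀ (x : X) (v : E x),
    toHermBundle.pt (σ (σ x)) (lift (σ x) (lift x v)) = toHermBundle.pt x (k.sign • v)
  conn_equivariant : ∀ (s t : ∀ x, E x), (∀ x, t (σ x) = lift x (s x)) →
    ∀ x : X, toHermBundle.DiffAt s x → ∀ v : TangentSpace 𝓘(ℝ, ℂ) x,
      conn t (σ x) (mfderiv 𝓘(ℝ, ℂ) 𝓘(ℝ, ℂ) σ x v) = lift x (conn s x v)

namespace FlatTriple

variable {σ : AntiholInvolution X} {k : StructureKind}

/-- `Φ` is an isomorphism of triples: a smooth isomorphism of complex vector bundles over `X`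
that preserves the connections and intertwines the lifts of `σ`. -/
structure IsIso (V V' : FlatTriple σ k n) (Φ : ∀ x, V.E x ≃ₗ[ℂ] V'.E x) : Prop where
  smooth : ContMDiff (HermBundle.totalModel n) (HermBundle.totalModel n) ∞
    (fun p : V.Total => V'.pt p.proj (Φ p.proj p.snd))
  smooth_symm : ContMDiff (HermBundle.totalModel n) (HermBundle.totalModel n) ∞
    (fun p : V'.Total => V.pt p.proj ((Φ p.proj).symm p.snd))
  conn : ∀ (s : ∀ x, V.E x) (x : X), V.DiffAt s x → ∀ v : TangentSpace 𝓘(ℝ, ℂ) x,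
    V'.conn (fun z => Φ z (s z)) x v = Φ x (V.conn s x v)
  lift : ∀ (x : X) (v : V.E x), Φ (σ x) (V.lift x v) = V'.lift x (Φ x v)

/-- `Φ` preserves the hermitian metrics. -/
def IsometricOnFibers (V V' : FlatTriple σ k n) (Φ : ∀ x, V.E x ≃ₗ[ℂ] V'.E x) : Prop :=
  ∀ (x : X) (v w : V.E x), inner ℂ (Φ x v) (Φ x w) = inner ℂ v w

/-- The lift `σ̃` is antiunitary for the hermitian metric. -/
def Antiunitary (V : FlatTriple σ k n) : Prop :=
  ∀ (x : X) (v w : V.E x), inner ℂ (V.lift x v) (V.lift x w) = inner ℂ w v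

theorem IsIso.refl (V : FlatTriple σ k n) : IsIso V V (fun _ => LinearEquiv.refl ℂ _) :=
  ⟨contMDiff_id, contMDiff_id, fun _ _ _ _ => rfl, fun _ _ => rfl⟩

theorem IsIso.trans {V V' V'' : FlatTriple σ k n} {Φ : ∀ x, V.E x ≃ₗ[ℂ] V'.E x}
    {Ψ : ∀ x, V'.E x ≃ₗ[ℂ] V''.E x} (h : IsIso V V' Φ) (h' : IsIso V' V'' Ψ) :
    IsIso V V'' (fun x => (Φ x).trans (Ψ x)) where
  smooth := h'.smooth.comp h.smooth
  smooth_symm := h.smooth_symm.comp h'.smooth_symm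
  conn s x hs v := by
    have h1 : V'.DiffAt (fun z => Φ z (s z)) x :=
      ((h.smooth.mdifferentiable (by simp)) _).comp x hs
    have h2 := h'.conn _ x h1 v
    rw [h.conn s x hs v] at h2
    exact h2
  lift x v := by
    simp only [LinearEquiv.trans_apply]
    rw [h.lift, h'.lift]

theorem IsIso.symm {V V' : FlatTriple σ k n} {Φ : ∀ x, V.E x ≃ₗ[ℂ] V'.E x}
    (h : IsIso V V' Φ) : IsIso V' V (fun x => (Φ x).symm) where
  smooth := h.smooth_symm
  smooth_symm := h.smooth
  conn s x hs v := by
    have h1 : V.DiffAt (fun z => (Φ z).symm (s z)) x :=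
      ((h.smooth_symm.mdifferentiable (by simp)) _).comp x hs
    have h2 := h.conn _ x h1 v
    simp only [LinearEquiv.apply_symm_apply] at h2
    rw [LinearEquiv.eq_symm_apply]
    exact h2.symm
  lift x v := by
    rw [LinearEquiv.symm_apply_eq, h.lift, LinearEquiv.apply_symm_apply]

/-- Isomorphism of triples `(V, ∇, σ̃)`. -/
def setoid (σ : AntiholInvolution X) (k : StructureKind) (n : ℕ) :
    Setoid (FlatTriple σ k n) where
  r V V' := ∃ Φ : ∀ x, V.E x ≃ₗ[ℂ] V'.E x, IsIso V V' Φ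
  iseqv := ⟨fun V => ⟨_, IsIso.refl V⟩, fun ⟨_, h⟩ => ⟨_, h.symm⟩,
    fun ⟨_, h⟩ ⟨_, h'⟩ => ⟨_, h.trans h'⟩⟩

/-- Isometric isomorphism of triples `(V, ∇, σ̃)` with antiunitary `σ̃`. -/
def setoidAntiunitary (σ : AntiholInvolution X) (k : StructureKind) (n : ℕ) :
    Setoid {V : FlatTriple σ k n // V.Antiunitary} where
  r V V' := ∃ Φ : ∀ x, V.1.E x ≃ₗ[ℂ] V'.1.E x, IsIso V.1 V'.1 Φ ∧ IsometricOnFibers V.1 V'.1 Φ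
  iseqv := by
    refine ⟨fun V => ⟨_, IsIso.refl V.1, fun _ _ _ => rfl⟩, ?_, ?_⟩
    · rintro V V' ⟨Φ, h, hm⟩
      refine ⟨_, h.symm, fun x v w => ?_⟩
      rw [← hm, LinearEquiv.apply_symm_apply, LinearEquiv.apply_symm_apply]
    · rintro V V' V'' ⟨Φ, h, hm⟩ ⟨Ψ, h', hm'⟩
      exact ⟨_, h.trans h', fun x v w => (hm' x _ _).trans (hm x v w)⟩

/-- The isomorphism classes of triples `(V, ∇, σ̃)`. -/
abbrev IsoClass (σ : AntiholInvolution X) (k : StructureKind) (n : ℕ) :=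
  Quotient (FlatTriple.setoid σ k n)

/-- The isometric isomorphism classes of triples `(V, ∇, σ̃)` with antiunitary `σ̃`. -/
abbrev UnitaryIsoClass (σ : AntiholInvolution X) (k : StructureKind) (n : ℕ) :=
  Quotient (FlatTriple.setoidAntiunitary σ k n)

/-- `ρ` is the monodromy representation of `(V, ∇, σ̃)` in the frame `φ` of the fiber at `x₀`:
`ρ(γ) = T_γ` for the loops `γ` at `x₀`, and `ρ(γ) = σ̃_{x₀}⁻¹ T_γ` for the paths `γ` from `x₀` to
`σ x₀`. -/
def HasMonodromy (V : FlatTriple σ k n) {x₀ : X} (φ : EuclideanSpace ℂ (Fin n) ≃ₗ[ℂ] V.E x₀)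
    (ρ : ExtRep σ x₀ k n) : Prop :=
  (∀ (γ : Path x₀ x₀) (z : EuclideanSpace ℂ (Fin n)),
    V.Transport γ (φ z)
      (φ ((ρ.toFun (OrbifoldGroup.loop (Path.Homotopic.Quotient.mk γ))).act z))) ∧
  (∀ (γ : Path x₀ (σ x₀)) (z : EuclideanSpace ℂ (Fin n)),
    V.Transport γ (φ z)
      (V.lift x₀ (φ ((ρ.toFun (OrbifoldGroup.path (Path.Homotopic.Quotient.mk γ))).act z))))

end FlatTriple

end Bundles

/-! This is the Riemann–Hilbert correspondence between flat bundles and monodromy, with the lift of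
σ carried along. The relation "ρ is the monodromy of (V, ∇, σ̃) in some frame of the fiber at x₀" is
shown to be total in both directions and single-valued up to equivalence; `exists_bijective_of_rel`
turns such a relation into a bijection of quotients.

From bundles to representations. Zero curvature is the integrability condition for local parallel
frames (`exists_parallel_frame_of_flat`); since ∇ preserves h, these can be taken unitary
(`exists_isFlatFrameOn`). Transition maps between flat frames are locally constant, so germs of
parallel sections form a covering space of X, and its monodromy is parallel transport, defined on
homotopy classes of continuous paths (`transport_iff`). Equivariance of ∇ gives T_{σ(γ)} σ̃ = σ̃ T_γ
(`transportIso_map`). With functoriality of transport this yields the multiplication law of Γ, and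
the sign of a quaternionic ρ is the sign of σ̃² (`exists_hasMonodromy`).

In the plain category σ̃ need not be antiunitary for h. Averaging h(v, w) with h(σ̃w, σ̃v) on the
fiber at x₀ gives an inner product invariant under all the monodromy, and a frame orthonormal for it
makes ρ unitary (`exists_frame_hasMonodromy`). Two such frames differ by a linear intertwiner only;
its unitary polar part intertwines the same representations, also on the antiunitary elements
(`exists_unitary_part`).

From representations to bundles. A vector over x is a class [q, z], with q a path class from x₀ to x
and z in ℂⁿ, modulo [γq, z] = [q, ρ(γ)z], where γq runs first through the loop γ and then through q.
Concretely, a cover by coordinate balls with compatible path classes gives a locally constant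
unitary cocycle (`PathCover.cocycle`), whose connection is differentiation in the frames. A fixed
path β from x₀ to σ(x₀) defines σ̃[q, z] = ±[β⁻¹σ(q), ρ(β)z], where β⁻¹ is the inverse in Γ and the
sign is that of the structure; the law of ρ makes this well defined with the right square
(`lift_frame`, `lift_lift`).

Finally, transport of φ'φ⁻¹ from x₀ to the other points is path independent when two triples have
the same monodromy. It is constant in flat frames, hence an isomorphism
(`HasMonodromy.exists_isIso`). -/

/-! ### The Frobenius theorem for linear systems: zero curvature gives a parallel frame. -/

section LinearFrobenius

variable {E 𝒜 : Type*} [NormedAddCommGroup E] [NormedSpace ℝ E] [NormedRing 𝒜] [NormedAlgebra ℝ 𝒜]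

/-- Solutions of the linear equation `s' = -η(tv)(v) s` along a short ray. -/
theorem exists_solution_along_ray [CompleteSpace 𝒜] {η : E → E →L[ℝ] 𝒜} {r C : ℝ} (hr : 0 < r) (hC : 0 ≤ C)
    (hη : ContinuousOn η (Metric.ball 0 r)) (hηC : ∀ z ∈ Metric.ball (0 : E) r, ‖η z‖ ≤ C)
    (hCr : C * r * (‖(1 : 𝒜)‖ + 1) ≤ 1) {v : E} (hv : v ∈ Metric.ball (0 : E) r) :
    ∃ s : ℝ → 𝒜, s 0 = 1 ∧ (v = 0 → s 1 = 1) ∧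
      ∀ t ∈ Set.Icc (0 : ℝ) 1, HasDerivWithinAt s (-(η (t • v) v * s t)) (Set.Icc 0 1) t := by
  -- At v = 0 the constant solution is picked by hand, so that s 1 = 1 needs no uniqueness argument.
  -- It normalizes the parallel frame at the origin.
  rcases eq_or_ne v 0 with rfl | hv0
  · exact ⟨fun _ => 1, rfl, fun _ => rfl, fun t _ => by
      simpa using hasDerivWithinAt_const t (Set.Icc (0 : ℝ) 1) (1 : 𝒜)⟩
  have hmem : ∀ t ∈ Set.Icc (0 : ℝ) 1, t • v ∈ Metric.ball (0 : E) r := fun t ht => by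
    rw [mem_ball_zero_iff] at hv ⊢
    rw [norm_smul, Real.norm_of_nonneg ht.1]
    nlinarith [ht.2, norm_nonneg v]
  have hb : ∀ t ∈ Set.Icc (0 : ℝ) 1, ‖η (t • v) v‖ ≤ C * r := fun t ht => by
    refine ((η (t • v)).le_opNorm v).trans ?_
    exact mul_le_mul (hηC _ (hmem t ht)) (mem_ball_zero_iff.1 hv).le (norm_nonneg _) hC
  have h1 : C * r ≤ 1 := by nlinarith [norm_nonneg (1 : 𝒜), mul_nonneg hC hr.le]
  -- The solution is kept in the ball of radius 1 about 1, where ‖x‖ ≤ ‖1‖ + 1. There `hCr` bounds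
  -- the speed by 1, which over unit time does not leave the ball; the Lipschitz constant C r is at
  -- most 1.
  have hpl : IsPicardLindelof (fun t x => -(η (t • v) v * x)) (tmin := 0) (tmax := 1)
      ⟨0, by simp⟩ (1 : 𝒜) 1 0 1 1 := by
    refine ⟨fun t ht => LipschitzOnWith.of_dist_le_mul fun x _ y _ => ?_, fun x _ => ?_,
      fun t ht x hx => ?_, by simp⟩
    · rw [dist_eq_norm, dist_eq_norm, neg_sub_neg, ← mul_sub, NNReal.coe_one, one_mul,
        norm_sub_rev x y]
      refine (norm_mul_le _ _).trans ?_
      nlinarith [hb t ht, norm_nonneg (y - x)]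
    · refine ((ContinuousOn.clm_apply (hη.comp (by fun_prop) hmem) continuousOn_const).mul
        continuousOn_const).neg
    · have hx' : ‖x‖ ≤ ‖(1 : 𝒜)‖ + 1 := by
        have := norm_le_norm_add_norm_sub' x (1 : 𝒜)
        rw [mem_closedBall_iff_norm] at hx
        simp only [NNReal.coe_one] at hx
        linarith
      rw [norm_neg, NNReal.coe_one]
      refine (norm_mul_le _ _).trans (le_trans ?_ hCr)
      exact mul_le_mul (hb t ht) hx' (norm_nonneg _) (mul_nonneg hC hr.le)
  obtain ⟨s, hs0, hs⟩ := hpl.exists_eq_forall_mem_Icc_hasDerivWithinAt₀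
  exact ⟨s, hs0, fun h => (hv0 h).elim, hs⟩

/-- A second order Taylor estimate for a map with Lipschitz derivative on a ball. -/
theorem norm_taylor_le_of_lipschitz {G : Type*} [NormedAddCommGroup G] [NormedSpace ℝ G]
    {f : E → G} {r M : ℝ} (hf : ∀ z ∈ Metric.ball (0 : E) r, DifferentiableAt ℝ f z)
    (hM : 0 ≤ M)
    (hL : ∀ z ∈ Metric.ball (0 : E) r, ∀ w ∈ Metric.ball (0 : E) r,
      ‖fderiv ℝ f w - fderiv ℝ f z‖ ≤ M * ‖w - z‖)
    {z w : E} (hz : z ∈ Metric.ball (0 : E) r) (hw : w ∈ Metric.ball (0 : E) r) :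
    ‖f w - f z - fderiv ℝ f z (w - z)‖ ≤ M * ‖w - z‖ * ‖w - z‖ := by
  have hseg : segment ℝ z w ⊆ Metric.ball (0 : E) r := (convex_ball _ _).segment_subset hz hw
  refine Convex.norm_image_sub_le_of_norm_hasFDerivWithin_le' (s := segment ℝ z w)
    (fun x hx => (hf x (hseg hx)).hasFDerivAt.hasFDerivWithinAt) (fun x hx => ?_)
    (convex_segment z w) (left_mem_segment ℝ z w) (right_mem_segment ℝ z w)
  refine (hL z hz x (hseg hx)).trans (mul_le_mul_of_nonneg_left ?_ hM)
  obtain ⟨t, ht, rfl⟩ := (segment_eq_image' ℝ z w ▸ hx : x ∈ _)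
  rw [add_sub_cancel_left, norm_smul, Real.norm_of_nonneg ht.1]
  nlinarith [ht.2, norm_nonneg (w - z)]

/-- The curvature `dη + η ∧ η` of the matrix-valued one-form `η`. -/
noncomputable def formCurvature (η : E → E →L[ℝ] 𝒜) (z u v : E) : 𝒜 :=
  fderiv ℝ η z u v - fderiv ℝ η z v u + (η z u * η z v - η z v * η z u)

/-- The expected first-order prediction along the ray is s_{v+h}(t) ≈ s_v(t) − η(tv)(th) s_v(t). Its
error e vanishes at t = 0 and satisfies e' = −P e + O(‖h‖²), because zero curvature cancels the
terms linear in h. Grönwall then gives e(1) = O(‖h‖²), which is differentiability at v. -/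
theorem hasFDerivAt_of_radial_solutions {η : E → E →L[ℝ] 𝒜} {r C L M : ℝ}
    (hC : 0 ≤ C) (hL0 : 0 ≤ L) (hM : 0 ≤ M) (hCr : C * r ≤ 1)
    (hηC : ∀ z ∈ Metric.ball (0 : E) r, ‖η z‖ ≤ C)
    (hηd : ∀ z ∈ Metric.ball (0 : E) r, DifferentiableAt ℝ η z)
    (hηL : ∀ z ∈ Metric.ball (0 : E) r, ∀ w ∈ Metric.ball (0 : E) r,
      ‖η w - η z‖ ≤ L * ‖w - z‖)
    (hηM : ∀ z ∈ Metric.ball (0 : E) r, ∀ w ∈ Metric.ball (0 : E) r,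
      ‖fderiv ℝ η w - fderiv ℝ η z‖ ≤ M * ‖w - z‖)
    (hflat : ∀ z ∈ Metric.ball (0 : E) r, ∀ u v, formCurvature η z u v = 0)
    {s : E → ℝ → 𝒜} (hs0 : ∀ v ∈ Metric.ball (0 : E) r, s v 0 = 1)
    (hs : ∀ v ∈ Metric.ball (0 : E) r, ∀ t ∈ Set.Icc (0 : ℝ) 1,
      HasDerivWithinAt (s v) (-(η (t • v) v * s v t)) (Set.Icc 0 1) t)
    {v : E} (hv : v ∈ Metric.ball (0 : E) r) :
    HasFDerivAt (fun w => s w 1) (-((ContinuousLinearMap.mul ℝ 𝒜).flip (s v 1) ∘L η v)) v := by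
  have hsmul : ∀ t ∈ Set.Icc (0 : ℝ) 1, ∀ w ∈ Metric.ball (0 : E) r,
      t • w ∈ Metric.ball (0 : E) r := fun t ht w hw => by
    rw [mem_ball_zero_iff] at hw ⊢
    rw [norm_smul, Real.norm_of_nonneg ht.1]
    nlinarith [ht.2, norm_nonneg w]
  obtain ⟨S, hS⟩ : ∃ S, ∀ t ∈ Set.Icc (0 : ℝ) 1, ‖s v t‖ ≤ S :=
    isCompact_Icc.exists_bound_of_continuousOn
      (fun t ht => (hs v hv t ht).continuousWithinAt)
  have hS0 : 0 ≤ S := (norm_nonneg _).trans (hS 0 (by simp))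
  have hr0 : 0 ≤ r := (norm_nonneg v).trans (mem_ball_zero_iff.1 hv).le
  -- The two summands bound the contributions of Q and of D below, where S bounds the solution along
  -- the ray through v.
  set K₀ : ℝ := (M * r + L) * S + (L * r + C) * C * S with hK₀
  have key : ∀ h : E, v + h ∈ Metric.ball (0 : E) r →
      ‖s (v + h) 1 - s v 1 + η v h * s v 1‖ ≤ K₀ * (Real.exp 1 - 1) * ‖h‖ ^ 2 := by
    intro h hvh
    let e : ℝ → 𝒜 := fun t => s (v + h) t - s v t + η (t • v) (t • h) * s v t
    let P : ℝ → 𝒜 := fun t => η (t • (v + h)) (v + h)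
    let e' : ℝ → 𝒜 := fun t => -(P t * s (v + h) t) + η (t • v) v * s v t
      + ((fderiv ℝ η (t • v) v (t • h) + η (t • v) h) * s v t
        - η (t • v) (t • h) * (η (t • v) v * s v t))
    have he : ∀ t ∈ Set.Icc (0 : ℝ) 1, HasDerivWithinAt e (e' t) (Set.Icc 0 1) t := by
      intro t ht
      have hlin : HasDerivWithinAt (fun t : ℝ => t • v) v (Set.Icc 0 1) t := by
        simpa using (hasDerivWithinAt_id t _).smul_const v
      have hlin' : HasDerivWithinAt (fun t : ℝ => t • h) h (Set.Icc 0 1) t := by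
        simpa using (hasDerivWithinAt_id t _).smul_const h
      have h1 : HasDerivWithinAt (fun t : ℝ => η (t • v)) (fderiv ℝ η (t • v) v)
          (Set.Icc 0 1) t :=
        (hηd _ (hsmul t ht v hv)).hasFDerivAt.comp_hasDerivWithinAt t hlin
      have h2 := (h1.clm_apply hlin').mul (hs v hv t ht)
      have h3 := ((hs (v + h) hvh t ht).sub (hs v hv t ht)).add h2
      refine h3.congr_deriv ?_
      simp only [e', P, sub_neg_eq_add, mul_neg]
      abel
    have hbound : ∀ t ∈ Set.Icc (0 : ℝ) 1, ‖e' t‖ ≤ 1 * ‖e t‖ + K₀ * ‖h‖ ^ 2 := by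
      intro t ht
      have htv := hsmul t ht v hv
      have htvh := hsmul t ht _ hvh
      have hth : ‖t • h‖ ≤ ‖h‖ := by
        rw [norm_smul, Real.norm_of_nonneg ht.1]
        nlinarith [ht.2, norm_nonneg h]
      have hsub : t • (v + h) - t • v = t • h := by rw [smul_add, add_sub_cancel_left]
      -- Flatness enters here: it exchanges the arguments of dη, so that differentiating the
      -- prediction in t becomes a derivative of η in the direction th, at the cost of a commutator.
      have hfl : fderiv ℝ η (t • v) v (t • h) = fderiv ℝ η (t • v) (t • h) v
          - (η (t • v) v * η (t • v) (t • h) - η (t • v) (t • h) * η (t • v) v) := by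
        have := hflat _ htv v (t • h)
        rw [formCurvature] at this
        rw [← sub_eq_zero, ← this]
        abel
      let Q : 𝒜 := (η (t • (v + h)) - η (t • v) - fderiv ℝ η (t • v) (t • h)) v
        + (η (t • (v + h)) - η (t • v)) h
      let D : 𝒜 := (η (t • (v + h)) - η (t • v)) v + η (t • (v + h)) h
      -- Q is a second-order Taylor remainder of η in the direction v plus a first difference
      -- applied to h; D is P t − η(tv)v. So Q = O(‖h‖²), and D and η(tv)(th) are each O(‖h‖).
      have hid : e' t = -(P t * e t) + (-(Q * s v t) + D * (η (t • v) (t • h) * s v t)) := by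
        simp only [e', P, e, Q, D, hfl, map_add, _root_.sub_apply]
        noncomm_ring
      have hd : ‖η (t • (v + h)) - η (t • v)‖ ≤ L * ‖h‖ := by
        refine (hηL _ htv _ htvh).trans ?_
        rw [hsub]
        exact mul_le_mul_of_nonneg_left hth hL0
      have hvr : ‖v‖ ≤ r := (mem_ball_zero_iff.1 hv).le
      have hP : ‖P t‖ ≤ 1 := by
        refine ((η _).le_opNorm _).trans (le_trans ?_ hCr)
        exact mul_le_mul (hηC _ htvh) (mem_ball_zero_iff.1 hvh).le (norm_nonneg _) hC
      have hQ : ‖Q‖ ≤ (M * r + L) * ‖h‖ ^ 2 := by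
        have h1 : ‖η (t • (v + h)) - η (t • v) - fderiv ℝ η (t • v) (t • h)‖
            ≤ M * ‖h‖ ^ 2 := by
          have := norm_taylor_le_of_lipschitz hηd hM hηM htv htvh
          rw [hsub] at this
          refine this.trans ?_
          rw [mul_assoc, sq]
          exact mul_le_mul_of_nonneg_left
            (mul_le_mul hth hth (norm_nonneg _) (norm_nonneg _)) hM
        calc ‖Q‖ ≤ M * ‖h‖ ^ 2 * r + L * ‖h‖ * ‖h‖ := by
              refine norm_add_le_of_le ?_ ?_
              · exact (ContinuousLinearMap.le_opNorm _ _).trans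
                  (mul_le_mul h1 hvr (norm_nonneg _) (by positivity))
              · exact (ContinuousLinearMap.le_opNorm _ _).trans
                  (mul_le_mul_of_nonneg_right hd (norm_nonneg _))
          _ = _ := by ring
      have hD : ‖D‖ ≤ (L * r + C) * ‖h‖ := by
        calc ‖D‖ ≤ L * ‖h‖ * r + C * ‖h‖ := by
              refine norm_add_le_of_le ?_ ?_
              · exact (ContinuousLinearMap.le_opNorm _ _).trans
                  (mul_le_mul hd hvr (norm_nonneg _) (by positivity))
              · exact (ContinuousLinearMap.le_opNorm _ _).trans
                  (mul_le_mul_of_nonneg_right (hηC _ htvh) (norm_nonneg _))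
          _ = _ := by ring
      have hst := hS t ht
      have hη' : ‖η (t • v) (t • h)‖ ≤ C * ‖h‖ :=
        ((η _).le_opNorm _).trans (mul_le_mul (hηC _ htv) hth (norm_nonneg _) hC)
      rw [hid]
      refine norm_add_le_of_le ?_ ?_
      · rw [norm_neg]
        exact (norm_mul_le _ _).trans (mul_le_mul_of_nonneg_right hP (norm_nonneg _))
      · calc _ ≤ (M * r + L) * ‖h‖ ^ 2 * S + (L * r + C) * ‖h‖ * (C * ‖h‖ * S) := by
              refine norm_add_le_of_le ?_ ?_
              · rw [norm_neg]
                exact (norm_mul_le _ _).trans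
                  (mul_le_mul hQ hst (norm_nonneg _) (by positivity))
              · refine (norm_mul_le _ _).trans
                  (mul_le_mul hD ?_ (norm_nonneg _) (by positivity))
                exact (norm_mul_le _ _).trans
                  (mul_le_mul hη' hst (norm_nonneg _) (by positivity))
          _ = _ := by rw [hK₀]; ring
    have hg := norm_le_gronwallBound_of_norm_deriv_right_le (f := e) (f' := e') (δ := 0) (K := 1)
      (ε := K₀ * ‖h‖ ^ 2) (a := 0) (b := 1) (fun t ht => (he t ht).continuousWithinAt)
      (fun t ht => (he t (Set.Ico_subset_Icc_self ht)).mono_of_mem_nhdsWithin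
        (Icc_mem_nhdsGE_of_mem ht))
      (by simp [e, hs0 v hv, hs0 _ hvh]) (fun t ht => hbound t (Set.Ico_subset_Icc_self ht))
      1 (by simp)
    have he1 : e 1 = s (v + h) 1 - s v 1 + η v h * s v 1 := by simp [e]
    rw [he1, gronwallBound_of_K_ne_0 one_ne_zero] at hg
    refine hg.trans (le_of_eq ?_)
    simp
    ring
  rw [hasFDerivAt_iff_isLittleO_nhds_zero]
  refine Asymptotics.IsBigO.trans_isLittleO (g := fun h : E => ‖h‖ ^ 2)
    (Asymptotics.IsBigO.of_bound (K₀ * (Real.exp 1 - 1)) ?_) (by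
      simpa using Asymptotics.isLittleO_norm_pow_id (E' := E) one_lt_two)
  have hnear : ∀ᶠ h : E in 𝓝 0, v + h ∈ Metric.ball (0 : E) r :=
    (continuous_const.add continuous_id).continuousAt.eventually
      (Metric.isOpen_ball.mem_nhds (by simpa using hv))
  filter_upwards [hnear] with h hh
  have := key h hh
  rw [Real.norm_of_nonneg (by positivity)]
  simpa [sub_neg_eq_add] using this

/-- A flat matrix-valued one-form has a local parallel frame. -/
theorem exists_parallel_frame_of_flat [CompleteSpace 𝒜] {η : E → E →L[ℝ] 𝒜} (hη : ContDiffAt ℝ 2 η 0)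
    (hflat : ∀ᶠ z in 𝓝 0, ∀ u v, formCurvature η z u v = 0) :
    ∃ g : E → 𝒜, g 0 = 1 ∧ ∀ᶠ z in 𝓝 0,
      HasFDerivAt g (-((ContinuousLinearMap.mul ℝ 𝒜).flip (g z) ∘L η z)) z := by
  obtain ⟨L, tL, htL, hL⟩ := (hη.of_le one_le_two).exists_lipschitzOnWith
  obtain ⟨M, tM, htM, hM⟩ := (hη.fderiv_right (m := 1) (by norm_num)).exists_lipschitzOnWith
  have hd : ∀ᶠ z in 𝓝 (0 : E), DifferentiableAt ℝ η z :=
    (hη.eventually (by simp)).mono fun z hz => hz.differentiableAt (by simp)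
  set C := ‖η 0‖ + 1
  have hC : ∀ᶠ z in 𝓝 (0 : E), ‖η z‖ ≤ C :=
    (hη.continuousAt.norm.eventually (gt_mem_nhds (lt_add_one _))).mono fun z hz => le_of_lt hz
  obtain ⟨ε, hε, hball⟩ := Metric.eventually_nhds_iff_ball.1
    (hflat.and ((eventually_mem_set.2 htL).and ((eventually_mem_set.2 htM).and (hd.and hC))))
  have hC0 : 0 < C := by positivity
  -- The second bound is what Picard–Lindelöf on the whole interval [0, 1] demands.
  set r := min ε (1 / (C * (‖(1 : 𝒜)‖ + 1))) with hr
  have hr0 : 0 < r := lt_min hε (by positivity)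
  have hsub : Metric.ball (0 : E) r ⊆ Metric.ball 0 ε := Metric.ball_subset_ball (min_le_left _ _)
  have hCr : C * r * (‖(1 : 𝒜)‖ + 1) ≤ 1 := by
    have := (le_div_iff₀ (by positivity)).1 (hr ▸ min_le_right ε (1 / (C * (‖(1 : 𝒜)‖ + 1))))
    linarith
  have hCr' : C * r ≤ 1 := by nlinarith [norm_nonneg (1 : 𝒜), mul_pos hC0 hr0]
  have hcont : ContinuousOn η (Metric.ball 0 r) := fun z hz =>
    (hball z (hsub hz)).2.2.2.1.continuousAt.continuousWithinAt
  have hex : ∀ v : E, ∃ s : ℝ → 𝒜, v ∈ Metric.ball (0 : E) r → s 0 = 1 ∧ (v = 0 → s 1 = 1) ∧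
      ∀ t ∈ Set.Icc (0 : ℝ) 1, HasDerivWithinAt s (-(η (t • v) v * s t)) (Set.Icc 0 1) t := by
    intro v
    by_cases hv : v ∈ Metric.ball (0 : E) r
    · obtain ⟨s, h⟩ := exists_solution_along_ray hr0 hC0.le hcont
        (fun z hz => (hball z (hsub hz)).2.2.2.2) hCr hv
      exact ⟨s, fun _ => h⟩
    · exact ⟨0, fun h => (hv h).elim⟩
  choose s hs using hex
  refine ⟨fun v => s v 1, (hs 0 (Metric.mem_ball_self hr0)).2.1 rfl, ?_⟩
  filter_upwards [Metric.ball_mem_nhds (0 : E) hr0] with v hv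
  refine hasFDerivAt_of_radial_solutions (C := C) (L := L) (M := M) hC0.le L.2 M.2 hCr'
    (fun z hz => (hball z (hsub hz)).2.2.2.2) (fun z hz => (hball z (hsub hz)).2.2.2.1)
    (fun z hz w hw => ?_) (fun z hz w hw => ?_) (fun z hz => (hball z (hsub hz)).1)
    (fun w hw => (hs w hw).1) (fun w hw => (hs w hw).2.2) hv
  · simpa [dist_eq_norm] using hL.dist_le_mul w (hball w (hsub hw)).2.1 z (hball z (hsub hz)).2.1
  · simpa [dist_eq_norm] using
      hM.dist_le_mul w (hball w (hsub hw)).2.2.1 z (hball z (hsub hz)).2.2.1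

end LinearFrobenius


/-- The model fiber `ℂⁿ`. -/
abbrev ModelFiber (n : ℕ) := EuclideanSpace ℂ (Fin n)

/-! ### Smooth frames and the connection in a frame. -/

section Frames

variable {X : Type*} [TopologicalSpace X] [ChartedSpace ℂ X] {n : ℕ}

namespace HermBundle

/-- `G` is a smooth frame of `V` over `U`. -/
structure IsFrameOn (V : HermBundle X n) (G : ∀ x, ModelFiber n ≃ₗ[ℂ] V.E x) (U : Set X) :
    Prop where
  contMDiffAt : ∀ x ∈ U, ∀ w : ModelFiber n,
    ContMDiffAt (𝓘(ℝ, ℂ).prod 𝓘(ℝ, ModelFiber n)) (totalModel n) ∞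
      (fun p : X × ModelFiber n => V.pt p.1 (G p.1 p.2)) (x, w)
  contMDiffAt_symm : ∀ p : V.Total, p.proj ∈ U →
    ContMDiffAt (totalModel n) 𝓘(ℝ, ModelFiber n) ∞
      (fun p : V.Total => (G p.proj).symm p.snd) p

variable {V : HermBundle X n}

namespace IsFrameOn

variable {G : ∀ x, ModelFiber n ≃ₗ[ℂ] V.E x} {U : Set X}

theorem mono {U' : Set X} (hG : V.IsFrameOn G U) (h : U' ⊆ U) : V.IsFrameOn G U' :=
  ⟨fun x hx => hG.1 x (h hx), fun p hp => hG.2 p (h hp)⟩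

theorem diffAt_apply (hG : V.IsFrameOn G U) {x : X} (hx : x ∈ U) {f : X → ModelFiber n}
    (hf : MDifferentiableAt 𝓘(ℝ, ℂ) 𝓘(ℝ, ModelFiber n) f x) : V.DiffAt (fun z => G z (f z)) x :=
  ((hG.contMDiffAt x hx (f x)).mdifferentiableAt (by simp)).comp x
    (f := fun z => (z, f z)) (mdifferentiableAt_id.prodMk hf)

theorem diffAt_iff (hG : V.IsFrameOn G U) {x : X} (hx : x ∈ U) {s : ∀ x, V.E x} :
    V.DiffAt s x ↔
      MDifferentiableAt 𝓘(ℝ, ℂ) 𝓘(ℝ, ModelFiber n) (fun z => (G z).symm (s z)) x := by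
  refine ⟨fun h => ?_, fun h => ?_⟩
  · exact ((hG.contMDiffAt_symm (V.pt x (s x)) hx).mdifferentiableAt (by simp)).comp x h
  · simpa using hG.diffAt_apply hx h

theorem contMDiffAt_apply (hG : V.IsFrameOn G U) {x : X} (hx : x ∈ U) {f : X → ModelFiber n}
    (hf : ContMDiffAt 𝓘(ℝ, ℂ) 𝓘(ℝ, ModelFiber n) ∞ f x) :
    ContMDiffAt 𝓘(ℝ, ℂ) (totalModel n) ∞ (fun z => V.pt z (G z (f z))) x :=
  (hG.contMDiffAt x hx (f x)).comp x (f := fun z => (z, f z)) (contMDiffAt_id.prodMk hf)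

theorem contMDiffAt_coord (hG : V.IsFrameOn G U) {x : X} (hx : x ∈ U) {s : ∀ x, V.E x}
    (hs : ContMDiffAt 𝓘(ℝ, ℂ) (totalModel n) ∞ (fun z => V.pt z (s z)) x) :
    ContMDiffAt 𝓘(ℝ, ℂ) 𝓘(ℝ, ModelFiber n) ∞ (fun z => (G z).symm (s z)) x :=
  (hG.contMDiffAt_symm (V.pt x (s x)) hx).comp x hs

end IsFrameOn

theorem finrank_fiber (V : HermBundle X n) (x : X) : Module.finrank ℂ (V.E x) = n := by
  rw [((trivializationAt (ModelFiber n) V.E x).linearEquivAt ℂ x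
    (mem_baseSet_trivializationAt _ _ x)).finrank_eq, finrank_euclideanSpace_fin]

instance finiteDimensional_fiber (V : HermBundle X n) (x : X) : FiniteDimensional ℂ (V.E x) :=
  ((trivializationAt (ModelFiber n) V.E x).linearEquivAt ℂ x
    (mem_baseSet_trivializationAt _ _ x)).symm.finiteDimensional

theorem nonempty_isometry (V : HermBundle X n) (x : X) :
    Nonempty (ModelFiber n ≃ₗᵢ[ℂ] V.E x) :=
  ⟨((stdOrthonormalBasis ℂ (V.E x)).reindex (finCongr (V.finrank_fiber x))).repr.symm⟩

/-- A trivialization read backwards. A frame is a family over all of X, so off the base set it is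
filled with arbitrary isometries. -/
theorem exists_isFrameOn (V : HermBundle X n) (a : X) :
    ∃ (G : ∀ x, ModelFiber n ≃ₗ[ℂ] V.E x) (U : Set X), IsOpen U ∧ a ∈ U ∧ V.IsFrameOn G U := by
  classical
  let e := trivializationAt (ModelFiber n) V.E a
  let G : ∀ x, ModelFiber n ≃ₗ[ℂ] V.E x := fun x =>
    if h : x ∈ e.baseSet then (e.linearEquivAt ℂ x h).symm
    else (V.nonempty_isometry x).some.toLinearEquiv
  have hG : ∀ x ∈ e.baseSet, ∀ v, (G x).symm v = (e ⟨x, v⟩).2 := fun x h v => by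
    simp only [G, dif_pos h]; rfl
  have hG' : ∀ x ∈ e.baseSet, ∀ w, (e ⟨x, G x w⟩).2 = w := fun x h w => by
    rw [← hG x h, LinearEquiv.symm_apply_apply]
  refine ⟨G, e.baseSet, e.open_baseSet, mem_baseSet_trivializationAt _ _ a, ⟨?_, ?_⟩⟩
  · intro x hx w
    have hnear : ∀ᶠ p : X × ModelFiber n in 𝓝 (x, w), p.1 ∈ e.baseSet :=
      continuous_fst.continuousAt.eventually (e.open_baseSet.mem_nhds hx)
    refine (e.contMDiffAt_iff (by rw [e.mem_source]; exact hx)).2 ⟨contMDiffAt_fst, ?_⟩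
    refine contMDiffAt_snd.congr_of_eventuallyEq ?_
    filter_upwards [hnear] with p hp using hG' _ hp _
  · intro p hp
    have h := ((e.contMDiffAt_iff (IB := 𝓘(ℝ, ℂ)) (n := ∞) (by rw [e.mem_source]; exact hp)).1
      (contMDiffAt_id (x := p))).2
    refine h.congr_of_eventuallyEq ?_
    have hnear : ∀ᶠ q : V.Total in 𝓝 p, q.proj ∈ e.baseSet :=
      (FiberBundle.continuous_proj (ModelFiber n) V.E).continuousAt.eventually
        (e.open_baseSet.mem_nhds hp)
    filter_upwards [hnear] with q hq using hG _ hq _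

theorem DiffAt.add {s t : ∀ x, V.E x} {x : X} (hs : V.DiffAt s x) (ht : V.DiffAt t x) :
    V.DiffAt (fun z => s z + t z) x := by
  obtain ⟨G, U, -, hx, hG⟩ := V.exists_isFrameOn x
  rw [hG.diffAt_iff hx] at *
  simpa using! hs.add ht

theorem DiffAt.smul {s : ∀ x, V.E x} {f : X → ℂ} {x : X}
    (hf : MDifferentiableAt 𝓘(ℝ, ℂ) 𝓘(ℝ, ℂ) f x) (hs : V.DiffAt s x) :
    V.DiffAt (fun z => f z • s z) x := by
  obtain ⟨G, U, -, hx, hG⟩ := V.exists_isFrameOn x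
  rw [hG.diffAt_iff hx] at *
  have h : DifferentiableAt ℝ (fun p : ℂ × ModelFiber n => p.1 • p.2)
      (f x, (G x).symm (s x)) := by
    have := (differentiableAt_fst (𝕜 := ℝ) (p := (f x, (G x).symm (s x)))).smul
      (differentiableAt_snd (𝕜 := ℝ) (p := (f x, (G x).symm (s x))))
    exact this
  simpa using! h.mdifferentiableAt.comp x (f := fun z => (f z, (G z).symm (s z)))
    (hf.prodMk_space hs)

theorem DiffAt.const_smul {s : ∀ x, V.E x} (c : ℂ) {x : X} (hs : V.DiffAt s x) :
    V.DiffAt (fun z => c • s z) x :=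
  hs.smul mdifferentiableAt_const

theorem DiffAt.congr {s t : ∀ x, V.E x} {x : X} (hs : V.DiffAt s x)
    (h : ∀ᶠ z in 𝓝 x, s z = t z) : V.DiffAt t x :=
  MDifferentiableAt.congr_of_eventuallyEq hs (h.mono fun z hz => by simp [hz])

theorem diffAt_zero (x : X) : V.DiffAt (fun _ => 0) x := by
  obtain ⟨G, U, -, hx, hG⟩ := V.exists_isFrameOn x
  rw [hG.diffAt_iff hx]
  simpa using mdifferentiableAt_const

theorem DiffAt.sum {ι : Type*} (I : Finset ι) {s : ι → ∀ x, V.E x} {x : X}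
    (hs : ∀ i ∈ I, V.DiffAt (s i) x) : V.DiffAt (fun z => ∑ i ∈ I, s i z) x := by
  classical
  induction I using Finset.induction_on with
  | empty => simpa using diffAt_zero x
  | insert i I hi ih =>
    simp only [Finset.sum_insert hi]
    exact (hs i (by simp)).add (ih fun j hj => hs j (by simp [hj]))

end HermBundle

namespace FlatUnitaryBundle

variable [IsManifold 𝓘(ℂ, ℂ) ω X] {V : FlatUnitaryBundle X n}

theorem conn_congr {s t : ∀ x, V.E x} {x : X} (hs : V.DiffAt s x)
    (h : ∀ᶠ z in 𝓝 x, s z = t z) : V.conn s x = V.conn t x :=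
  V.conn.isCovariantDerivativeOnUniv.congr_of_eventuallyEq hs (hs.congr h) univ_mem h

theorem conn_add {s t : ∀ x, V.E x} {x : X} (hs : V.DiffAt s x) (ht : V.DiffAt t x) :
    V.conn (fun z => s z + t z) x = V.conn s x + V.conn t x :=
  V.conn.isCovariantDerivativeOnUniv.add hs ht

theorem conn_zero (x : X) : V.conn (fun _ => 0) x = 0 :=
  congrFun V.conn.zero x

theorem conn_sum {ι : Type*} (I : Finset ι) {s : ι → ∀ x, V.E x} {x : X}
    (hs : ∀ i ∈ I, V.DiffAt (s i) x) :
    V.conn (fun z => ∑ i ∈ I, s i z) x = ∑ i ∈ I, V.conn (s i) x := by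
  classical
  induction I using Finset.induction_on with
  | empty => simpa using conn_zero x
  | insert i I hi ih =>
    simp only [Finset.sum_insert hi]
    rw [conn_add (hs i (by simp)) (HermBundle.DiffAt.sum I fun j hj => hs j (by simp [hj])),
      ih fun j hj => hs j (by simp [hj])]

theorem conn_real_smul {s : ∀ x, V.E x} {f : X → ℝ} {x : X}
    (hf : MDifferentiableAt 𝓘(ℝ, ℂ) 𝓘(ℝ, ℝ) f x) (hs : V.DiffAt s x)
    (v : TangentSpace 𝓘(ℝ, ℂ) x) :
    V.conn (fun z => (f z : ℂ) • s z) x v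
      = (f x : ℂ) • V.conn s x v + ((mvfderiv 𝓘(ℝ, ℂ) f x v : ℝ) : ℂ) • s x := by
  have h := V.conn.isCovariantDerivativeOnUniv.leibniz hs hf
  have h' := congrArg (fun T : TangentSpace 𝓘(ℝ, ℂ) x →L[ℝ] V.E x => T v) h
  simp only [Complex.coe_smul]
  exact h'

/-- The Leibniz rule for complex functions. -/
theorem conn_complex_smul {s : ∀ x, V.E x} {f : X → ℂ} {x : X}
    (hf : MDifferentiableAt 𝓘(ℝ, ℂ) 𝓘(ℝ, ℂ) f x) (hs : V.DiffAt s x)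
    (v : TangentSpace 𝓘(ℝ, ℂ) x) :
    V.conn (fun z => f z • s z) x v
      = f x • V.conn s x v + (mvfderiv 𝓘(ℝ, ℂ) f x v) • s x := by
  have hre : HasMFDerivAt 𝓘(ℝ, ℂ) 𝓘(ℝ, ℝ) (fun z => (f z).re) x
      (Complex.reCLM ∘L mfderiv 𝓘(ℝ, ℂ) 𝓘(ℝ, ℂ) f x) :=
    (Complex.reCLM.hasMFDerivAt (x := f x)).comp x hf.hasMFDerivAt
  have him : HasMFDerivAt 𝓘(ℝ, ℂ) 𝓘(ℝ, ℝ) (fun z => (f z).im) x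
      (Complex.imCLM ∘L mfderiv 𝓘(ℝ, ℂ) 𝓘(ℝ, ℂ) f x) :=
    (Complex.imCLM.hasMFDerivAt (x := f x)).comp x hf.hasMFDerivAt
  have hI := hs.const_smul Complex.I
  have hd : ∀ g : X → ℝ, MDifferentiableAt 𝓘(ℝ, ℂ) 𝓘(ℝ, ℝ) g x →
      MDifferentiableAt 𝓘(ℝ, ℂ) 𝓘(ℝ, ℂ) (fun z => (g z : ℂ)) x := fun g hg =>
    (Complex.ofRealCLM.mdifferentiableAt (x := g x)).comp x hg
  -- The Leibniz rule of a covariant derivative concerns real functions. Writing f s = (Re f) s +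
  -- (Im f)(i s) reduces to it, and `conn_smul` moves i out of ∇.
  have h1 : (fun z => f z • s z)
      = fun z => ((f z).re : ℂ) • s z + ((f z).im : ℂ) • (Complex.I • s z) := by
    funext z
    rw [smul_smul, ← add_smul, Complex.re_add_im]
  have hmre : mvfderiv 𝓘(ℝ, ℂ) (fun z => (f z).re) x v = (mvfderiv 𝓘(ℝ, ℂ) f x v).re :=
    congrArg (fun T : TangentSpace 𝓘(ℝ, ℂ) x →L[ℝ] ℝ => T v) hre.mfderiv
  have hmim : mvfderiv 𝓘(ℝ, ℂ) (fun z => (f z).im) x v = (mvfderiv 𝓘(ℝ, ℂ) f x v).im :=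
    congrArg (fun T : TangentSpace 𝓘(ℝ, ℂ) x →L[ℝ] ℝ => T v) him.mfderiv
  rw [h1, conn_add (hs.smul (hd _ hre.mdifferentiableAt))
    (hI.smul (hd _ him.mdifferentiableAt)), _root_.add_apply,
    conn_real_smul hre.mdifferentiableAt hs, conn_real_smul him.mdifferentiableAt hI,
    V.conn_smul _ _ _ hs, hmre, hmim]
  conv_rhs => rw [← Complex.re_add_im (f x), ← Complex.re_add_im (mvfderiv 𝓘(ℝ, ℂ) f x v)]
  module

/-- The connection in a smooth frame. -/
theorem conn_eq_of_isFrameOn {G : ∀ x, ModelFiber n ≃ₗ[ℂ] V.E x} {U : Set X}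
    (hG : V.IsFrameOn G U) {x : X} (hx : x ∈ U) {f : X → ModelFiber n}
    (hf : MDifferentiableAt 𝓘(ℝ, ℂ) 𝓘(ℝ, ModelFiber n) f x) (v : TangentSpace 𝓘(ℝ, ℂ) x) :
    V.conn (fun z => G z (f z)) x v
      = G x (mvfderiv 𝓘(ℝ, ℂ) f x v) + V.conn (fun z => G z (f x)) x v := by
  let b := EuclideanSpace.basisFun (Fin n) ℂ
  have hb : ∀ w : ModelFiber n, w = ∑ i, w i • b i := fun w => by
    conv_lhs => rw [← b.sum_repr w]
    simp [b]
  have hfi : ∀ i, HasMFDerivAt 𝓘(ℝ, ℂ) 𝓘(ℝ, ℂ) (fun z => f z i) x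
      (((EuclideanSpace.proj i : ModelFiber n →L[ℂ] ℂ).restrictScalars ℝ) ∘L
        mfderiv 𝓘(ℝ, ℂ) 𝓘(ℝ, ModelFiber n) f x) := fun i =>
    (((EuclideanSpace.proj i : ModelFiber n →L[ℂ] ℂ).restrictScalars ℝ).hasMFDerivAt
      (x := f x)).comp x hf.hasMFDerivAt
  have hmi : ∀ i, mvfderiv 𝓘(ℝ, ℂ) (fun z => f z i) x v = mvfderiv 𝓘(ℝ, ℂ) f x v i := fun i =>
    congrArg (fun T : TangentSpace 𝓘(ℝ, ℂ) x →L[ℝ] ℂ => T v) (hfi i).mfderiv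
  have hGb : ∀ i, V.DiffAt (fun z => G z (b i)) x := fun i =>
    hG.diffAt_apply hx mdifferentiableAt_const
  have h1 : ∀ g : X → ModelFiber n,
      (fun z => G z (g z)) = fun z => ∑ i, g z i • G z (b i) := fun g => by
    funext z
    conv_lhs => rw [hb (g z), map_sum]
    simp
  rw [h1 f, h1 fun _ => f x, conn_sum _ fun i _ => (hGb i).smul (hfi i).mdifferentiableAt,
    conn_sum _ fun i _ => (hGb i).const_smul _]
  conv_rhs => rw [hb (mvfderiv 𝓘(ℝ, ℂ) f x v), map_sum]
  simp only [_root_.sum_apply, map_smul]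
  rw [← Finset.sum_add_distrib]
  refine Finset.sum_congr rfl fun i _ => ?_
  rw [conn_complex_smul (hfi i).mdifferentiableAt (hGb i), hmi, V.conn_smul _ _ _ (hGb i),
    add_comm]

end FlatUnitaryBundle

end Frames


/-! ### Coordinate vector fields and differentials in charts. -/

section ChartFields

variable {X : Type*} [TopologicalSpace X] [ChartedSpace ℂ X]

/-- The differential of the chart at `a`. -/
noncomputable def chartDiff (a x : X) : TangentSpace 𝓘(ℝ, ℂ) x →L[ℝ] ℂ :=
  mfderiv 𝓘(ℝ, ℂ) 𝓘(ℝ, ℂ) (extChartAt 𝓘(ℝ, ℂ) a) x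

/-- The coordinate vector field `u` in the chart at `a`. -/
noncomputable def chartField (a : X) (u : ℂ) (x : X) : TangentSpace 𝓘(ℝ, ℂ) x :=
  (chartDiff a x).inverse u

variable {a x : X}

theorem chartField_add (a x : X) (u v : ℂ) :
    chartField a (u + v) x = chartField a u x + chartField a v x :=
  ContinuousLinearMap.map_add _ _ _

theorem chartField_smul (a x : X) (r : ℝ) (u : ℂ) :
    chartField a (r • u) x = r • chartField a u x :=
  ContinuousLinearMap.map_smul _ _ _

theorem mvfderiv_of_hasMFDerivAt {W : Type*} [NormedAddCommGroup W] [NormedSpace ℝ W]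
    {f : X → W} {L : TangentSpace 𝓘(ℝ, ℂ) x →L[ℝ] W}
    (h : HasMFDerivAt 𝓘(ℝ, ℂ) 𝓘(ℝ, W) f x L) (v : TangentSpace 𝓘(ℝ, ℂ) x) :
    mvfderiv 𝓘(ℝ, ℂ) f x v = L v :=
  congrArg (fun T : TangentSpace 𝓘(ℝ, ℂ) x →L[ℝ] W => T v) h.mfderiv

theorem eventually_extChartAt_symm (hx : x ∈ (extChartAt 𝓘(ℝ, ℂ) a).source) :
    ∀ᶠ z in 𝓝 x, (extChartAt 𝓘(ℝ, ℂ) a).symm (extChartAt 𝓘(ℝ, ℂ) a z) = z :=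
  Filter.mem_of_superset (extChartAt_source_mem_nhds' hx) fun _ hz =>
    (extChartAt 𝓘(ℝ, ℂ) a).left_inv hz

variable [IsManifold 𝓘(ℂ, ℂ) ω X]

theorem isInvertible_chartDiff (hx : x ∈ (extChartAt 𝓘(ℝ, ℂ) a).source) :
    ∃ e : TangentSpace 𝓘(ℝ, ℂ) x ≃L[ℝ] ℂ, (e : TangentSpace 𝓘(ℝ, ℂ) x →L[ℝ] ℂ) = chartDiff a x :=
  isInvertible_mfderiv_extChartAt (I := 𝓘(ℝ, ℂ)) hx

theorem chartDiff_chartField (hx : x ∈ (extChartAt 𝓘(ℝ, ℂ) a).source) (u : ℂ) :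
    chartDiff a x (chartField a u x) = u := by
  obtain ⟨e, he⟩ := isInvertible_chartDiff hx
  rw [chartField, ← he, ContinuousLinearMap.inverse_equiv]
  exact e.apply_symm_apply u

theorem chartField_chartDiff (hx : x ∈ (extChartAt 𝓘(ℝ, ℂ) a).source)
    (v : TangentSpace 𝓘(ℝ, ℂ) x) : chartField a (chartDiff a x v) x = v := by
  obtain ⟨e, he⟩ := isInvertible_chartDiff hx
  rw [chartField, ← he, ContinuousLinearMap.inverse_equiv]
  exact e.symm_apply_apply v

/-- The trivialization of the tangent bundle at a is the differential of the chart at a, in which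
this field is the constant u. -/
theorem contMDiffOn_chartField (a : X) (u : ℂ) :
    ContMDiffOn 𝓘(ℝ, ℂ) 𝓘(ℝ, ℂ).tangent ∞
      (fun z => (⟨z, chartField a u z⟩ : TangentBundle 𝓘(ℝ, ℂ) X))
      (extChartAt 𝓘(ℝ, ℂ) a).source := by
  intro x hx
  have hx' : x ∈ (chartAt ℂ a).source := by simpa using hx
  let e := trivializationAt ℂ (TangentSpace 𝓘(ℝ, ℂ) (M := X)) a
  have hb : ∀ y, y ∈ (chartAt ℂ a).source → y ∈ e.baseSet := fun y hy => by
    rwa [TangentBundle.trivializationAt_baseSet]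
  refine ((e.contMDiffAt_iff (by rw [e.mem_source]; exact hb x hx')).2
    ⟨contMDiffAt_id, contMDiffAt_const (c := u).congr_of_eventuallyEq ?_⟩).contMDiffWithinAt
  filter_upwards [(chartAt ℂ a).open_source.mem_nhds hx'] with y hy
  have h1 := TangentBundle.continuousLinearMapAt_trivializationAt (I := 𝓘(ℝ, ℂ)) hy
  have h2 : e.continuousLinearMapAt ℝ y (chartField a u y) = u := by
    rw [h1]
    exact chartDiff_chartField (by simpa using hy) u
  refine Eq.trans ?_ h2
  exact (congrFun (e.coe_linearMapAt_of_mem (R := ℝ) (hb y hy)) _).symm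

/-- Both fields are pullbacks of constant fields under the chart, and the bracket commutes with
pullback. -/
theorem mlieBracket_chartField (hx : x ∈ (extChartAt 𝓘(ℝ, ℂ) a).source) (u v : ℂ) :
    VectorField.mlieBracket 𝓘(ℝ, ℂ) (chartField a u) (chartField a v) x = 0 := by
  let c : ℂ → ∀ z : ℂ, TangentSpace 𝓘(ℝ, ℂ) z := fun u _ => u
  have hc : ∀ u : ℂ, MDifferentiableAt 𝓘(ℝ, ℂ) 𝓘(ℝ, ℂ).tangent
      (fun z : ℂ => (⟨z, c u z⟩ : TangentBundle 𝓘(ℝ, ℂ) ℂ)) (extChartAt 𝓘(ℝ, ℂ) a x) := fun u => by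
    refine (mdifferentiableAt_section 𝓘(ℝ, ℂ) (F := ℂ) (c u)).2 ?_
    simp only [trivializationAt_model_space_apply]
    exact mdifferentiableAt_const
  have h := VectorField.mpullback_mlieBracket (I := 𝓘(ℝ, ℂ)) (I' := 𝓘(ℝ, ℂ)) (n := 2)
    (f := extChartAt 𝓘(ℝ, ℂ) a) (x₀ := x) (hc u) (hc v)
    (contMDiffAt_extChartAt' (by simpa using hx)) (by simp)
  refine h.symm.trans ?_
  rw [VectorField.mpullback_apply]
  have h0 : VectorField.mlieBracket 𝓘(ℝ, ℂ) (c u) (c v) (extChartAt 𝓘(ℝ, ℂ) a x) = 0 := by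
    rw [← VectorField.mlieBracketWithin_univ, VectorField.mlieBracketWithin_eq_lieBracketWithin]
    simp only [VectorField.lieBracketWithin, c]
    exact (congrArg₂ (fun A B : ℂ →L[ℝ] ℂ => A u - B v) (fderivWithin_const_apply v)
      (fderivWithin_const_apply u)).trans (sub_self (0 : ℂ))
  rw [h0]
  exact map_zero _

section Functions

variable {W : Type*} [NormedAddCommGroup W] [NormedSpace ℝ W]

theorem hasMFDerivAt_comp_extChartAt (hx : x ∈ (extChartAt 𝓘(ℝ, ℂ) a).source) {h : ℂ → W}
    {h' : ℂ →L[ℝ] W} (hh : HasFDerivAt h h' (extChartAt 𝓘(ℝ, ℂ) a x)) :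
    HasMFDerivAt 𝓘(ℝ, ℂ) 𝓘(ℝ, W) (fun z => h (extChartAt 𝓘(ℝ, ℂ) a z)) x
      (h' ∘L chartDiff a x) :=
  HasMFDerivAt.comp x (hh.hasMFDerivAt)
    (mdifferentiableAt_extChartAt (I := 𝓘(ℝ, ℂ)) (by simpa using hx)).hasMFDerivAt

theorem contDiffAt_comp_extChartAt_symm (hx : x ∈ (extChartAt 𝓘(ℝ, ℂ) a).source) {f : X → W}
    (hf : ContMDiffAt 𝓘(ℝ, ℂ) 𝓘(ℝ, W) ∞ f x) :
    ContDiffAt ℝ ∞ (fun z => f ((extChartAt 𝓘(ℝ, ℂ) a).symm z)) (extChartAt 𝓘(ℝ, ℂ) a x) := by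
  rw [← contMDiffAt_iff_contDiffAt]
  have h1 : ContMDiffAt 𝓘(ℝ, ℂ) 𝓘(ℝ, ℂ) ∞ (extChartAt 𝓘(ℝ, ℂ) a).symm
      (extChartAt 𝓘(ℝ, ℂ) a x) :=
    (contMDiffOn_extChartAt_symm a).contMDiffAt
      ((isOpen_extChartAt_target a).mem_nhds ((extChartAt 𝓘(ℝ, ℂ) a).map_source hx))
  refine ContMDiffAt.comp _ ?_ h1
  rwa [(extChartAt 𝓘(ℝ, ℂ) a).left_inv hx]

theorem mvfderiv_eq_fderiv (hx : x ∈ (extChartAt 𝓘(ℝ, ℂ) a).source) {f : X → W}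
    (hf : DifferentiableAt ℝ (fun z => f ((extChartAt 𝓘(ℝ, ℂ) a).symm z))
      (extChartAt 𝓘(ℝ, ℂ) a x)) (v : TangentSpace 𝓘(ℝ, ℂ) x) :
    mvfderiv 𝓘(ℝ, ℂ) f x v = fderiv ℝ (fun z => f ((extChartAt 𝓘(ℝ, ℂ) a).symm z))
      (extChartAt 𝓘(ℝ, ℂ) a x) (chartDiff a x v) := by
  refine mvfderiv_of_hasMFDerivAt ((hasMFDerivAt_comp_extChartAt hx
    hf.hasFDerivAt).congr_of_eventuallyEq ?_) v
  filter_upwards [eventually_extChartAt_symm hx] with z hz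
  rw [hz]

theorem differentiableAt_comp_extChartAt_symm (hx : x ∈ (extChartAt 𝓘(ℝ, ℂ) a).source)
    {f : X → W} (hf : MDifferentiableAt 𝓘(ℝ, ℂ) 𝓘(ℝ, W) f x) :
    DifferentiableAt ℝ (fun z => f ((extChartAt 𝓘(ℝ, ℂ) a).symm z))
      (extChartAt 𝓘(ℝ, ℂ) a x) := by
  rw [← mdifferentiableAt_iff_differentiableAt]
  have h1 : MDifferentiableAt 𝓘(ℝ, ℂ) 𝓘(ℝ, ℂ) (extChartAt 𝓘(ℝ, ℂ) a).symm
      (extChartAt 𝓘(ℝ, ℂ) a x) :=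
    ((contMDiffOn_extChartAt_symm (n := 1) a).contMDiffAt
      ((isOpen_extChartAt_target a).mem_nhds
        ((extChartAt 𝓘(ℝ, ℂ) a).map_source hx))).mdifferentiableAt one_ne_zero
  refine MDifferentiableAt.comp _ ?_ h1
  rwa [(extChartAt 𝓘(ℝ, ℂ) a).left_inv hx]

/-- A function with vanishing differential is locally constant. -/
theorem eventually_eq_of_mvfderiv_eq_zero {f : X → W}
    (h : ∀ᶠ z in 𝓝 a, MDifferentiableAt 𝓘(ℝ, ℂ) 𝓘(ℝ, W) f z ∧ mvfderiv 𝓘(ℝ, ℂ) f z = 0) :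
    ∀ᶠ z in 𝓝 a, f z = f a := by
  set φ := extChartAt 𝓘(ℝ, ℂ) a with hφ
  have ha : a ∈ φ.source := mem_extChartAt_source a
  have hsymm : Tendsto φ.symm (𝓝 (φ a)) (𝓝 a) := by
    have := continuousAt_extChartAt_symm (I := 𝓘(ℝ, ℂ)) a
    rwa [ContinuousAt, φ.left_inv ha] at this
  obtain ⟨ε, hε, hball⟩ := Metric.eventually_nhds_iff_ball.1
    ((hsymm.eventually h).and ((isOpen_extChartAt_target a).mem_nhds (φ.map_source ha)))
  have hd : ∀ z ∈ Metric.ball (φ a) ε, HasFDerivAt (fun z => f (φ.symm z)) (0 : ℂ →L[ℝ] W) z := by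
    intro z hz
    obtain ⟨⟨h1, h2⟩, h3⟩ := hball z hz
    have hs : φ.symm z ∈ φ.source := φ.map_target h3
    have hzz : φ (φ.symm z) = z := φ.right_inv h3
    have h4 := differentiableAt_comp_extChartAt_symm hs h1
    have h5 : fderiv ℝ (fun z => f (φ.symm z)) z = 0 := by
      ext u
      have := mvfderiv_eq_fderiv hs h4 (chartField a u (φ.symm z))
      rw [h2, chartDiff_chartField hs, ← hφ, hzz] at this
      simpa using this.symm
    rw [← hφ, hzz] at h4
    rw [← h5]
    exact h4.hasFDerivAt
  have hconst : ∀ z ∈ Metric.ball (φ a) ε, f (φ.symm z) = f a := by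
    intro z hz
    have := (convex_ball (φ a) ε).is_const_of_fderivWithin_eq_zero (𝕜 := ℝ)
      (fun w hw => (hd w hw).differentiableAt.differentiableWithinAt)
      (fun w hw => by
        rw [fderivWithin_of_isOpen Metric.isOpen_ball hw]; exact (hd w hw).fderiv)
      hz (Metric.mem_ball_self hε)
    rwa [φ.left_inv ha] at this
  filter_upwards [eventually_extChartAt_symm ha,
    (continuousAt_extChartAt (I := 𝓘(ℝ, ℂ)) a).eventually (Metric.ball_mem_nhds _ hε)] with z hz hz'
  rw [← hconst _ hz', hz]

end Functions

end ChartFields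


/-! ### The connection form in a frame and its curvature. -/

section ConnectionForm

variable {X : Type*} [TopologicalSpace X] [ChartedSpace ℂ X] [IsManifold 𝓘(ℂ, ℂ) ω X] {n : ℕ}

theorem contDiffAt_smulRight {W : Type*} [NormedAddCommGroup W] [NormedSpace ℝ W]
    (L : ℂ →L[ℝ] ℝ) {f : ℂ → W} {p : ℂ} (hf : ContDiffAt ℝ ∞ f p) :
    ContDiffAt ℝ ∞ (fun z => L.smulRight (f z)) p :=
  contDiffAt_const.smulRight hf

theorem contDiffAt_sum_smulRight {f : Fin n → ℂ → ModelFiber n} {p : ℂ}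
    (hf : ∀ i, ContDiffAt ℝ ∞ (f i) p) :
    ContDiffAt ℝ ∞ (fun z => ∑ i,
      (EuclideanSpace.proj i : ModelFiber n →L[ℂ] ℂ).smulRight (f i z)) p := by
  refine ContDiffAt.sum fun i _ => ?_
  let L : ModelFiber n →L[ℝ] (ModelFiber n →L[ℂ] ModelFiber n) :=
    (ContinuousLinearMap.smulRightL ℂ (ModelFiber n) (ModelFiber n)
      (EuclideanSpace.proj i : ModelFiber n →L[ℂ] ℂ)).restrictScalars ℝ
  exact L.contDiff.contDiffAt.comp p (hf i)

theorem exists_hasFDerivAt_apply {W M : Type*} [NormedAddCommGroup W] [NormedSpace ℝ W]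
    [NormedAddCommGroup M] [NormedSpace ℝ M] {η : ℂ → ℂ →L[ℝ] W} {p : ℂ}
    (h : ContDiffAt ℝ ∞ η p) (v : ℂ) (T : W →L[ℝ] M) :
    ∃ L : ℂ →L[ℝ] M, HasFDerivAt (fun z => T (η z v)) L p ∧
      ∀ u, L u = T (fderiv ℝ η p u v) := by
  have hd : HasFDerivAt η (fderiv ℝ η p) p := (h.differentiableAt (by simp)).hasFDerivAt
  let T' : (ℂ →L[ℝ] W) →L[ℝ] M := T ∘L ContinuousLinearMap.apply ℝ W v
  exact ⟨T' ∘L fderiv ℝ η p, T'.hasFDerivAt.comp p hd, fun u => rfl⟩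

theorem formCurvature_apply {M : Type*} [NormedAddCommGroup M] [NormedSpace ℂ M]
    (η : ℂ → ℂ →L[ℝ] (M →L[ℂ] M)) (p u v : ℂ) (w : M) :
    formCurvature η p u v w = fderiv ℝ η p u v w + η p u (η p v w)
      - (fderiv ℝ η p v u w + η p v (η p u w)) := by
  have : formCurvature η p u v w = fderiv ℝ η p u v w - fderiv ℝ η p v u w
    + (η p u (η p v w) - η p v (η p u w)) := rfl
  rw [this]
  abel

theorem exists_smooth_cutoff [T2Space X] {a : X} {U : Set X} (hU : U ∈ 𝓝 a) :
    ∃ χ : X → ℝ, ContMDiff 𝓘(ℝ, ℂ) 𝓘(ℝ, ℝ) ∞ χ ∧ tsupport χ ⊆ U ∧ ∀ᶠ z in 𝓝 a, χ z = 1 := by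
  obtain ⟨f, -, hf⟩ := (SmoothBumpFunction.nhds_basis_tsupport (I := 𝓘(ℝ, ℂ)) a).mem_iff.1 hU
  exact ⟨f, f.contMDiff, hf, f.eventuallyEq_one⟩

namespace HermBundle

/-- Local smooth sections extend to global smooth sections. -/
theorem exists_smooth_extension [T2Space X] (V : HermBundle X n) {s : ∀ x, V.E x} {a : X}
    {U : Set X} (hU : IsOpen U) (ha : a ∈ U)
    (hs : ∀ x ∈ U, ContMDiffAt 𝓘(ℝ, ℂ) (totalModel n) ∞ (fun z => V.pt z (s z)) x) :
    ∃ t : ∀ x, V.E x, V.Smooth t ∧ ∀ᶠ z in 𝓝 a, t z = s z := by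
  obtain ⟨χ, hχ, hsupp, h1⟩ := exists_smooth_cutoff (hU.mem_nhds ha)
  refine ⟨χ • s, ContMDiffOn.smul_section_of_tsupport hχ.contMDiffOn hU hsupp
    fun x hx => (hs x hx).contMDiffWithinAt, ?_⟩
  filter_upwards [h1] with z hz
  simp [hz]

end HermBundle

/-- Zero curvature is tested on global smooth fields, so coordinate fields are cut off. One bump
function serves all u at once, hence the common neighbourhood. -/
theorem exists_smooth_chartField [T2Space X] {a x : X} (hx : x ∈ (extChartAt 𝓘(ℝ, ℂ) a).source) :
    ∃ W : ℂ → ∀ x : X, TangentSpace 𝓘(ℝ, ℂ) x, (∀ u, IsSmoothVectorField (W u)) ∧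
      ∀ᶠ z in 𝓝 x, ∀ u, W u z = chartField a u z := by
  obtain ⟨χ, hχ, hsupp, h1⟩ := exists_smooth_cutoff (extChartAt_source_mem_nhds' hx)
  refine ⟨fun u => χ • chartField a u, fun u =>
    ContMDiffOn.smul_section_of_tsupport hχ.contMDiffOn (isOpen_extChartAt_source a) hsupp
      (contMDiffOn_chartField a u), ?_⟩
  filter_upwards [h1] with z hz u
  simp [hz]

namespace FlatUnitaryBundle

theorem smooth_conn (V : FlatUnitaryBundle X n) {s : ∀ x, V.E x} (hs : V.Smooth s)
    {U : ∀ x : X, TangentSpace 𝓘(ℝ, ℂ) x} (hU : IsSmoothVectorField U) :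
    V.Smooth (fun z => V.conn s z (U z)) := by
  have h := V.conn_smooth.contMDiff.contMDiff hs.contMDiffOn
  rw [contMDiffOn_univ] at h
  exact ContMDiff.clm_bundle_apply h hU

/-- The connection form of a flat connection has zero curvature. -/
theorem formCurvature_eq_zero [T2Space X] {V : FlatUnitaryBundle X n}
    {G : ∀ x, ModelFiber n ≃ₗ[ℂ] V.E x} {U : Set X} (hG : V.IsFrameOn G U) (hU : IsOpen U) {a : X}
    {η : ℂ → ℂ →L[ℝ] (ModelFiber n →L[ℂ] ModelFiber n)} {N : Set X} (hN : IsOpen N) (hNU : N ⊆ U)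
    (hNs : N ⊆ (extChartAt 𝓘(ℝ, ℂ) a).source)
    (hη : ∀ x ∈ N, ContDiffAt ℝ ∞ η (extChartAt 𝓘(ℝ, ℂ) a x))
    (hconn : ∀ x ∈ N, ∀ u w, V.conn (fun z => G z w) x (chartField a u x)
        = G x (η (extChartAt 𝓘(ℝ, ℂ) a x) u w)) {x : X} (hx : x ∈ N) (u v : ℂ) :
    formCurvature η (extChartAt 𝓘(ℝ, ℂ) a x) u v = 0 := by
  set φ := extChartAt 𝓘(ℝ, ℂ) a with hφ
  have hnear : ∀ᶠ z in 𝓝 x, z ∈ N := hN.mem_nhds hx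
  refine ContinuousLinearMap.ext fun w => ?_
  choose L hL hL' using fun v => exists_hasFDerivAt_apply (hη x hx) v
    ((ContinuousLinearMap.apply ℂ (ModelFiber n) w).restrictScalars ℝ)
  have hηm : ∀ v : ℂ, HasMFDerivAt 𝓘(ℝ, ℂ) 𝓘(ℝ, ModelFiber n) (fun z => η (φ z) v w) x
      (L v ∘L chartDiff a x) := fun v => hasMFDerivAt_comp_extChartAt (hNs hx) (hL v)
  obtain ⟨s, hs, hsG⟩ := V.exists_smooth_extension (s := fun z => G z w) hU (hNU hx)
    fun x hx => hG.contMDiffAt_apply hx contMDiffAt_const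
  obtain ⟨W, hW, hWc⟩ := exists_smooth_chartField (hNs hx)
  have hsd : ∀ᶠ z in 𝓝 x, ∀ v, V.conn s z (W v z) = G z (η (φ z) v w) := by
    filter_upwards [hsG.eventually_nhds, hnear, hWc] with z hz hzN hzW v
    rw [conn_congr (hs.mdifferentiable (by simp) z) hz, hzW v, hconn z hzN]
  -- In the frame, ∇_u ∇_v w = (∂_u η_v + η_u η_v) w. Antisymmetrizing in u and v gives dη + η ∧ η,
  -- since coordinate fields commute.
  have hterm : ∀ u v, V.conn (fun z => V.conn s z (W v z)) x (W u x)
      = G x (fderiv ℝ η (φ x) u v w + η (φ x) u (η (φ x) v w)) := by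
    intro u v
    rw [conn_congr ((V.smooth_conn hs (hW v)).mdifferentiable (by simp) x)
      (hsd.mono fun z hz => hz v), conn_eq_of_isFrameOn hG (hNU hx) (hηm v).mdifferentiableAt,
      mvfderiv_of_hasMFDerivAt (hηm v), hWc.self_of_nhds u, hconn x hx, map_add]
    congr 2
    refine Eq.trans ?_ (hL' v u)
    change L v (chartDiff a x (chartField a u x)) = _
    rw [chartDiff_chartField (hNs hx)]
  have hbr : VectorField.mlieBracket 𝓘(ℝ, ℂ) (W u) (W v) x = 0 := by
    rw [Filter.EventuallyEq.mlieBracket_vectorField_eq (hWc.mono fun z hz => hz u)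
      (hWc.mono fun z hz => hz v), mlieBracket_chartField (hNs hx)]
  have hflat := V.conn_flat (W u) (W v) s (hW u) (hW v) hs x
  rw [hbr, map_zero, sub_zero, hterm, hterm, ← map_sub, LinearEquiv.map_eq_zero_iff] at hflat
  exact (formCurvature_apply η (φ x) u v w).trans hflat

/-- The matrix-valued one-form of the connection in a smooth frame. -/
theorem exists_connection_form [T2Space X] {V : FlatUnitaryBundle X n}
    {G : ∀ x, ModelFiber n ≃ₗ[ℂ] V.E x} {U : Set X} (hG : V.IsFrameOn G U) (hU : IsOpen U) {a : X}
    (ha : a ∈ U) :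
    ∃ (η : ℂ → ℂ →L[ℝ] (ModelFiber n →L[ℂ] ModelFiber n)) (N : Set X), IsOpen N ∧ a ∈ N ∧ N ⊆ U ∧
      N ⊆ (extChartAt 𝓘(ℝ, ℂ) a).source ∧
      (∀ x ∈ N, ContDiffAt ℝ ∞ η (extChartAt 𝓘(ℝ, ℂ) a x)) ∧
      (∀ x ∈ N, ∀ u w, V.conn (fun z => G z w) x (chartField a u x)
        = G x (η (extChartAt 𝓘(ℝ, ℂ) a x) u w)) ∧
      ∀ x ∈ N, ∀ u v, formCurvature η (extChartAt 𝓘(ℝ, ℂ) a x) u v = 0 := by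
  set φ := extChartAt 𝓘(ℝ, ℂ) a with hφ
  let b := EuclideanSpace.basisFun (Fin n) ℂ
  have hext := fun w : ModelFiber n => V.exists_smooth_extension (s := fun z => G z w) hU ha
    fun x hx => hG.contMDiffAt_apply hx contMDiffAt_const
  choose S hS hSG using fun i => hext (b i)
  obtain ⟨W, hW, hWc⟩ := exists_smooth_chartField (mem_extChartAt_source (I := 𝓘(ℝ, ℂ)) a)
  obtain ⟨N, hN, hNo, haN⟩ := eventually_nhds_iff.1 ((((eventually_all.2 hSG).and hWc).and
    (hU.mem_nhds ha)).and (extChartAt_source_mem_nhds (I := 𝓘(ℝ, ℂ)) a))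
  have hNU : N ⊆ U := fun x hx => (hN x hx).1.2
  have hNs : N ⊆ φ.source := fun x hx => (hN x hx).2
  have hnear : ∀ {x}, x ∈ N → ∀ᶠ z in 𝓝 x, z ∈ N := fun hx => hNo.mem_nhds hx
  let Ω : ℂ → Fin n → X → ModelFiber n := fun u i x => (G x).symm (V.conn (S i) x (W u x))
  let A : ℂ → ℂ → (ModelFiber n →L[ℂ] ModelFiber n) := fun u z =>
    ∑ i, (EuclideanSpace.proj i : ModelFiber n →L[ℂ] ℂ).smulRight (Ω u i (φ.symm z))
  -- Defined from its values on the basis 1, i of the tangent space. Real linearity is built in, and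
  -- smoothness reduces to that of ∇ of the frame vectors along two fixed fields.
  let η : ℂ → ℂ →L[ℝ] (ModelFiber n →L[ℂ] ModelFiber n) := fun z =>
    Complex.reCLM.smulRight (A 1 z) + Complex.imCLM.smulRight (A Complex.I z)
  have hΩ : ∀ x ∈ N, ∀ u i, ContMDiffAt 𝓘(ℝ, ℂ) 𝓘(ℝ, ModelFiber n) ∞ (Ω u i) x :=
    fun x hx u i => hG.contMDiffAt_coord (hNU hx) (V.smooth_conn (hS i) (hW u)).contMDiffAt
  have hA : ∀ x ∈ N, ∀ u, ContDiffAt ℝ ∞ (A u) (φ x) := fun x hx u =>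
    contDiffAt_sum_smulRight fun i => contDiffAt_comp_extChartAt_symm (hNs hx) (hΩ x hx u i)
  have hη : ∀ x ∈ N, ContDiffAt ℝ ∞ η (φ x) := fun x hx =>
    (contDiffAt_smulRight _ (hA x hx 1)).add (contDiffAt_smulRight _ (hA x hx Complex.I))
  have hGd : ∀ x ∈ N, ∀ w, V.DiffAt (fun z => G z w) x := fun x hx w =>
    hG.diffAt_apply (hNU hx) mdifferentiableAt_const
  have hAconn : ∀ x ∈ N, ∀ u w, V.conn (fun z => G z w) x (chartField a u x)
      = G x (A u (φ x) w) := by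
    intro x hx u w
    have h1 : (fun z => G z w) = fun z => ∑ i, w i • G z (b i) := by
      funext z
      conv_lhs => rw [← b.sum_repr w, map_sum]
      simp [b]
    have h2 : ∀ i, V.conn (fun z => G z (b i)) x (W u x) = G x (Ω u i x) := fun i => by
      rw [conn_congr (hGd x hx (b i)) ((hnear hx).mono fun z hz => ((hN z hz).1.1.1 i).symm)]
      simp [Ω]
    rw [← (hN x hx).1.1.2 u, h1, conn_sum _ fun i _ => (hGd x hx (b i)).const_smul (w i)]
    simp only [_root_.sum_apply, A, map_sum]
    refine Finset.sum_congr rfl fun i _ => ?_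
    rw [V.conn_smul _ _ _ (hGd x hx (b i)), h2, φ.left_inv (hNs hx)]
    simp
  have hconn : ∀ x ∈ N, ∀ u w, V.conn (fun z => G z w) x (chartField a u x)
      = G x (η (φ x) u w) := by
    intro x hx u w
    have hu : chartField a u x = u.re • chartField a 1 x + u.im • chartField a Complex.I x := by
      rw [← chartField_smul, ← chartField_smul, ← chartField_add]
      congr 1
      simp
    rw [hu, map_add, map_smul, map_smul, hAconn x hx, hAconn x hx]
    simp only [η, _root_.add_apply,
      ContinuousLinearMap.smulRight_apply, Complex.reCLM_apply, Complex.imCLM_apply,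
      _root_.smul_apply, map_add]
    simp only [← Complex.coe_smul, map_smul]
  refine ⟨η, N, hNo, haN, hNU, hNs, hη, hconn, fun x hx u v => ?_⟩
  exact formCurvature_eq_zero hG hU hNo hNU hNs hη hconn hx u v

end FlatUnitaryBundle

end ConnectionForm


/-! ### Smoothness and invertibility of the parallel frame. -/

section SmoothParallelFrame

variable {E : Type*} [NormedAddCommGroup E] [NormedSpace ℝ E]
  {𝒜 : Type*} [NormedRing 𝒜] [NormedAlgebra ℝ 𝒜]

/-- Bootstrapping: if g is C^k, the equation dg = −η g shows that dg is C^k, so g is C^{k+1}. -/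
theorem contDiffOn_of_fderiv_eq_mul {η : E → E →L[ℝ] 𝒜} {g : E → 𝒜} {B : Set E} (hB : IsOpen B)
    (hη : ContDiffOn ℝ ∞ η B)
    (hg : ∀ z ∈ B, HasFDerivAt g (-((ContinuousLinearMap.mul ℝ 𝒜).flip (g z) ∘L η z)) z) :
    ContDiffOn ℝ ∞ g B := by
  have hd : DifferentiableOn ℝ g B := fun z hz => (hg z hz).differentiableAt.differentiableWithinAt
  refine contDiffOn_infty.2 fun k => ?_
  induction k with
  | zero => exact contDiffOn_zero.2 hd.continuousOn
  | succ k ih =>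
    push_cast
    refine (contDiffOn_succ_iff_fderiv_of_isOpen hB).2 ⟨hd, by simp, ?_⟩
    have h1 : ContDiffOn ℝ k
        (fun z => -((ContinuousLinearMap.mul ℝ 𝒜).flip (g z) ∘L η z)) B :=
      (((ContinuousLinearMap.mul ℝ 𝒜).flip.contDiff.comp_contDiffOn ih).clm_comp
        (hη.of_le (by exact_mod_cast le_top))).neg
    exact h1.congr fun z hz => (hg z hz).fderiv

/-- A translation moves the base point to the origin. Invertibility persists near p because units
are open and g p = 1. -/
theorem exists_smooth_parallel_frame [CompleteSpace 𝒜] {η : E → E →L[ℝ] 𝒜} {p : E}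
    (hη : ∀ᶠ z in 𝓝 p, ContDiffAt ℝ ∞ η z)
    (hF : ∀ᶠ z in 𝓝 p, ∀ u v, formCurvature η z u v = 0) :
    ∃ g : E → 𝒜, g p = 1 ∧ ∀ᶠ z in 𝓝 p, ContDiffAt ℝ ∞ g z ∧ IsUnit (g z) ∧
      HasFDerivAt g (-((ContinuousLinearMap.mul ℝ 𝒜).flip (g z) ∘L η z)) z := by
  have ht : Tendsto (fun z : E => p + z) (𝓝 0) (𝓝 p) := by
    have : Continuous fun z : E => p + z := by fun_prop
    simpa using this.tendsto 0
  have hη0 : ContDiffAt ℝ 2 (fun z => η (p + z)) 0 := by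
    have h1 : ContDiffAt ℝ ∞ η (p + 0) := by simpa using hη.self_of_nhds
    exact (h1.comp (0 : E) (contDiffAt_const.add contDiffAt_id)).of_le
      (WithTop.coe_le_coe.2 (le_top : (2 : ℕ∞) ≤ ⊤))
  have hF0 : ∀ᶠ z in 𝓝 0, ∀ u v, formCurvature (fun z => η (p + z)) z u v = 0 := by
    filter_upwards [ht.eventually hF] with z hz u v
    rw [← hz u v, formCurvature, formCurvature, fderiv_comp_add_left]
  obtain ⟨g, hg0, hg⟩ := exists_parallel_frame_of_flat hη0 hF0
  have ht' : Tendsto (fun z : E => z - p) (𝓝 p) (𝓝 0) := by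
    have : Continuous fun z : E => z - p := by fun_prop
    simpa using this.tendsto p
  have hg' : ∀ᶠ z in 𝓝 p, HasFDerivAt (fun z => g (z - p))
      (-((ContinuousLinearMap.mul ℝ 𝒜).flip (g (z - p)) ∘L η z)) z := by
    filter_upwards [ht'.eventually hg] with z hz
    have := hz.comp z ((hasFDerivAt_id z).sub_const p)
    simpa [Function.comp_def] using this
  refine ⟨fun z => g (z - p), by simpa using hg0, ?_⟩
  obtain ⟨B, hB, hBo, hpB⟩ := eventually_nhds_iff.1 (hη.and hg')
  have hs := contDiffOn_of_fderiv_eq_mul hBo (fun z hz => (hB z hz).1.contDiffWithinAt)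
    fun z hz => (hB z hz).2
  have hu : ∀ᶠ z in 𝓝 p, IsUnit (g (z - p)) := by
    have hc : ContinuousAt (fun z => g (z - p)) p := (hB p hpB).2.continuousAt
    refine hc.eventually (Units.isOpen.mem_nhds ?_)
    simp [hg0]
  filter_upwards [hBo.mem_nhds hpB, hu] with z hz hz'
  exact ⟨hs.contDiffAt (hBo.mem_nhds hz), hz', (hB z hz).2⟩

end SmoothParallelFrame

/-! ### Unitary frames of parallel sections. -/

section FlatFrames

variable {X : Type*} [TopologicalSpace X] [ChartedSpace ℂ X] {n : ℕ}

namespace HermBundle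

variable {V : HermBundle X n}

theorem IsFrameOn.congr {G G' : ∀ x, ModelFiber n ≃ₗ[ℂ] V.E x} {U : Set X} (hG : V.IsFrameOn G U)
    (hU : IsOpen U) (h : ∀ x ∈ U, G x = G' x) : V.IsFrameOn G' U := by
  refine ⟨fun x hx w => (hG.contMDiffAt x hx w).congr_of_eventuallyEq ?_,
    fun p hp => (hG.contMDiffAt_symm p hp).congr_of_eventuallyEq ?_⟩
  · filter_upwards [continuous_fst.continuousAt.eventually (hU.mem_nhds hx)] with p hp
    rw [h _ hp]
  · filter_upwards [(FiberBundle.continuous_proj (ModelFiber n) V.E).continuousAt.eventually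
      (hU.mem_nhds hp)] with q hq
    rw [h _ hq]

/-- Change of a frame by a smooth family of automorphisms. -/
theorem IsFrameOn.trans {G : ∀ x, ModelFiber n ≃ₗ[ℂ] V.E x} {U : Set X} (hG : V.IsFrameOn G U)
    {H : X → ModelFiber n ≃L[ℂ] ModelFiber n}
    (hH : ∀ x ∈ U, ContMDiffAt 𝓘(ℝ, ℂ) 𝓘(ℝ, ModelFiber n →L[ℂ] ModelFiber n) ∞
      (fun x => (H x : ModelFiber n →L[ℂ] ModelFiber n)) x)
    (hH' : ∀ x ∈ U, ContMDiffAt 𝓘(ℝ, ℂ) 𝓘(ℝ, ModelFiber n →L[ℂ] ModelFiber n) ∞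
      (fun x => ((H x).symm : ModelFiber n →L[ℂ] ModelFiber n)) x) :
    V.IsFrameOn (fun x => (H x).toLinearEquiv.trans (G x)) U := by
  let ev : (ModelFiber n →L[ℂ] ModelFiber n) × ModelFiber n → ModelFiber n := fun q => q.1 q.2
  have hev : ContDiff ℝ ∞ ev := by
    let b : (ModelFiber n →L[ℂ] ModelFiber n) →L[ℝ] ModelFiber n →L[ℝ] ModelFiber n :=
      ContinuousLinearMap.restrictScalarsL ℂ (ModelFiber n) (ModelFiber n) ℝ ℝ
    exact b.isBoundedBilinearMap.contDiff
  refine ⟨fun x hx w => ?_, fun p hp => ?_⟩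
  · have h1 : ContMDiffAt (𝓘(ℝ, ℂ).prod 𝓘(ℝ, ModelFiber n)) 𝓘(ℝ, ModelFiber n) ∞
        (fun p : X × ModelFiber n => ev ((H p.1 : ModelFiber n →L[ℂ] ModelFiber n), p.2)) (x, w) :=
      hev.contMDiff.contMDiffAt.comp (x, w)
        (((hH x hx).comp (x, w) contMDiffAt_fst).prodMk_space contMDiffAt_snd)
    exact (hG.contMDiffAt x hx (H x w)).comp (x, w)
      (f := fun p : X × ModelFiber n => (p.1, ev ((H p.1 : ModelFiber n →L[ℂ] ModelFiber n), p.2)))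
      (contMDiffAt_fst.prodMk h1)
  · have h1 := (hH' _ hp).comp p (contMDiff_proj V.E).contMDiffAt
    exact hev.contMDiff.contMDiffAt.comp p (h1.prodMk_space (hG.contMDiffAt_symm p hp))

theorem IsFrameOn.const_trans {G : ∀ x, ModelFiber n ≃ₗ[ℂ] V.E x} {U : Set X}
    (hG : V.IsFrameOn G U) (C : ModelFiber n ≃L[ℂ] ModelFiber n) :
    V.IsFrameOn (fun x => C.toLinearEquiv.trans (G x)) U :=
  hG.trans (H := fun _ => C) (fun _ _ => contMDiffAt_const) fun _ _ => contMDiffAt_const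

end HermBundle

variable [IsManifold 𝓘(ℂ, ℂ) ω X]

namespace FlatUnitaryBundle

/-- `G` is a unitary frame of parallel sections over the open set `U`. -/
structure IsFlatFrameOn (V : FlatUnitaryBundle X n) (G : ∀ x, ModelFiber n ≃ₗᵢ[ℂ] V.E x)
    (U : Set X) : Prop where
  isOpen : IsOpen U
  isFrameOn : V.IsFrameOn (fun x => (G x).toLinearEquiv) U
  conn_eq_zero : ∀ x ∈ U, ∀ w, V.conn (fun z => G z w) x = 0

variable {V : FlatUnitaryBundle X n}

/-- Inner products of parallel sections are locally constant. -/
theorem eventually_inner_eq [T2Space X] {s t : ∀ x, V.E x} {U : Set X} (hU : IsOpen U) {a : X}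
    (ha : a ∈ U)
    (hs : ∀ x ∈ U, ContMDiffAt 𝓘(ℝ, ℂ) (HermBundle.totalModel n) ∞ (fun z => V.pt z (s z)) x)
    (ht : ∀ x ∈ U, ContMDiffAt 𝓘(ℝ, ℂ) (HermBundle.totalModel n) ∞ (fun z => V.pt z (t z)) x)
    (hs0 : ∀ x ∈ U, V.conn s x = 0) (ht0 : ∀ x ∈ U, V.conn t x = 0) :
    ∀ᶠ z in 𝓝 a, inner ℂ (s z) (t z) = inner ℂ (s a) (t a) := by
  -- Smoothness of the metric is an axiom about global sections, so the local ones are extended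
  -- before it is applied.
  obtain ⟨S, hS, hSs⟩ := V.exists_smooth_extension hU ha hs
  obtain ⟨T, hT, hTt⟩ := V.exists_smooth_extension hU ha ht
  refine eventually_eq_of_mvfderiv_eq_zero (f := fun z => inner ℂ (s z) (t z)) ?_
  filter_upwards [hSs.eventually_nhds, hTt.eventually_nhds, hU.mem_nhds ha] with x hx hx' hxU
  refine ⟨?_, ?_⟩
  · refine ((V.metric_smooth S T hS hT).mdifferentiable (by simp) x).congr_of_eventuallyEq ?_
    filter_upwards [hx, hx'] with z hz hz'
    rw [hz, hz']
  · ext v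
    rw [V.conn_unitary s t x ((hs x hxU).mdifferentiableAt (by simp))
      ((ht x hxU).mdifferentiableAt (by simp)) v, hs0 x hxU, ht0 x hxU]
    simp

/-- In a frame G with connection form η, a section G(g w) has derivative G((dg + η g) w). Thus a
solution of dg = −η g changes G into a parallel frame. -/
theorem exists_parallel_linear_frame [T2Space X] (V : FlatUnitaryBundle X n) (a : X) :
    ∃ (G : ∀ x, ModelFiber n ≃ₗ[ℂ] V.E x) (U : Set X), IsOpen U ∧ a ∈ U ∧ V.IsFrameOn G U ∧
      ∀ x ∈ U, ∀ w, V.conn (fun z => G z w) x = 0 := by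
  classical
  obtain ⟨G, U, hU, ha, hG⟩ := V.exists_isFrameOn a
  obtain ⟨η, N, hN, haN, hNU, hNs, hη, hconn, hF⟩ := exists_connection_form hG hU ha
  set φ := extChartAt 𝓘(ℝ, ℂ) a with hφ
  have hsymm : ∀ᶠ z in 𝓝 (φ a), φ.symm z ∈ N ∧ φ (φ.symm z) = z := by
    have h1 := continuousAt_extChartAt_symm (I := 𝓘(ℝ, ℂ)) a
    have h2 : φ.symm (φ a) = a := φ.left_inv (hNs haN)
    refine (h1.eventually (hN.mem_nhds (by rw [h2]; exact haN))).and ?_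
    exact Filter.mem_of_superset
      ((isOpen_extChartAt_target a).mem_nhds (φ.map_source (hNs haN))) fun z hz => φ.right_inv hz
  obtain ⟨g, -, hg⟩ := exists_smooth_parallel_frame (η := η) (p := φ a)
    (hsymm.mono fun z hz => by simpa [hz.2] using hη _ hz.1)
    (hsymm.mono fun z hz => by simpa [hz.2] using hF _ hz.1)
  have hg' : ∀ᶠ x in 𝓝 a, ContDiffAt ℝ ∞ g (φ x) ∧ IsUnit (g (φ x)) ∧
      HasFDerivAt g (-((ContinuousLinearMap.mul ℝ _).flip (g (φ x)) ∘L η (φ x))) (φ x) :=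
    (continuousAt_extChartAt (I := 𝓘(ℝ, ℂ)) a).eventually hg
  obtain ⟨B, hB, hBo, haB⟩ := eventually_nhds_iff.1 (hg'.and (hN.mem_nhds haN))
  -- The identity is a default value away from the neighbourhood B where g is invertible.
  let H : X → ModelFiber n ≃L[ℂ] ModelFiber n := fun x =>
    if h : IsUnit (g (φ x)) then ContinuousLinearEquiv.ofUnit h.unit
    else ContinuousLinearEquiv.refl ℂ _
  have hH : ∀ x ∈ B, (H x : ModelFiber n →L[ℂ] ModelFiber n) = g (φ x) := fun x hx => by
    simp only [H, dif_pos (hB x hx).1.2.1]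
    rfl
  have hH' : ∀ x ∈ B, ((H x).symm : ModelFiber n →L[ℂ] ModelFiber n) = Ring.inverse (g (φ x)) :=
    fun x hx => by
      simp only [H, dif_pos (hB x hx).1.2.1]
      rw [Ring.inverse_of_isUnit (hB x hx).1.2.1]
      rfl
  have hBs : ∀ x ∈ B, x ∈ φ.source := fun x hx => hNs (hB x hx).2
  have hgφ : ∀ x ∈ B, ContMDiffAt 𝓘(ℝ, ℂ) 𝓘(ℝ, ModelFiber n →L[ℂ] ModelFiber n) ∞
      (fun x => g (φ x)) x := fun x hx =>
    (hB x hx).1.1.contMDiffAt.comp x (contMDiffAt_extChartAt' (by simpa [hφ] using hBs x hx))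
  have hfr : V.IsFrameOn (fun x => (H x).toLinearEquiv.trans (G x)) B := by
    refine (hG.mono fun x hx => hNU (hB x hx).2).trans (fun x hx => ?_) fun x hx => ?_
    · exact (hgφ x hx).congr_of_eventuallyEq
        (Filter.mem_of_superset (hBo.mem_nhds hx) fun z hz => hH z hz)
    · have h1 : ContDiffAt ℝ ∞ Ring.inverse (g (φ x)) := by
        have := contDiffAt_ringInverse ℝ (n := ∞) (hB x hx).1.2.1.unit
        exact this
      exact (h1.contMDiffAt.comp x (hgφ x hx) :
        ContMDiffAt 𝓘(ℝ, ℂ) 𝓘(ℝ, ModelFiber n →L[ℂ] ModelFiber n) ∞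
          (fun x => Ring.inverse (g (φ x))) x).congr_of_eventuallyEq
        (Filter.mem_of_superset (hBo.mem_nhds hx) fun z hz => hH' z hz)
  refine ⟨_, B, hBo, haB, hfr, fun x hx w => ?_⟩
  obtain ⟨L, hL, hL'⟩ : ∃ L : ℂ →L[ℝ] ModelFiber n, HasFDerivAt (fun z => g z w) L (φ x) ∧
      ∀ u, L u = -(η (φ x) u (g (φ x) w)) := by
    let T : (ModelFiber n →L[ℂ] ModelFiber n) →L[ℝ] ModelFiber n :=
      (ContinuousLinearMap.apply ℂ (ModelFiber n) w).restrictScalars ℝ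
    exact ⟨_, T.hasFDerivAt.comp (φ x) (hB x hx).1.2.2, fun u => rfl⟩
  have hm := hasMFDerivAt_comp_extChartAt (hBs x hx) hL
  have hxU : x ∈ U := hNU (hB x hx).2
  have hnear : ∀ᶠ z in 𝓝 x, G z (g (φ z) w) = (H z).toLinearEquiv.trans (G z) w := by
    filter_upwards [hBo.mem_nhds hx] with z hz
    rw [← hH z hz]
    rfl
  rw [← conn_congr (hG.diffAt_apply hxU hm.mdifferentiableAt) hnear]
  ext v
  rw [conn_eq_of_isFrameOn hG hxU hm.mdifferentiableAt, mvfderiv_of_hasMFDerivAt hm,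
    ← chartField_chartDiff (hBs x hx) v, hconn x (hB x hx).2]
  have h2 : (L ∘L chartDiff a x) (chartField a (chartDiff a x v) x)
      = -(η (φ x) (chartDiff a x v) (g (φ x) w)) := by
    rw [← hL']
    change L (chartDiff a x (chartField a (chartDiff a x v) x)) = _
    rw [chartDiff_chartField (hBs x hx)]
  refine (congrArg (fun q => G x q + G x (η (φ x) (chartDiff a x v) (g (φ x) w))) h2).trans ?_
  rw [map_neg, neg_add_cancel]
  rfl

/-- A constant change of frame makes the parallel frame isometric at a. It stays isometric nearby,
since inner products of parallel sections are locally constant. -/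
theorem exists_isFlatFrameOn [T2Space X] (V : FlatUnitaryBundle X n) (a : X) :
    ∃ (G : ∀ x, ModelFiber n ≃ₗᵢ[ℂ] V.E x) (U : Set X), a ∈ U ∧ V.IsFlatFrameOn G U := by
  classical
  obtain ⟨G, U, hU, ha, hG, hG0⟩ := V.exists_parallel_linear_frame a
  let ι := (V.nonempty_isometry a).some
  let C : ModelFiber n ≃L[ℂ] ModelFiber n :=
    (ι.toLinearEquiv.trans (G a).symm).toContinuousLinearEquiv
  let G' : ∀ x, ModelFiber n ≃ₗ[ℂ] V.E x := fun x => C.toLinearEquiv.trans (G x)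
  have hG' : V.IsFrameOn G' U := hG.const_trans C
  have hG'0 : ∀ x ∈ U, ∀ w, V.conn (fun z => G' z w) x = 0 := fun x hx w => hG0 x hx (C w)
  have hG'a : ∀ w, G' a w = ι w := fun w => (G a).apply_symm_apply (ι w)
  let b := EuclideanSpace.basisFun (Fin n) ℂ
  have hort : ∀ᶠ z in 𝓝 a, Orthonormal ℂ (G' z ∘ b) := by
    have h1 : ∀ i j, ∀ᶠ z in 𝓝 a, inner ℂ (G' z (b i)) (G' z (b j))
        = inner ℂ (G' a (b i)) (G' a (b j)) := fun i j =>
      eventually_inner_eq hU ha (fun x hx => hG'.contMDiffAt_apply hx contMDiffAt_const)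
        (fun x hx => hG'.contMDiffAt_apply hx contMDiffAt_const) (fun x hx => hG'0 x hx _)
        (fun x hx => hG'0 x hx _)
    filter_upwards [eventually_all.2 fun i => eventually_all.2 fun j => h1 i j] with z hz
    rw [orthonormal_iff_ite]
    intro i j
    rw [Function.comp_apply, Function.comp_apply, hz i j, hG'a, hG'a, ι.inner_map_map]
    exact orthonormal_iff_ite.1 b.orthonormal i j
  obtain ⟨N, hN, hNo, haN⟩ := eventually_nhds_iff.1 (hort.and (hU.mem_nhds ha))
  let K : ∀ x, ModelFiber n ≃ₗᵢ[ℂ] V.E x := fun x =>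
    if h : Orthonormal ℂ (G' x ∘ b) then
      (G' x).isometryOfOrthonormal (v := b.toBasis) (by simp) (by simpa using h)
    else (V.nonempty_isometry x).some
  have hK : ∀ x ∈ N, (K x).toLinearEquiv = G' x := fun x hx => by
    simp only [K, dif_pos (hN x hx).1]
    ext1 w
    rfl
  have hNU : N ⊆ U := fun x hx => (hN x hx).2
  refine ⟨K, N, haN, hNo, (hG'.mono hNU).congr hNo fun x hx => (hK x hx).symm, fun x hx w => ?_⟩
  rw [← hG'0 x (hNU hx) w]
  refine (conn_congr (hG'.diffAt_apply (hNU hx) mdifferentiableAt_const) ?_).symm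
  filter_upwards [hNo.mem_nhds hx] with z hz
  exact (DFunLike.congr_fun (hK z hz) w).symm

end FlatUnitaryBundle

end FlatFrames


/-! ### The covering space of parallel germs and transport along homotopy classes. -/

section Transport

variable {X : Type*} [TopologicalSpace X] [ChartedSpace ℂ X] [IsManifold 𝓘(ℂ, ℂ) ω X] {n : ℕ}

namespace FlatUnitaryBundle

variable {V : FlatUnitaryBundle X n}

namespace IsFlatFrameOn

variable {G G' : ∀ x, ModelFiber n ≃ₗᵢ[ℂ] V.E x} {U U' : Set X}

theorem diffAt_iff (hG : V.IsFlatFrameOn G U) {x : X} (hx : x ∈ U) {s : ∀ x, V.E x} :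
    V.DiffAt s x ↔
      MDifferentiableAt 𝓘(ℝ, ℂ) 𝓘(ℝ, ModelFiber n) (fun z => (G z).symm (s z)) x :=
  hG.isFrameOn.diffAt_iff hx

theorem conn_eq (hG : V.IsFlatFrameOn G U) {x : X} (hx : x ∈ U) {s : ∀ x, V.E x}
    (hs : V.DiffAt s x) (v : TangentSpace 𝓘(ℝ, ℂ) x) :
    V.conn s x v = G x (mvfderiv 𝓘(ℝ, ℂ) (fun z => (G z).symm (s z)) x v) := by
  have h := conn_eq_of_isFrameOn hG.isFrameOn hx ((hG.diffAt_iff hx).1 hs) v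
  simp only [LinearIsometryEquiv.coe_toLinearEquiv, LinearIsometryEquiv.apply_symm_apply] at h
  rw [h, hG.conn_eq_zero x hx]
  simp

theorem parallelNear_apply (hG : V.IsFlatFrameOn G U) {x : X} (hx : x ∈ U) (w : ModelFiber n) :
    V.ParallelNear (fun z => G z w) x := by
  filter_upwards [hG.isOpen.mem_nhds hx] with z hz
  exact ⟨hG.isFrameOn.diffAt_apply hz mdifferentiableAt_const, hG.conn_eq_zero z hz w⟩

theorem eventually_symm_eq (hG : V.IsFlatFrameOn G U) {x : X} (hx : x ∈ U) {s : ∀ x, V.E x}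
    (hs : V.ParallelNear s x) : ∀ᶠ z in 𝓝 x, (G z).symm (s z) = (G x).symm (s x) := by
  refine eventually_eq_of_mvfderiv_eq_zero (f := fun z => (G z).symm (s z)) ?_
  filter_upwards [hs, hG.isOpen.mem_nhds hx] with z hz hzU
  refine ⟨(hG.diffAt_iff hzU).1 hz.1, ?_⟩
  ext1 v
  have h := hG.conn_eq hzU hz.1 v
  rw [hz.2, _root_.zero_apply, eq_comm, LinearIsometryEquiv.map_eq_zero_iff] at h
  exact h

/-- The coordinates of a parallel section in a flat frame are locally constant. Applying this to the
finitely many basis vectors yields one neighbourhood valid for all w. -/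
theorem eventually_transition_eq (hG : V.IsFlatFrameOn G U) (hG' : V.IsFlatFrameOn G' U') {x : X}
    (hx : x ∈ U) (hx' : x ∈ U') :
    ∀ᶠ z in 𝓝 x, ∀ w, (G' z).symm (G z w) = (G' x).symm (G x w) := by
  let b := EuclideanSpace.basisFun (Fin n) ℂ
  have h : ∀ i, ∀ᶠ z in 𝓝 x, (G' z).symm (G z (b i)) = (G' x).symm (G x (b i)) := fun i =>
    hG'.eventually_symm_eq hx' (hG.parallelNear_apply hx (b i))
  filter_upwards [eventually_all.2 h] with z hz w
  have h2 : ((G z).trans (G' z).symm).toLinearEquiv.toLinearMap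
      = ((G x).trans (G' x).symm).toLinearEquiv.toLinearMap :=
    b.toBasis.ext fun i => by simpa using hz i
  exact LinearMap.congr_fun h2 w

end IsFlatFrameOn

theorem ParallelNear.add {s t : ∀ x, V.E x} {x : X} (hs : V.ParallelNear s x)
    (ht : V.ParallelNear t x) : V.ParallelNear (fun z => s z + t z) x := by
  filter_upwards [hs, ht] with z hz hz'
  exact ⟨hz.1.add hz'.1, by rw [conn_add hz.1 hz'.1, hz.2, hz'.2, add_zero]⟩

theorem ParallelNear.const_smul {s : ∀ x, V.E x} {x : X} (c : ℂ) (hs : V.ParallelNear s x) :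
    V.ParallelNear (fun z => c • s z) x := by
  filter_upwards [hs] with z hz
  refine ⟨hz.1.const_smul c, ContinuousLinearMap.ext fun v => ?_⟩
  rw [V.conn_smul c s z hz.1, hz.2]
  simp

section Covering

variable [T2Space X]

/-- A choice of a flat unitary frame near each point. -/
noncomputable def flatFrame (V : FlatUnitaryBundle X n) (a x : X) : ModelFiber n ≃ₗᵢ[ℂ] V.E x :=
  (V.exists_isFlatFrameOn a).choose x

/-- The domain of the chosen flat frame. -/
noncomputable def flatDomain (V : FlatUnitaryBundle X n) (a : X) : Set X :=
  (V.exists_isFlatFrameOn a).choose_spec.choose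

theorem mem_flatDomain (V : FlatUnitaryBundle X n) (a : X) : a ∈ V.flatDomain a :=
  (V.exists_isFlatFrameOn a).choose_spec.choose_spec.1

theorem isFlatFrameOn_flatFrame (V : FlatUnitaryBundle X n) (a : X) :
    V.IsFlatFrameOn (V.flatFrame a) (V.flatDomain a) :=
  (V.exists_isFlatFrameOn a).choose_spec.choose_spec.2

/-- The model fiber with the discrete topology. -/
def DiscreteFiber (n : ℕ) := ModelFiber n

instance : TopologicalSpace (DiscreteFiber n) := ⊥

instance : DiscreteTopology (DiscreteFiber n) := ⟨rfl⟩

/-- The covering space of parallel germs, as a bundle with discrete fibers. -/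
noncomputable def flatCore (V : FlatUnitaryBundle X n) :
    FiberBundleCore X X (DiscreteFiber n) where
  baseSet := V.flatDomain
  isOpen_baseSet a := (V.isFlatFrameOn_flatFrame a).isOpen
  indexAt := id
  mem_baseSet_at := V.mem_flatDomain
  coordChange a b x w := (V.flatFrame b x).symm (V.flatFrame a x w)
  coordChange_self a x _ w := (V.flatFrame a x).symm_apply_apply w
  continuousOn_coordChange a b := by
    rintro ⟨x, w⟩ ⟨⟨hx, hx'⟩, -⟩
    refine ContinuousAt.continuousWithinAt ?_
    let w' : DiscreteFiber n := (V.flatFrame b x).symm (V.flatFrame a x w)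
    have h0 : ContinuousAt (fun _ : X × DiscreteFiber n => w') (x, w) := continuousAt_const
    refine h0.congr ?_
    have h1 : ∀ᶠ p : X × DiscreteFiber n in 𝓝 (x, w), p.2 = w :=
      continuous_snd.continuousAt.eventually
        ((isOpen_discrete {w}).mem_nhds (Set.mem_singleton w))
    have h2 : ∀ᶠ p : X × DiscreteFiber n in 𝓝 (x, w), ∀ w,
        (V.flatFrame b p.1).symm (V.flatFrame a p.1 w)
          = (V.flatFrame b x).symm (V.flatFrame a x w) :=
      (continuous_fst.tendsto (x, w)).eventually ((V.isFlatFrameOn_flatFrame a).eventually_transition_eq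
      (V.isFlatFrameOn_flatFrame b) hx hx')
    filter_upwards [h1, h2] with p hp hp'
    rw [hp]
    exact (hp' w).symm
  coordChange_comp a b c x _ w :=
    congrArg (V.flatFrame c x).symm ((V.flatFrame b x).apply_symm_apply _)

/-- Locally constant transitions are continuous for the discrete topology on the fiber. Path lifting
in this covering gives transport along continuous paths, and its homotopy invariance. -/
theorem isCoveringMap_flatCore (V : FlatUnitaryBundle X n) :
    IsCoveringMap (TotalSpace.proj : V.flatCore.TotalSpace → X) :=
  FiberBundle.isCoveringMap (F := DiscreteFiber n)

/-- The point of the covering space given by a vector. -/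
noncomputable def germ (V : FlatUnitaryBundle X n) (x : X) (v : V.E x) : V.flatCore.TotalSpace :=
  ⟨x, (V.flatFrame x x).symm v⟩

/-- Parallel transport along a homotopy class of paths. -/
noncomputable def transport (V : FlatUnitaryBundle X n) {x y : X}
    (q : Path.Homotopic.Quotient x y) (v : V.E x) : V.E y :=
  V.flatFrame y y (V.isCoveringMap_flatCore.monodromy q ⟨V.germ x v, rfl⟩).1.2

theorem exists_eq_germ (p : V.flatCore.TotalSpace) (x : X) (h : p.proj = x) :
    ∃ v : V.E x, p = V.germ x v := by
  obtain ⟨y, w⟩ := p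
  obtain rfl : y = x := h
  exact ⟨V.flatFrame y y w, congrArg (TotalSpace.mk y) ((V.flatFrame y y).symm_apply_apply w).symm⟩

theorem germ_transport {x y : X} (q : Path.Homotopic.Quotient x y) (v : V.E x) :
    V.germ y (V.transport q v) = (V.isCoveringMap_flatCore.monodromy q ⟨V.germ x v, rfl⟩).1 := by
  obtain ⟨w, hw⟩ := exists_eq_germ _ y (V.isCoveringMap_flatCore.monodromy q ⟨V.germ x v, rfl⟩).2
  rw [transport, hw, germ, germ]
  simp

theorem germ_injective {x : X} {v w : V.E x} (h : V.germ x v = V.germ x w) : v = w := by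
  have h' : (⟨x, (V.flatFrame x x).symm v⟩ : V.flatCore.TotalSpace)
    = ⟨x, (V.flatFrame x x).symm w⟩ := h
  injection h' with _ h2
  exact (V.flatFrame x x).symm.injective h2

theorem transport_refl {x : X} (v : V.E x) :
    V.transport (Path.Homotopic.Quotient.refl x) v = v := by
  apply germ_injective
  rw [germ_transport, IsCoveringMap.monodromy_refl]
  rfl

theorem transport_trans {x y z : X} (q : Path.Homotopic.Quotient x y)
    (q' : Path.Homotopic.Quotient y z) (v : V.E x) :
    V.transport (q.trans q') v = V.transport q' (V.transport q v) := by
  apply germ_injective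
  rw [germ_transport, germ_transport, IsCoveringMap.monodromy_trans_apply]
  congr 2
  exact Subtype.ext (germ_transport q v).symm

theorem continuousOn_germ (a : X) (w : ModelFiber n) :
    ContinuousOn (fun z => V.germ z (V.flatFrame a z w)) (V.flatDomain a) := by
  have h := (V.flatCore.localTriv a).toOpenPartialHomeomorph.continuousOn_symm
  have h' : ContinuousOn (fun z : X => ((z, w) : X × DiscreteFiber n)) (V.flatDomain a) :=
    (continuous_id.prodMk continuous_const).continuousOn
  refine (h.comp h' fun z hz => ⟨hz, trivial⟩).congr fun z hz => ?_
  rfl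

/-- A lift of γ that is locally a parallel section along γ is the same thing as a continuous lift to
the covering of germs. Existence and uniqueness of transport are therefore those of path lifting. -/
theorem transport_iff {x y : X} (γ : Path x y) (v : V.E x) (w : V.E y) :
    V.Transport γ v w ↔ V.transport (Path.Homotopic.Quotient.mk γ) v = w := by
  have hcov := V.isCoveringMap_flatCore
  constructor
  · rintro ⟨c, hc0, hc1, hc⟩
    have hcont : Continuous fun t => V.germ (γ t) (c t) := by
      refine continuous_iff_continuousAt.2 fun t => ?_
      obtain ⟨s, hs, hst⟩ := hc t
      have h1 := (V.isFlatFrameOn_flatFrame (γ t)).eventually_symm_eq (V.mem_flatDomain _) hs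
      have h2 : ContinuousAt (fun z => V.germ z
          (V.flatFrame (γ t) z ((V.flatFrame (γ t) (γ t)).symm (s (γ t))))) (γ t) :=
        (continuousOn_germ (γ t) _).continuousAt
          ((V.isFlatFrameOn_flatFrame _).isOpen.mem_nhds (V.mem_flatDomain _))
      have h3 := h2.comp (f := γ) (x := t) γ.continuous.continuousAt
      refine h3.congr ?_
      filter_upwards [hst, γ.continuous.continuousAt.eventually h1] with t' ht' ht''
      rw [Function.comp_apply, ht', ← ht'', LinearIsometryEquiv.apply_symm_apply]
    -- The end points of γ equal x and y only propositionally, so vectors over them are compared as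
    -- points of the total space.
    have hinj : ∀ {x y : X} {v : V.E x} {w : V.E y}, V.pt x v = V.pt y w →
        V.germ x v = V.germ y w := by
      rintro x y v w h
      obtain rfl : x = y := congrArg TotalSpace.proj h
      rw [TotalSpace.mk_inj] at h
      rw [h]
    let Γ : Path (V.germ x v) (V.germ y w) := ⟨⟨_, hcont⟩, hinj hc0, hinj hc1⟩
    apply germ_injective
    rw [germ_transport]
    have h := hcov.monodromy_eq_of_map_eq (γ := Path.Homotopic.Quotient.mk γ)
      (ex := ⟨V.germ x v, rfl⟩) (ey := ⟨V.germ y w, rfl⟩) (Path.Homotopic.Quotient.mk Γ) rfl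
    rw [h]
  · rintro rfl
    have h0 : γ 0 = TotalSpace.proj (V.germ x v) := γ.source
    let Γ := hcov.liftPath γ (V.germ x v) h0
    have hΓ : ∀ t, (Γ t).proj = γ t := fun t => congrFun (hcov.liftPath_lifts γ _ h0) t
    have hΓ0 : Γ 0 = V.germ x v := hcov.liftPath_zero γ _ h0
    have hΓ1 : Γ 1 = V.germ y (V.transport (Path.Homotopic.Quotient.mk γ) v) :=
      (germ_transport (V := V) (Path.Homotopic.Quotient.mk γ) v).symm
    choose c hc using fun t => exists_eq_germ (Γ t) (γ t) (hΓ t)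
    have hinj : ∀ {x y : X} {v : V.E x} {w : V.E y}, V.germ x v = V.germ y w →
        V.pt x v = V.pt y w := by
      rintro x y v w h
      obtain rfl : x = y := congrArg TotalSpace.proj h
      rw [germ_injective h]
    refine ⟨c, hinj ((hc 0).symm.trans hΓ0), hinj ((hc 1).symm.trans hΓ1), fun t => ?_⟩
    let a := γ t
    let e := V.flatCore.localTriv a
    have hmem : Γ t ∈ e.source := (V.flatCore.mem_localTriv_source a _).2 (by
      rw [hΓ t]
      exact V.mem_flatDomain (γ t))
    -- A continuous function to the discrete fiber is locally constant: near t the lift has constant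
    -- coordinates in the flat frame at γ t, that is, it is a parallel section along γ.
    have h1 : ContinuousAt (fun t' => (e (Γ t')).2) t :=
      ((e.continuousAt hmem).comp (f := Γ) (x := t) Γ.continuous.continuousAt).snd
    have h2 : ∀ᶠ t' in 𝓝 t, (e (Γ t')).2 = (e (Γ t)).2 :=
      h1.eventually ((isOpen_discrete {(e (Γ t)).2}).mem_nhds (Set.mem_singleton _))
    refine ⟨fun z => V.flatFrame a z ((e (Γ t)).2 : DiscreteFiber n),
      (V.isFlatFrameOn_flatFrame a).parallelNear_apply (V.mem_flatDomain a) _, ?_⟩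
    filter_upwards [h2] with t' ht'
    rw [← ht', hc t']
    have h3 : (e (V.germ (γ t') (c t'))).2 = (V.flatFrame a (γ t')).symm
        (V.flatFrame (γ t') (γ t') ((V.flatFrame (γ t') (γ t')).symm (c t'))) := rfl
    rw [h3]
    simp

end Covering

end FlatUnitaryBundle

end Transport


/-! ### Smoothness of σ and surjectivity of its differential. -/

section InvolutionSmooth

variable {X : Type*} [TopologicalSpace X] [ChartedSpace ℂ X]

theorem AntiholInvolution.contMDiff (σ : AntiholInvolution X) :
    ContMDiff 𝓘(ℝ, ℂ) 𝓘(ℝ, ℂ) ∞ σ := by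
  intro x
  have h1 := σ.antiholomorphic x
  have h2 : ContMDiffAt 𝓘(ℝ, ℂ) 𝓘(ℝ, ℂ) ∞
      (fun z => (starRingEnd ℂ) (chartAt ℂ (σ x) (σ z))) x := by
    rw [contMDiffAt_iff] at h1 ⊢
    exact ⟨h1.1, (h1.2.restrict_scalars ℝ).of_le le_top⟩
  rw [contMDiffAt_iff_target]
  refine ⟨σ.continuous_toFun.continuousAt, ?_⟩
  have h3 : ContMDiff 𝓘(ℝ, ℂ) 𝓘(ℝ, ℂ) ∞ (starRingEnd ℂ : ℂ → ℂ) :=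
    (Complex.conjCLE : ℂ →L[ℝ] ℂ).contMDiff
  refine (h3.contMDiffAt.comp x h2).congr_of_eventuallyEq (Filter.Eventually.of_forall fun z => ?_)
  simp

/-- The chain rule for σ ∘ σ = id. Equivariance of ∇ speaks only of vectors dσ(u); this shows that
they exhaust the tangent space. -/
theorem AntiholInvolution.mfderiv_surjective (σ : AntiholInvolution X) (x : X)
    (v : TangentSpace 𝓘(ℝ, ℂ) (σ x)) : ∃ u : TangentSpace 𝓘(ℝ, ℂ) x,
      mfderiv 𝓘(ℝ, ℂ) 𝓘(ℝ, ℂ) σ x u = v := by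
  have hd := σ.contMDiff.mdifferentiable (by simp)
  have h1 : σ.toFun ∘ σ.toFun = id := funext σ.involutive
  obtain ⟨y, rfl⟩ : ∃ y, σ y = x := ⟨σ x, σ.involutive x⟩
  have key : ∀ z, z = y → ∀ v : TangentSpace 𝓘(ℝ, ℂ) z,
      ∃ u : TangentSpace 𝓘(ℝ, ℂ) (σ y), mfderiv 𝓘(ℝ, ℂ) 𝓘(ℝ, ℂ) σ (σ y) u = v := by
    rintro z rfl v
    have h2 := mfderiv_comp (I := 𝓘(ℝ, ℂ)) (I' := 𝓘(ℝ, ℂ)) (I'' := 𝓘(ℝ, ℂ)) z (hd (σ z)) (hd z)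
    rw [h1, mfderiv_id] at h2
    exact ⟨mfderiv 𝓘(ℝ, ℂ) 𝓘(ℝ, ℂ) σ z v, (DFunLike.congr_fun h2 v).symm⟩
  exact key (σ (σ y)) (σ.involutive y) v

end InvolutionSmooth

/-! ### Transport is isometric and compatible with isomorphisms and with the lift of σ. -/

section TransportProperties

variable {X : Type*} [TopologicalSpace X] [ChartedSpace ℂ X] [IsManifold 𝓘(ℂ, ℂ) ω X] {n : ℕ}

namespace FlatUnitaryBundle

variable {V V' : FlatUnitaryBundle X n}

theorem Transport.add {x y : X} {γ : Path x y} {v v' : V.E x} {w w' : V.E y}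
    (h : V.Transport γ v w) (h' : V.Transport γ v' w') : V.Transport γ (v + v') (w + w') := by
  obtain ⟨c, h0, h1, hc⟩ := h
  obtain ⟨c', h0', h1', hc'⟩ := h'
  have hadd : ∀ {x y : X} {v v' : V.E x} {w w' : V.E y}, V.pt x v = V.pt y w →
      V.pt x v' = V.pt y w' → V.pt x (v + v') = V.pt y (w + w') := by
    rintro x y v v' w w' h h'
    obtain rfl : x = y := congrArg TotalSpace.proj h
    rw [TotalSpace.mk_inj] at h h'
    rw [h, h']
  refine ⟨fun t => c t + c' t, hadd h0 h0', hadd h1 h1', fun t => ?_⟩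
  obtain ⟨s, hs, hst⟩ := hc t
  obtain ⟨s', hs', hst'⟩ := hc' t
  refine ⟨_, hs.add hs', ?_⟩
  filter_upwards [hst, hst'] with t' ht ht'
  rw [ht, ht']

/-- Images of parallel lifts under a map that preserves parallel sections. -/
theorem Transport.map {x y : X} {γ : Path x y} {v : V.E x} {w : V.E y}
    (h : V.Transport γ v w) (Φ : ∀ x, V.E x → V'.E x)
    (hΦ : ∀ s x, V.ParallelNear s x → V'.ParallelNear (fun z => Φ z (s z)) x) :
    V'.Transport γ (Φ x v) (Φ y w) := by
  obtain ⟨c, h0, h1, hc⟩ := h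
  refine ⟨fun t => Φ _ (c t), congrArg (fun p : V.Total => V'.pt p.proj (Φ p.proj p.snd)) h0,
    congrArg (fun p : V.Total => V'.pt p.proj (Φ p.proj p.snd)) h1, fun t => ?_⟩
  obtain ⟨s, hs, hst⟩ := hc t
  refine ⟨_, hΦ s _ hs, ?_⟩
  filter_upwards [hst] with t' ht
  rw [ht]

theorem Transport.const_smul {x y : X} {γ : Path x y} {v : V.E x} {w : V.E y}
    (h : V.Transport γ v w) (a : ℂ) : V.Transport γ (a • v) (a • w) :=
  h.map (fun _ v => a • v) fun _ _ hs => hs.const_smul a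

/-- In a unitary flat frame both lifts have locally constant coordinates, so their inner product is
locally constant on the connected interval. -/
theorem Transport.inner_eq [T2Space X] {x y : X} {γ : Path x y} {v v' : V.E x} {w w' : V.E y}
    (h : V.Transport γ v w) (h' : V.Transport γ v' w') : inner ℂ w w' = inner ℂ v v' := by
  obtain ⟨c, h0, h1, hc⟩ := h
  obtain ⟨c', h0', h1', hc'⟩ := h'
  have hinn : ∀ {x y : X} {v v' : V.E x} {w w' : V.E y}, V.pt x v = V.pt y w →
      V.pt x v' = V.pt y w' → inner ℂ v v' = inner ℂ w w' := by
    rintro x y v v' w w' h h'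
    obtain rfl : x = y := congrArg TotalSpace.proj h
    rw [TotalSpace.mk_inj] at h h'
    rw [h, h']
  rw [← hinn h0 h0', ← hinn h1 h1']
  have hloc : IsLocallyConstant fun t => inner ℂ (c t) (c' t) := by
    rw [IsLocallyConstant.iff_eventually_eq]
    intro t
    obtain ⟨s, hs, hst⟩ := hc t
    obtain ⟨s', hs', hst'⟩ := hc' t
    obtain ⟨G, U, ha, hG⟩ := V.exists_isFlatFrameOn (γ t)
    filter_upwards [hst, hst', γ.continuous.continuousAt.eventually (hG.eventually_symm_eq ha hs),
      γ.continuous.continuousAt.eventually (hG.eventually_symm_eq ha hs')] with t' e1 e2 e3 e4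
    rw [e1, e2, hst.self_of_nhds, hst'.self_of_nhds, ← (G (γ t')).symm.inner_map_map, e3, e4,
      (G (γ t)).symm.inner_map_map]
  exact hloc.apply_eq_of_preconnectedSpace 1 0

theorem IsFlatFrameOn.transport {G : ∀ x, ModelFiber n ≃ₗᵢ[ℂ] V.E x} {U : Set X}
    (hG : V.IsFlatFrameOn G U) {x y : X} {γ : Path x y} (hγ : ∀ t, γ t ∈ U) (w : ModelFiber n) :
    V.Transport γ (G x w) (G y w) := by
  have hpt : ∀ {x y : X}, x = y → V.pt x (G x w) = V.pt y (G y w) := by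
    rintro x y rfl
    rfl
  exact ⟨fun t => G (γ t) w, hpt γ.source, hpt γ.target, fun t =>
    ⟨fun z => G z w, hG.parallelNear_apply (hγ t) w, Filter.Eventually.of_forall fun _ => rfl⟩⟩

variable [T2Space X]

/-- Parallel transport along a homotopy class of paths, as an isometry. -/
noncomputable def transportIso (V : FlatUnitaryBundle X n) {x y : X}
    (q : Path.Homotopic.Quotient x y) : V.E x ≃ₗᵢ[ℂ] V.E y :=
  LinearEquiv.isometryOfInner
    { toFun := V.transport q
      invFun := V.transport q.symm
      map_add' := fun v w => by
        induction q with | mk γ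
        exact (transport_iff γ _ _).1
          (((transport_iff γ v _).2 rfl).add ((transport_iff γ w _).2 rfl))
      map_smul' := fun a v => by
        induction q with | mk γ
        exact (transport_iff γ _ _).1 (((transport_iff γ v _).2 rfl).const_smul a)
      left_inv := fun v => by
        rw [← transport_trans, Path.Homotopic.Quotient.trans_symm, transport_refl]
      right_inv := fun v => by
        rw [← transport_trans, Path.Homotopic.Quotient.symm_trans, transport_refl] }
    fun v w => by
      induction q with | mk γ
      exact ((transport_iff γ v _).2 rfl).inner_eq ((transport_iff γ w _).2 rfl)

theorem transport_iff' {x y : X} (γ : Path x y) (v : V.E x) (w : V.E y) :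
    V.Transport γ v w ↔ V.transportIso (Path.Homotopic.Quotient.mk γ) v = w :=
  transport_iff γ v w

theorem transportIso_trans {x y z : X} (q : Path.Homotopic.Quotient x y)
    (q' : Path.Homotopic.Quotient y z) (v : V.E x) :
    V.transportIso (q.trans q') v = V.transportIso q' (V.transportIso q v) :=
  transport_trans q q' v

theorem transportIso_symm {x y : X} (q : Path.Homotopic.Quotient x y) (v : V.E y) :
    V.transportIso q.symm v = (V.transportIso q).symm v :=
  rfl

end FlatUnitaryBundle

namespace FlatTriple

open FlatUnitaryBundle

variable {σ : AntiholInvolution X} {k : StructureKind} {V V' : FlatTriple σ k n}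

theorem IsIso.parallelNear {Φ : ∀ x, V.E x ≃ₗ[ℂ] V'.E x} (h : IsIso V V' Φ) {s : ∀ x, V.E x} {x : X}
    (hs : V.ParallelNear s x) : V'.ParallelNear (fun z => Φ z (s z)) x := by
  filter_upwards [hs] with z hz
  refine ⟨((h.smooth.mdifferentiable (by simp)) _).comp z hz.1, ContinuousLinearMap.ext fun v => ?_⟩
  rw [h.conn s z hz.1 v, hz.2]
  simp

theorem IsIso.transport {Φ : ∀ x, V.E x ≃ₗ[ℂ] V'.E x} (h : IsIso V V' Φ) {x y : X} {γ : Path x y}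
    {v : V.E x} {w : V.E y} (hT : V.Transport γ v w) : V'.Transport γ (Φ x v) (Φ y w) :=
  hT.map (fun x => Φ x) fun _ _ => h.parallelNear

/-- The image of a section under the lift of `σ`. -/
def liftSection (V : FlatTriple σ k n) (s : ∀ x, V.E x) (y : X) : V.E y :=
  σ.involutive y ▸ V.lift (σ y) (s (σ y))

theorem pt_liftSection (s : ∀ x, V.E x) (y : X) :
    V.pt y (V.liftSection s y) = V.pt (σ (σ y)) (V.lift (σ y) (s (σ y))) := by
  have key : ∀ {a b : X} (h : a = b) (v : V.E a), V.pt b (h ▸ v) = V.pt a v := by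
    rintro a b rfl v
    rfl
  exact key _ _

theorem liftSection_apply (s : ∀ x, V.E x) (x : X) :
    V.liftSection s (σ x) = V.lift x (s x) := by
  have h := pt_liftSection s (σ x)
  have key : ∀ y, y = x → V.pt (σ y) (V.lift y (s y)) = V.pt (σ x) (V.lift x (s x)) := by
    rintro y rfl
    rfl
  rw [key _ (σ.involutive x), TotalSpace.mk_inj] at h
  exact h

/-- Equivariance annihilates ∇ of the image section on every vector dσ(u), hence on all tangent
vectors. This is what makes σ̃ commute with transport. -/
theorem parallelNear_liftSection {s : ∀ x, V.E x} {x : X} (hs : V.ParallelNear s x) :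
    V.ParallelNear (V.liftSection s) (σ x) := by
  have hσ : Tendsto σ (𝓝 (σ x)) (𝓝 x) := by
    have := σ.continuous_toFun.tendsto (σ x)
    rwa [σ.involutive] at this
  have key : ∀ z, V.DiffAt s z ∧ V.conn s z = 0 →
      V.DiffAt (V.liftSection s) (σ z) ∧ V.conn (V.liftSection s) (σ z) = 0 := by
    rintro z ⟨h1, h2⟩
    refine ⟨?_, ContinuousLinearMap.ext fun v => ?_⟩
    · have h3 : (fun y => V.pt y (V.liftSection s y))
          = fun y => (fun p : V.Total => V.pt (σ p.proj) (V.lift p.proj p.snd))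
            ((fun z => V.pt z (s z)) (σ y)) := funext fun y => pt_liftSection s y
      unfold HermBundle.DiffAt
      rw [h3]
      refine ((V.lift_smooth.mdifferentiable (by simp)) _).comp (σ z) ?_
      refine MDifferentiableAt.comp (σ z) (g := fun z => V.pt z (s z)) ?_
        (σ.contMDiff.mdifferentiable (by simp) _)
      rwa [σ.involutive]
    · obtain ⟨u, rfl⟩ := σ.mfderiv_surjective z v
      rw [V.conn_equivariant s _ (fun x => liftSection_apply s x) z h1 u, h2]
      simp
  filter_upwards [hσ.eventually hs] with z hz
  have := key _ hz
  rwa [σ.involutive] at this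

theorem transport_lift {x y : X} {γ : Path x y} {v : V.E x} {w : V.E y}
    (hT : V.Transport γ v w) :
    V.Transport (γ.map σ.continuous_toFun) (V.lift x v) (V.lift y w) := by
  obtain ⟨c, h0, h1, hc⟩ := hT
  refine ⟨fun t => V.lift (γ t) (c t),
    congrArg (fun p : V.Total => V.pt (σ p.proj) (V.lift p.proj p.snd)) h0,
    congrArg (fun p : V.Total => V.pt (σ p.proj) (V.lift p.proj p.snd)) h1, fun t => ?_⟩
  obtain ⟨s, hs, hst⟩ := hc t
  refine ⟨V.liftSection s, parallelNear_liftSection hs, ?_⟩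
  filter_upwards [hst] with t' ht
  rw [ht]
  exact (liftSection_apply s (γ t')).symm

theorem transportIso_map [T2Space X] {x y : X} (q : Path.Homotopic.Quotient x y) (v : V.E x) :
    V.transportIso (q.map σ.toContinuousMap) (V.lift x v) = V.lift y (V.transportIso q v) := by
  induction q with | mk γ
  exact (transport_iff' _ _ _).1 (transport_lift ((transport_iff' γ v _).2 rfl))

end FlatTriple

end TransportProperties


/-! ### Brackets and second derivatives in charts, for the curvature of the constructed connection.
-/

section FieldsInCharts

variable {X : Type*} [TopologicalSpace X] [ChartedSpace ℂ X] [IsManifold 𝓘(ℂ, ℂ) ω X]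
  {W : Type*} [NormedAddCommGroup W] [NormedSpace ℝ W]

theorem contMDiffAt_chartDiff_apply {U : ∀ x : X, TangentSpace 𝓘(ℝ, ℂ) x}
    (hU : IsSmoothVectorField U) (x : X) :
    ContMDiffAt 𝓘(ℝ, ℂ) 𝓘(ℝ, ℂ) ∞ (fun z => chartDiff x z (U z)) x := by
  let e := trivializationAt ℂ (TangentSpace 𝓘(ℝ, ℂ) (M := X)) x
  have hb : ∀ y, y ∈ (chartAt ℂ x).source → y ∈ e.baseSet := fun y hy => by
    rwa [TangentBundle.trivializationAt_baseSet]
  have h1 := ((e.contMDiffAt_iff (IB := 𝓘(ℝ, ℂ)) (n := ∞)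
    (by rw [e.mem_source]; exact hb x (mem_chart_source ℂ x))).1 (hU x)).2
  refine h1.congr_of_eventuallyEq ?_
  filter_upwards [chart_source_mem_nhds ℂ x] with y hy
  have h2 := congrArg (fun T : TangentSpace 𝓘(ℝ, ℂ) y →L[ℝ] ℂ => T (U y))
    (TangentBundle.continuousLinearMapAt_trivializationAt (I := 𝓘(ℝ, ℂ)) hy)
  refine h2.symm.trans ?_
  exact congrFun (e.coe_linearMapAt_of_mem (R := ℝ) (hb y hy)) _

theorem mlieBracket_model_eq_lieBracket (u u' : ∀ z : ℂ, TangentSpace 𝓘(ℝ, ℂ) z) (p : ℂ) :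
    VectorField.mlieBracket 𝓘(ℝ, ℂ) u u' p = VectorField.lieBracket ℝ (E := ℂ) u u' p := by
  rw [← VectorField.mlieBracketWithin_univ, VectorField.mlieBracketWithin_eq_lieBracketWithin]
  exact congrFun (VectorField.lieBracketWithin_univ (𝕜 := ℝ) (V := (u : ℂ → ℂ)) (W := (u' : ℂ → ℂ))) p

/-- The bracket of vector fields in a chart. -/
theorem mlieBracket_eq_chartField {U U' : ∀ x : X, TangentSpace 𝓘(ℝ, ℂ) x} {x : X} {u u' : ℂ → ℂ}
    (hu : DifferentiableAt ℝ u (extChartAt 𝓘(ℝ, ℂ) x x))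
    (hu' : DifferentiableAt ℝ u' (extChartAt 𝓘(ℝ, ℂ) x x))
    (hU : ∀ᶠ z in 𝓝 x, U z = chartField x (u (extChartAt 𝓘(ℝ, ℂ) x z)) z)
    (hU' : ∀ᶠ z in 𝓝 x, U' z = chartField x (u' (extChartAt 𝓘(ℝ, ℂ) x z)) z) :
    VectorField.mlieBracket 𝓘(ℝ, ℂ) U U' x
      = chartField x (VectorField.lieBracket ℝ u u' (extChartAt 𝓘(ℝ, ℂ) x x)) x := by
  have hc : ∀ {u : ℂ → ℂ}, DifferentiableAt ℝ u (extChartAt 𝓘(ℝ, ℂ) x x) →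
      MDifferentiableAt 𝓘(ℝ, ℂ) 𝓘(ℝ, ℂ).tangent
      (fun z : ℂ => (⟨z, u z⟩ : TangentBundle 𝓘(ℝ, ℂ) ℂ)) (extChartAt 𝓘(ℝ, ℂ) x x) := fun {u} hu => by
    refine (mdifferentiableAt_section 𝓘(ℝ, ℂ) (F := ℂ) (E := TangentSpace 𝓘(ℝ, ℂ)) u).2 ?_
    simp only [trivializationAt_model_space_apply]
    exact hu.mdifferentiableAt
  have h := VectorField.mpullback_mlieBracket (I := 𝓘(ℝ, ℂ)) (I' := 𝓘(ℝ, ℂ)) (n := 2)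
    (f := extChartAt 𝓘(ℝ, ℂ) x) (x₀ := x) (hc hu) (hc hu')
    (contMDiffAt_extChartAt' (by simp)) (by simp)
  rw [Filter.EventuallyEq.mlieBracket_vectorField_eq hU hU']
  refine h.symm.trans ?_
  rw [VectorField.mpullback_apply]
  exact congrArg (fun v => chartField x v x) (mlieBracket_model_eq_lieBracket u u' _)

/-- Directional derivatives along smooth fields commute up to the bracket. -/
theorem mvfderiv_mvfderiv_sub {f : X → W} {x : X}
    (hf : ∀ᶠ z in 𝓝 x, ContMDiffAt 𝓘(ℝ, ℂ) 𝓘(ℝ, W) ∞ f z)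
    {U U' : ∀ x : X, TangentSpace 𝓘(ℝ, ℂ) x} (hU : IsSmoothVectorField U)
    (hU' : IsSmoothVectorField U') :
    mvfderiv 𝓘(ℝ, ℂ) (fun z => mvfderiv 𝓘(ℝ, ℂ) f z (U' z)) x (U x)
      - mvfderiv 𝓘(ℝ, ℂ) (fun z => mvfderiv 𝓘(ℝ, ℂ) f z (U z)) x (U' x)
      - mvfderiv 𝓘(ℝ, ℂ) f x (VectorField.mlieBracket 𝓘(ℝ, ℂ) U U' x) = 0 := by
  set φ := extChartAt 𝓘(ℝ, ℂ) x with hφ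
  have hx : x ∈ φ.source := mem_extChartAt_source x
  let F : ℂ → W := fun y => f (φ.symm y)
  have hF : ∀ᶠ z in 𝓝 x, z ∈ φ.source ∧ ContDiffAt ℝ ∞ F (φ z) := by
    filter_upwards [hf, extChartAt_source_mem_nhds (I := 𝓘(ℝ, ℂ)) x] with z hz hzs
    exact ⟨hzs, contDiffAt_comp_extChartAt_symm hzs hz⟩
  have hFx : ContDiffAt ℝ ∞ F (φ x) := hF.self_of_nhds.2
  -- The coordinate expression of a vector field in the chart at x.
  let c : (∀ x : X, TangentSpace 𝓘(ℝ, ℂ) x) → ℂ → ℂ := fun U y =>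
    chartDiff x (φ.symm y) (U (φ.symm y))
  have hcd : ∀ {U : ∀ x : X, TangentSpace 𝓘(ℝ, ℂ) x}, IsSmoothVectorField U →
      DifferentiableAt ℝ (c U) (φ x) := fun hU =>
    (contDiffAt_comp_extChartAt_symm hx (contMDiffAt_chartDiff_apply hU x)).differentiableAt
      (by simp)
  have hcz : ∀ (U : ∀ x : X, TangentSpace 𝓘(ℝ, ℂ) x), ∀ z ∈ φ.source,
      c U (φ z) = chartDiff x z (U z) := fun U z hz => by
    have key : ∀ y, y = z → chartDiff x y (U y) = chartDiff x z (U z) := by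
      rintro y rfl
      rfl
    exact key _ (φ.left_inv hz)
  have hcU : ∀ (U : ∀ x : X, TangentSpace 𝓘(ℝ, ℂ) x),
      ∀ᶠ z in 𝓝 x, U z = chartField x (c U (φ z)) z := fun U => by
    filter_upwards [extChartAt_source_mem_nhds (I := 𝓘(ℝ, ℂ)) x] with z hz
    rw [hcz U z hz, chartField_chartDiff hz]
  have hF' : DifferentiableAt ℝ (fderiv ℝ F) (φ x) :=
    (hFx.fderiv_right (m := ∞) (by simp)).differentiableAt (by simp)
  have hder : ∀ {U U' : ∀ x : X, TangentSpace 𝓘(ℝ, ℂ) x}, IsSmoothVectorField U →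
      IsSmoothVectorField U' →
      mvfderiv 𝓘(ℝ, ℂ) (fun z => mvfderiv 𝓘(ℝ, ℂ) f z (U' z)) x (U x)
        = fderiv ℝ (fderiv ℝ F) (φ x) (c U (φ x)) (c U' (φ x))
          + fderiv ℝ F (φ x) (fderiv ℝ (c U') (φ x) (c U (φ x))) := by
    intro U U' hU hU'
    have h1 : HasFDerivAt (fun y => fderiv ℝ F y (c U' y)) _ (φ x) :=
      hF'.hasFDerivAt.clm_apply (hcd hU').hasFDerivAt
    have h2 := (hasMFDerivAt_comp_extChartAt hx h1).congr_of_eventuallyEq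
      (f₁ := fun z => mvfderiv 𝓘(ℝ, ℂ) f z (U' z)) (by
        filter_upwards [hF] with z hz
        rw [hcz U' z hz.1]
        exact mvfderiv_eq_fderiv hz.1 (hz.2.differentiableAt (by simp)) _)
    refine (mvfderiv_of_hasMFDerivAt h2 _).trans ?_
    have h3 : chartDiff x x (U x) = c U (φ x) := (hcz U x hx).symm
    refine (congrArg (fderiv ℝ F (φ x) ∘L fderiv ℝ (c U') (φ x)
      + (fderiv ℝ (fderiv ℝ F) (φ x)).flip (c U' (φ x))) h3).trans ?_
    simp only [_root_.add_apply, ContinuousLinearMap.comp_apply, ContinuousLinearMap.flip_apply]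
    exact add_comm _ _
  have h2 : (2 : WithTop ℕ∞) ≤ ∞ := WithTop.coe_le_coe.2 (le_top : (2 : ℕ∞) ≤ ⊤)
  -- Symmetry of the second derivative cancels the second-order terms; the first-order terms
  -- assemble into the bracket.
  have hsymm := hFx.isSymmSndFDerivAt (by simpa using h2)
  rw [hder hU hU', hder hU' hU, mlieBracket_eq_chartField (hcd hU) (hcd hU') (hcU U) (hcU U'),
    mvfderiv_eq_fderiv hx (hFx.differentiableAt (by simp)), chartDiff_chartField hx,
    VectorField.lieBracket, map_sub, hsymm.eq]
  abel

/-- The differential of a smooth function is smooth. -/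
theorem contMDiffAt_mvfderiv_comp_symmL {f : X → W} {x : X}
    (hf : ∀ᶠ z in 𝓝 x, ContMDiffAt 𝓘(ℝ, ℂ) 𝓘(ℝ, W) ∞ f z) :
    ContMDiffAt 𝓘(ℝ, ℂ) 𝓘(ℝ, ℂ →L[ℝ] W) ∞ (fun z => mvfderiv 𝓘(ℝ, ℂ) f z ∘L
      (trivializationAt ℂ (TangentSpace 𝓘(ℝ, ℂ) (M := X)) x).symmL ℝ z) x := by
  set φ := extChartAt 𝓘(ℝ, ℂ) x with hφ
  have hx : x ∈ φ.source := mem_extChartAt_source x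
  let e := trivializationAt ℂ (TangentSpace 𝓘(ℝ, ℂ) (M := X)) x
  have h1 : ContDiffAt ℝ ∞ (fderiv ℝ fun y => f (φ.symm y)) (φ x) :=
    (contDiffAt_comp_extChartAt_symm hx hf.self_of_nhds).fderiv_right (by simp)
  have h2 : ContMDiffAt 𝓘(ℝ, ℂ) 𝓘(ℝ, ℂ →L[ℝ] W) ∞
      (fun z => fderiv ℝ (fun y => f (φ.symm y)) (φ z)) x :=
    h1.contMDiffAt.comp x (contMDiffAt_extChartAt' (by simp))
  refine h2.congr_of_eventuallyEq ?_
  filter_upwards [hf, extChartAt_source_mem_nhds (I := 𝓘(ℝ, ℂ)) x] with z hz hzs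
  have hzc : z ∈ (chartAt ℂ x).source := by simpa using hzs
  have hzb : z ∈ e.baseSet := by rwa [TangentBundle.trivializationAt_baseSet]
  ext1 u
  have h3 := mvfderiv_eq_fderiv hzs ((contDiffAt_comp_extChartAt_symm hzs hz).differentiableAt
    (by simp)) (e.symmL ℝ z u)
  refine h3.trans ?_
  have h4 := congrArg (fun T : TangentSpace 𝓘(ℝ, ℂ) z →L[ℝ] ℂ => T (e.symmL ℝ z u))
    (TangentBundle.continuousLinearMapAt_trivializationAt (I := 𝓘(ℝ, ℂ)) hzc)
  have h5 : chartDiff x z (e.symmL ℝ z u) = u :=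
    h4.symm.trans (e.continuousLinearMapAt_symmL hzb u)
  rw [h5]

end FieldsInCharts


/-! ### Rules for the differential of vector-valued functions. -/

section Derivatives

variable {X : Type*} [TopologicalSpace X] [ChartedSpace ℂ X] {F : Type*} [NormedAddCommGroup F]

theorem mvfderiv_inner_apply [InnerProductSpace ℂ F] {f g : X → F} {x : X}
    (hf : MDifferentiableAt 𝓘(ℝ, ℂ) 𝓘(ℝ, F) f x) (hg : MDifferentiableAt 𝓘(ℝ, ℂ) 𝓘(ℝ, F) g x)
    (v : TangentSpace 𝓘(ℝ, ℂ) x) :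
    mvfderiv 𝓘(ℝ, ℂ) (fun z => inner ℂ (f z) (g z)) x v
      = inner ℂ (mvfderiv 𝓘(ℝ, ℂ) f x v) (g x) + inner ℂ (f x) (mvfderiv 𝓘(ℝ, ℂ) g x v) := by
  have h1 : HasFDerivAt (𝕜 := ℝ) (fun p : F × F => inner ℂ p.1 p.2)
      ((fderivInnerCLM ℂ (f x, g x)).comp
        ((ContinuousLinearMap.fst ℝ F F).prod (ContinuousLinearMap.snd ℝ F F))) (f x, g x) :=
    (hasFDerivAt_fst (p := (f x, g x))).inner ℂ (hasFDerivAt_snd (p := (f x, g x)))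
  have hL := (hf.prodMk_space hg).hasMFDerivAt
  have hf' := mvfderiv_of_hasMFDerivAt
    (((ContinuousLinearMap.fst ℝ F F).hasMFDerivAt (x := (f x, g x))).comp x hL) v
  have hg' := mvfderiv_of_hasMFDerivAt
    (((ContinuousLinearMap.snd ℝ F F).hasMFDerivAt (x := (f x, g x))).comp x hL) v
  refine (mvfderiv_of_hasMFDerivAt (h1.hasMFDerivAt.comp x hL) v).trans ?_
  refine (fderivInnerCLM_apply ℂ (f x, g x) _).trans ((add_comm _ _).trans ?_)
  exact (congrArg₂ (fun a b => inner ℂ a (g x) + inner ℂ (f x) b) hf' hg').symm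

theorem mvfderiv_const_smul_apply [NormedSpace ℂ F] {f : X → F} {x : X}
    (hf : MDifferentiableAt 𝓘(ℝ, ℂ) 𝓘(ℝ, F) f x) (c : ℂ) (v : TangentSpace 𝓘(ℝ, ℂ) x) :
    mvfderiv 𝓘(ℝ, ℂ) (fun z => c • f z) x v = c • mvfderiv 𝓘(ℝ, ℂ) f x v := by
  have h2 := ((c • ContinuousLinearMap.id ℂ F).restrictScalars ℝ).hasMFDerivAt
    (x := f x) |>.comp x hf.hasMFDerivAt
  exact mvfderiv_of_hasMFDerivAt h2 v

theorem mvfderiv_congr [NormedSpace ℝ F] {f g : X → F} {x : X} (h : ∀ᶠ z in 𝓝 x, f z = g z)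
    (v : TangentSpace 𝓘(ℝ, ℂ) x) : mvfderiv 𝓘(ℝ, ℂ) f x v = mvfderiv 𝓘(ℝ, ℂ) g x v :=
  congrArg (fun T : TangentSpace 𝓘(ℝ, ℂ) x →L[ℝ] F => T v)
    (Filter.EventuallyEq.mfderiv_eq (I := 𝓘(ℝ, ℂ)) (I' := 𝓘(ℝ, F)) h)

end Derivatives

/-! ### The flat unitary bundle of a locally constant unitary cocycle. -/

section Cocycles

/-- A locally constant unitary cocycle on an open cover indexed by the points of `X`. -/
structure UnitaryCocycle (X : Type*) [TopologicalSpace X] (n : ℕ) where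
  dom : X → Set X
  isOpen_dom : ∀ a, IsOpen (dom a)
  mem_dom : ∀ a, a ∈ dom a
  c : X → X → X → ModelFiber n ≃ₗᵢ[ℂ] ModelFiber n
  c_self : ∀ a, ∀ x ∈ dom a, ∀ w, c a a x w = w
  c_comp : ∀ a b d x, x ∈ dom a → x ∈ dom b → x ∈ dom d → ∀ w, c b d x (c a b x w) = c a d x w
  c_loc : ∀ a b x, x ∈ dom a → x ∈ dom b → ∀ᶠ z in 𝓝 x, c a b z = c a b x

namespace UnitaryCocycle

section Topological

variable {X : Type*} [TopologicalSpace X] {n : ℕ} (D : UnitaryCocycle X n)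

/-- The vector bundle core of a cocycle. -/
noncomputable def core : VectorBundleCore ℝ X (ModelFiber n) X where
  baseSet := D.dom
  isOpen_baseSet := D.isOpen_dom
  indexAt := id
  mem_baseSet_at := D.mem_dom
  coordChange a b x := (D.c a b x : ModelFiber n →L[ℂ] ModelFiber n).restrictScalars ℝ
  coordChange_self := D.c_self
  continuousOn_coordChange a b := fun x hx => by
    refine ContinuousAt.continuousWithinAt ?_
    refine continuousAt_const.congr (f := fun _ =>
      (D.c a b x : ModelFiber n →L[ℂ] ModelFiber n).restrictScalars ℝ) ?_
    filter_upwards [D.c_loc a b x hx.1 hx.2] with z hz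
    rw [hz]
  coordChange_comp a b d x hx := D.c_comp a b d x hx.1.1 hx.1.2 hx.2

noncomputable instance (x : X) : NormedAddCommGroup (D.core.Fiber x) :=
  inferInstanceAs (NormedAddCommGroup (ModelFiber n))

noncomputable instance (x : X) : InnerProductSpace ℂ (D.core.Fiber x) :=
  inferInstanceAs (InnerProductSpace ℂ (ModelFiber n))

theorem isLinear_localTriv (a : X) : (D.core.localTriv a).IsLinear ℂ where
  linear x _ :=
    { map_add := fun v w => (D.c x a x).map_add v w
      map_smul := fun r v => (D.c x a x).map_smul r v }

/-- The core is real because smoothness is taken over the real manifold. Its coordinate changes are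
ℂ-linear and locally constant, so the same trivializations give a complex bundle. -/
theorem vectorBundle_complex : VectorBundle ℂ (ModelFiber n) D.core.Fiber where
  trivialization_linear' := by
    rintro _ ⟨i, rfl⟩
    exact D.isLinear_localTriv i
  continuousOn_coordChange' := by
    rintro _ _ ⟨i, rfl⟩ ⟨j, rfl⟩
    have := D.isLinear_localTriv
    intro x hx
    refine ContinuousAt.continuousWithinAt ?_
    have hx' : x ∈ D.dom i ∩ D.dom j := hx
    refine continuousAt_const.congr (f := fun _ =>
      (D.c i j x : ModelFiber n →L[ℂ] ModelFiber n)) ?_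
    filter_upwards [D.c_loc i j x hx'.1 hx'.2,
      ((D.isOpen_dom i).inter (D.isOpen_dom j)).mem_nhds hx'] with z hz hzm
    ext1 w
    rw [← hz]
    have h1 := D.core.localTriv_coordChange_eq i j hzm w
    have h2 := (D.core.localTriv i).coordChangeL_apply (R := ℝ) (D.core.localTriv j) hzm w
    have h3 := (D.core.localTriv i).coordChangeL_apply (R := ℂ) (D.core.localTriv j) hzm w
    exact (h3.trans (h2.symm.trans h1)).symm

end Topological

variable {X : Type*} [TopologicalSpace X] [ChartedSpace ℂ X] {n : ℕ} (D : UnitaryCocycle X n)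

instance : D.core.IsContMDiff 𝓘(ℝ, ℂ) ∞ where
  contMDiffOn_coordChange a b := fun x hx => by
    refine ContMDiffAt.contMDiffWithinAt ?_
    refine (contMDiffAt_const (c :=
      (D.c a b x : ModelFiber n →L[ℂ] ModelFiber n).restrictScalars ℝ)).congr_of_eventuallyEq ?_
    filter_upwards [D.c_loc a b x hx.1 hx.2] with z hz
    change (D.c a b z : ModelFiber n →L[ℂ] ModelFiber n).restrictScalars ℝ = _
    rw [hz]

theorem contMDiffAt_coord {a x : X} (hx : x ∈ D.dom a) {s : ∀ x, D.core.Fiber x}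
    (hs : ContMDiffAt 𝓘(ℝ, ℂ) (𝓘(ℝ, ℂ).prod 𝓘(ℝ, ModelFiber n)) ∞
      (fun z => TotalSpace.mk' (ModelFiber n) z (s z)) x) :
    ContMDiffAt 𝓘(ℝ, ℂ) 𝓘(ℝ, ModelFiber n) ∞ (fun z => D.c z a z (s z)) x := by
  have : MemTrivializationAtlas (D.core.localTriv a) := ⟨a, rfl⟩
  exact (((D.core.localTriv a).contMDiffAt_iff (IB := 𝓘(ℝ, ℂ)) (n := ∞)
    (by rw [Trivialization.mem_source]; exact hx)).1 hs).2

/-- The hermitian bundle of a cocycle. -/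
noncomputable def hermBundle : HermBundle X n where
  E := D.core.Fiber
  instFiber := D.core.fiberBundle
  instComplex := D.vectorBundle_complex
  instReal := D.core.vectorBundle
  instSmooth := VectorBundleCore.instContMDiffVectorBundle D.core
  metric_smooth s t hs ht := by
    intro x
    have h1 := D.contMDiffAt_coord (D.mem_dom x) (hs x)
    have h2 := D.contMDiffAt_coord (D.mem_dom x) (ht x)
    have h3 : ContDiff ℝ ∞ fun p : ModelFiber n × ModelFiber n => inner ℂ p.1 p.2 :=
      contDiff_inner
    refine (h3.contMDiff.contMDiffAt.comp x (h1.prodMk_space h2)).congr_of_eventuallyEq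
      (Filter.Eventually.of_forall fun z => ?_)
    exact ((D.c z x z).inner_map_map (s z) (t z)).symm

/-- The unitary frame over `D.dom a`. -/
noncomputable def frame (a x : X) : ModelFiber n ≃ₗᵢ[ℂ] D.hermBundle.E x := D.c a x x

/-- The coordinates of a vector in the frame over `D.dom a`. -/
noncomputable def coord (a x : X) : D.hermBundle.E x ≃ₗᵢ[ℂ] ModelFiber n := D.c x a x

theorem frame_symm {a x : X} (hx : x ∈ D.dom a) (v : D.hermBundle.E x) :
    (D.frame a x).symm v = D.coord a x v := by
  rw [LinearIsometryEquiv.symm_apply_eq]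
  exact ((D.c_comp x a x x (D.mem_dom x) hx (D.mem_dom x) v).trans
    (D.c_self x x (D.mem_dom x) v)).symm

theorem coord_eq {a b x : X} (ha : x ∈ D.dom a) (hb : x ∈ D.dom b) (v : D.hermBundle.E x) :
    (D.frame b x).symm v = D.c a b x ((D.frame a x).symm v) := by
  rw [D.frame_symm ha, D.frame_symm hb]
  exact (D.c_comp x a b x (D.mem_dom x) ha hb v).symm

theorem isFrameOn_frame (a : X) :
    D.hermBundle.IsFrameOn (fun x => (D.frame a x).toLinearEquiv) (D.dom a) := by
  have : MemTrivializationAtlas (D.core.localTriv a) := ⟨a, rfl⟩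
  refine ⟨fun x hx w => ?_, fun p hp => ?_⟩
  · refine ((D.core.localTriv a).contMDiffAt_iff (IB := 𝓘(ℝ, ℂ)) (n := ∞)
      (by refine (Trivialization.mem_source _).2 ?_; exact hx)).2 ⟨contMDiffAt_fst, ?_⟩
    refine contMDiffAt_snd.congr_of_eventuallyEq ?_
    filter_upwards [continuous_fst.continuousAt.eventually ((D.isOpen_dom a).mem_nhds hx)]
      with q hq
    have h := D.frame_symm hq (D.frame a q.1 q.2)
    rw [LinearIsometryEquiv.symm_apply_apply] at h
    exact h.symm
  · have h := ((D.core.localTriv a).contMDiffAt_iff (IB := 𝓘(ℝ, ℂ)) (n := ∞)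
      (by refine (Trivialization.mem_source _).2 ?_; exact hp)).1 (contMDiffAt_id (x := p))
    refine h.2.congr_of_eventuallyEq ?_
    filter_upwards [(FiberBundle.continuous_proj (ModelFiber n)
      D.hermBundle.E).continuousAt.eventually ((D.isOpen_dom a).mem_nhds hp)] with q hq
    exact D.frame_symm hq q.snd

theorem diffAt_iff {a x : X} (hx : x ∈ D.dom a) {s : ∀ x, D.hermBundle.E x} :
    D.hermBundle.DiffAt s x ↔
      MDifferentiableAt 𝓘(ℝ, ℂ) 𝓘(ℝ, ModelFiber n) (fun z => (D.frame a z).symm (s z)) x :=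
  (D.isFrameOn_frame a).diffAt_iff hx

theorem eventually_contMDiffAt {s : ∀ x, D.hermBundle.E x} (hs : D.hermBundle.Smooth s) (x : X) :
    ∀ᶠ z in 𝓝 x, ContMDiffAt 𝓘(ℝ, ℂ) 𝓘(ℝ, ModelFiber n) ∞
      (fun z => (D.frame x z).symm (s z)) z := by
  filter_upwards [(D.isOpen_dom x).mem_nhds (D.mem_dom x)] with z hz
  exact (D.isFrameOn_frame x).contMDiffAt_coord hz hs.contMDiffAt

/-- The derivative of the coordinates of a section in the locally constant frames. -/
noncomputable def connAux (s : ∀ x, D.hermBundle.E x) (x : X) :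
    TangentSpace 𝓘(ℝ, ℂ) x →L[ℝ] D.hermBundle.E x :=
  ((D.frame x x : ModelFiber n →L[ℂ] D.hermBundle.E x).restrictScalars ℝ) ∘L
    mvfderiv 𝓘(ℝ, ℂ) (fun z => (D.frame x z).symm (s z)) x

/-- The definition differentiates in the frame indexed by the point x itself, which jumps with x.
Locally constant transitions contribute no derivative, so any fixed frame may replace it near x. -/
theorem connAux_eq {a x : X} (hx : x ∈ D.dom a) {s : ∀ x, D.hermBundle.E x}
    (hs : D.hermBundle.DiffAt s x) (v : TangentSpace 𝓘(ℝ, ℂ) x) :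
    D.connAux s x v = D.frame a x (mvfderiv 𝓘(ℝ, ℂ) (fun z => (D.frame a z).symm (s z)) x v) := by
  have h1 : MDifferentiableAt 𝓘(ℝ, ℂ) 𝓘(ℝ, ModelFiber n) (fun z => (D.frame a z).symm (s z)) x :=
    (D.diffAt_iff hx).1 hs
  have h2 := ((D.c a x x : ModelFiber n →L[ℂ] ModelFiber n).restrictScalars ℝ).hasMFDerivAt
    (x := (D.frame a x).symm (s x)) |>.comp x h1.hasMFDerivAt
  have h3 : mvfderiv 𝓘(ℝ, ℂ) (fun z => (D.frame x z).symm (s z)) x v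
      = D.c a x x (mvfderiv 𝓘(ℝ, ℂ) (fun z => (D.frame a z).symm (s z)) x v) := by
    refine mvfderiv_of_hasMFDerivAt (h2.congr_of_eventuallyEq ?_) v
    filter_upwards [(D.isOpen_dom x).mem_nhds (D.mem_dom x), (D.isOpen_dom a).mem_nhds hx,
      D.c_loc a x x hx (D.mem_dom x)] with z hz hz' hc
    rw [D.coord_eq hz' hz, hc]
    rfl
  refine (congrArg (D.frame x x) h3).trans ?_
  exact D.c_self x x (D.mem_dom x) _

variable [IsManifold 𝓘(ℂ, ℂ) ω X]

/-- The connection of a cocycle. -/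
noncomputable def connection :
    CovariantDerivative 𝓘(ℝ, ℂ) (ModelFiber n) D.hermBundle.E where
  toFun := D.connAux
  isCovariantDerivativeOnUniv :=
    { add := fun {s t x} hs ht _ => by
        have hs' := (D.diffAt_iff (D.mem_dom x)).1 hs
        have ht' := (D.diffAt_iff (D.mem_dom x)).1 ht
        ext1 v
        have h1 : (fun z => (D.frame x z).symm ((s + t) z))
            = (fun z => (D.frame x z).symm (s z)) + fun z => (D.frame x z).symm (t z) :=
          funext fun z => map_add _ _ _
        have h2 := DFunLike.congr_fun (mvfderiv_add hs' ht') v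
        rw [← h1] at h2
        exact (congrArg (D.frame x x) h2).trans (map_add (D.frame x x) _ _)
      leibniz := fun {s g x} hs hg _ => by
        have hs' := (D.diffAt_iff (D.mem_dom x)).1 hs
        ext1 v
        have h1 : (fun z => (D.frame x z).symm ((g • s) z))
            = g • fun z => (D.frame x z).symm (s z) :=
          funext fun z => by
            have := ((D.frame x z).symm : D.hermBundle.E z →L[ℂ] ModelFiber n).map_smul_of_tower
              (g z) (s z)
            exact this
        have h2 := DFunLike.congr_fun (mvfderiv_smul hg hs') v
        rw [← h1] at h2
        refine (congrArg (D.frame x x) h2).trans ((map_add (D.frame x x) _ _).trans ?_)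
        have h3 : ∀ (r : ℝ) (w : ModelFiber n), D.frame x x (r • w) = r • D.frame x x w :=
          fun r w => ((D.frame x x : ModelFiber n →L[ℂ] D.hermBundle.E x)).map_smul_of_tower r w
        refine congrArg₂ (· + ·) (h3 _ _) ((h3 _ _).trans ?_)
        rw [LinearIsometryEquiv.apply_symm_apply]
        rfl }

/-- The flat unitary bundle of a cocycle. -/
noncomputable def flatBundle : FlatUnitaryBundle X n where
  toHermBundle := D.hermBundle
  conn := D.connection
  conn_smooth := by
    refine ⟨⟨fun {s} hs => ?_⟩⟩
    have hs' : D.hermBundle.Smooth s := contMDiffOn_univ.1 hs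
    rw [contMDiffOn_univ]
    intro x
    -- Read in the trivializations at x, the section ∇s becomes the ordinary differential of the
    -- coordinates of s in one fixed frame.
    refine (contMDiffAt_hom_bundle _).2 ⟨contMDiffAt_id, ?_⟩
    refine (contMDiffAt_mvfderiv_comp_symmL (D.eventually_contMDiffAt hs' x)).congr_of_eventuallyEq ?_
    filter_upwards [(D.isOpen_dom x).mem_nhds (D.mem_dom x)] with z hz
    ext1 u
    have h1 := D.connAux_eq hz (hs'.mdifferentiable (by simp) z)
      ((trivializationAt ℂ (TangentSpace 𝓘(ℝ, ℂ) (M := X)) x).symmL ℝ z u)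
    rw [← LinearIsometryEquiv.symm_apply_eq, D.frame_symm hz] at h1
    refine Eq.trans ?_ h1
    exact congrFun ((D.core.localTriv x).coe_linearMapAt_of_mem (R := ℝ) hz) _
  conn_smul c s x hs v := by
    have h1 := mvfderiv_const_smul_apply ((D.diffAt_iff (D.mem_dom x)).1 hs) c v
    have h2 : (fun z => (D.frame x z).symm (c • s z)) = fun z => c • (D.frame x z).symm (s z) :=
      funext fun z => map_smul _ _ _
    rw [← h2] at h1
    exact (congrArg (D.frame x x) h1).trans (map_smul (D.frame x x) _ _)
  conn_unitary s t x hs ht v := by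
    have hs' := (D.diffAt_iff (D.mem_dom x)).1 hs
    have ht' := (D.diffAt_iff (D.mem_dom x)).1 ht
    have h1 := mvfderiv_inner_apply hs' ht' v
    simp only [LinearIsometryEquiv.inner_map_map] at h1
    refine h1.trans ?_
    rw [← (D.frame x x).inner_map_map, ← (D.frame x x).inner_map_map ((D.frame x x).symm (s x)),
      LinearIsometryEquiv.apply_symm_apply, LinearIsometryEquiv.apply_symm_apply]
    rfl
  conn_flat U W s hU hW hs x := by
    -- In a constant frame ∇ is differentiation of coordinates, so zero curvature is the commutation
    -- rule for directional derivatives.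
    have h1 := mvfderiv_mvfderiv_sub (D.eventually_contMDiffAt hs x) hU hW
    have h2 : ∀ W : ∀ x : X, TangentSpace 𝓘(ℝ, ℂ) x, ∀ᶠ z in 𝓝 x,
        (D.frame x z).symm (D.connAux s z (W z))
          = mvfderiv 𝓘(ℝ, ℂ) (fun z => (D.frame x z).symm (s z)) z (W z) := fun W => by
      filter_upwards [(D.isOpen_dom x).mem_nhds (D.mem_dom x)] with z hz
      rw [D.connAux_eq hz (hs.mdifferentiable (by simp) z), LinearIsometryEquiv.symm_apply_apply]
    rw [← mvfderiv_congr (h2 W), ← mvfderiv_congr (h2 U)] at h1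
    have h3 := congrArg (D.frame x x) h1
    rw [map_sub, map_sub, map_zero] at h3
    exact h3

theorem isFlatFrameOn_frame (a : X) : D.flatBundle.IsFlatFrameOn (D.frame a) (D.dom a) where
  isOpen := D.isOpen_dom a
  isFrameOn := D.isFrameOn_frame a
  conn_eq_zero x hx w := by
    have h1 : D.hermBundle.DiffAt (fun z => D.frame a z w) x :=
      (D.isFrameOn_frame a).diffAt_apply hx mdifferentiableAt_const
    ext1 v
    refine (D.connAux_eq hx h1 v).trans ?_
    simp only [LinearIsometryEquiv.symm_apply_apply]
    have h2 : mvfderiv 𝓘(ℝ, ℂ) (fun _ : X => w) x v = 0 :=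
      DFunLike.congr_fun (mvfderiv_const w) v
    exact (congrArg (D.frame a x) h2).trans (map_zero _)

end UnitaryCocycle

end Cocycles


/-! ### Maps that are constant in flat frames are smooth and respect the connections. -/

section LocalCriteria

variable {X : Type*} [TopologicalSpace X] [ChartedSpace ℂ X] {n : ℕ}

/-- Antilinear maps enter real calculus as continuous real-linear maps. -/
theorem exists_realClm_eq (L : ModelFiber n →ₛₗ[starRingEnd ℂ] ModelFiber n) :
    ∃ L' : ModelFiber n →L[ℝ] ModelFiber n, ∀ w, L' w = L w :=
  ⟨LinearMap.toContinuousLinearMap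
    { toFun := L
      map_add' := L.map_add
      map_smul' := fun r w => by
        rw [← Complex.coe_smul, L.map_smulₛₗ, Complex.conj_ofReal, Complex.coe_smul]
        rfl }, fun _ => rfl⟩

/-- Local path connectedness turns identities along paths inside a frame domain into identities on a
neighbourhood. -/
theorem eventually_exists_path {x : X} {U : Set X} (hU : IsOpen U) (hx : x ∈ U) :
    ∀ᶠ z in 𝓝 x, ∃ δ : Path x z, ∀ t, δ t ∈ U := by
  have := ChartedSpace.locallyPathConnectedSpace ℂ X
  filter_upwards [(hU.pathComponentIn x).mem_nhds (mem_pathComponentIn_self hx)] with z hz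
  exact ⟨JoinedIn.somePath hz, JoinedIn.somePath_mem hz⟩

variable [IsManifold 𝓘(ℂ, ℂ) ω X]

/-- A flat triple from a lift of `σ` which is constant in flat frames. -/
def FlatUnitaryBundle.toTriple (V : FlatUnitaryBundle X n) (σ : AntiholInvolution X)
    (k : StructureKind) (lift : ∀ x, V.E x →ₛₗ[starRingEnd ℂ] V.E (σ x))
    (lift_lift : ∀ (x : X) (v : V.E x),
      V.pt (σ (σ x)) (lift (σ x) (lift x v)) = V.pt x (k.sign • v))
    (hloc : ∀ x, ∃ (G G' : ∀ x, ModelFiber n ≃ₗᵢ[ℂ] V.E x) (U U' : Set X)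
      (L : ModelFiber n →ₛₗ[starRingEnd ℂ] ModelFiber n), x ∈ U ∧ σ x ∈ U' ∧
      V.IsFlatFrameOn G U ∧ V.IsFlatFrameOn G' U' ∧
      ∀ᶠ z in 𝓝 x, ∀ w, lift z (G z w) = G' (σ z) (L w)) :
    FlatTriple σ k n where
  toFlatUnitaryBundle := V
  lift := lift
  lift_lift := lift_lift
  lift_smooth := by
    intro p
    obtain ⟨G, G', U, U', L, hx, hx', hG, hG', hL⟩ := hloc p.proj
    obtain ⟨L', hL'⟩ := exists_realClm_eq L
    have hproj := FiberBundle.continuous_proj (ModelFiber n) V.E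
    have h1 : ContMDiffAt (HermBundle.totalModel n) 𝓘(ℝ, ModelFiber n) ∞
        (fun q : V.Total => L' ((G q.proj).symm q.snd)) p :=
      L'.contMDiff.contMDiffAt.comp p (hG.isFrameOn.contMDiffAt_symm p hx)
    have h2 : ContMDiffAt (HermBundle.totalModel n) 𝓘(ℝ, ℂ) ∞ (fun q : V.Total => σ q.proj) p :=
      σ.contMDiff.contMDiffAt.comp p (contMDiff_proj V.E).contMDiffAt
    refine ((hG'.isFrameOn.contMDiffAt (σ p.proj) hx' _).comp p
      (f := fun q : V.Total => (σ q.proj, L' ((G q.proj).symm q.snd)))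
      (h2.prodMk h1)).congr_of_eventuallyEq ?_
    filter_upwards [hproj.continuousAt.eventually hL] with q hq
    have h3 := hq ((G q.proj).symm q.snd)
    rw [LinearIsometryEquiv.apply_symm_apply] at h3
    simp only [Function.comp_apply, hL', h3]
    rfl
  conn_equivariant := by
    intro s t hst x hs v
    obtain ⟨G, G', U, U', L, hx, hx', hG, hG', hL⟩ := hloc x
    obtain ⟨L', hL'⟩ := exists_realClm_eq L
    have hσ : MDifferentiable 𝓘(ℝ, ℂ) 𝓘(ℝ, ℂ) σ := σ.contMDiff.mdifferentiable (by simp)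
    have hs' := (hG.diffAt_iff hx).1 hs
    -- In flat frames σ̃ is a constant real-linear map, so equivariance reduces to the chain rule
    -- for t ∘ σ in coordinates.
    have hcoord : ∀ᶠ z in 𝓝 x, (G' (σ z)).symm (t (σ z)) = L' ((G z).symm (s z)) := by
      filter_upwards [hL] with z hz
      have h3 := hz ((G z).symm (s z))
      rw [LinearIsometryEquiv.apply_symm_apply] at h3
      rw [hst, h3, LinearIsometryEquiv.symm_apply_apply, hL']
    have hσt : Tendsto σ (𝓝 (σ x)) (𝓝 x) := by
      have := σ.continuous_toFun.tendsto (σ x)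
      rwa [σ.involutive] at this
    have hcoord' : ∀ᶠ y in 𝓝 (σ x), (G' y).symm (t y) = L' ((G (σ y)).symm (s (σ y))) := by
      filter_upwards [hσt.eventually hcoord] with y hy
      rwa [σ.involutive] at hy
    have hd : MDifferentiableAt 𝓘(ℝ, ℂ) 𝓘(ℝ, ModelFiber n)
        (fun y => L' ((G (σ y)).symm (s (σ y)))) (σ x) := by
      refine L'.mdifferentiableAt.comp (σ x) ?_
      refine MDifferentiableAt.comp (σ x) (g := fun z => (G z).symm (s z)) ?_ (hσ _)
      rwa [σ.involutive]
    have ht' : MDifferentiableAt 𝓘(ℝ, ℂ) 𝓘(ℝ, ModelFiber n) (fun y => (G' y).symm (t y)) (σ x) :=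
      hd.congr_of_eventuallyEq hcoord'
    have ht : V.DiffAt t (σ x) := (hG'.diffAt_iff hx').2 ht'
    rw [hG'.conn_eq hx' ht, hG.conn_eq hx hs]
    have h4 : mvfderiv 𝓘(ℝ, ℂ) (fun z => (G' (σ z)).symm (t (σ z))) x v
        = L' (mvfderiv 𝓘(ℝ, ℂ) (fun z => (G z).symm (s z)) x v) := by
      rw [mvfderiv_congr hcoord]
      exact mvfderiv_of_hasMFDerivAt
        ((L'.hasMFDerivAt (x := (G x).symm (s x))).comp x hs'.hasMFDerivAt) v
    have h5 : mvfderiv 𝓘(ℝ, ℂ) (fun z => (G' (σ z)).symm (t (σ z))) x v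
        = mvfderiv 𝓘(ℝ, ℂ) (fun y => (G' y).symm (t y)) (σ x)
          (mfderiv 𝓘(ℝ, ℂ) 𝓘(ℝ, ℂ) σ x v) :=
      mvfderiv_of_hasMFDerivAt (ht'.hasMFDerivAt.comp x (hσ x).hasMFDerivAt) v
    rw [← h5, h4, hL', hL.self_of_nhds]

namespace FlatTriple

variable {σ : AntiholInvolution X} {k : StructureKind} {V V' : FlatTriple σ k n}

/-- `Φ` is constant in flat frames. -/
def FlatHom (V V' : FlatUnitaryBundle X n) (Φ : ∀ x, V.E x ≃ₗ[ℂ] V'.E x) : Prop :=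
  ∀ x, ∃ (G : ∀ x, ModelFiber n ≃ₗᵢ[ℂ] V.E x) (G' : ∀ x, ModelFiber n ≃ₗᵢ[ℂ] V'.E x)
    (U U' : Set X) (L : ModelFiber n ≃L[ℂ] ModelFiber n), x ∈ U ∧ x ∈ U' ∧
    V.IsFlatFrameOn G U ∧ V'.IsFlatFrameOn G' U' ∧ ∀ᶠ z in 𝓝 x, ∀ w, Φ z (G z w) = G' z (L w)

theorem FlatHom.symm {V V' : FlatUnitaryBundle X n} {Φ : ∀ x, V.E x ≃ₗ[ℂ] V'.E x}
    (h : FlatHom V V' Φ) : FlatHom V' V fun x => (Φ x).symm := by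
  intro x
  obtain ⟨G, G', U, U', L, hx, hx', hG, hG', hL⟩ := h x
  refine ⟨G', G, U', U, L.symm, hx', hx, hG', hG, ?_⟩
  filter_upwards [hL] with z hz w
  rw [LinearEquiv.symm_apply_eq, hz, ContinuousLinearEquiv.apply_symm_apply]

theorem FlatHom.smooth {V V' : FlatUnitaryBundle X n} {Φ : ∀ x, V.E x ≃ₗ[ℂ] V'.E x}
    (h : FlatHom V V' Φ) : ContMDiff (HermBundle.totalModel n) (HermBundle.totalModel n) ∞
      (fun p : V.Total => V'.pt p.proj (Φ p.proj p.snd)) := by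
  intro p
  obtain ⟨G, G', U, U', L, hx, hx', hG, hG', hL⟩ := h p.proj
  have hproj := FiberBundle.continuous_proj (ModelFiber n) V.E
  have h1 : ContMDiffAt (HermBundle.totalModel n) 𝓘(ℝ, ModelFiber n) ∞
      (fun q : V.Total => L ((G q.proj).symm q.snd)) p :=
    ((L : ModelFiber n →L[ℂ] ModelFiber n).restrictScalars ℝ).contMDiff.contMDiffAt.comp p
      (hG.isFrameOn.contMDiffAt_symm p hx)
  refine ((hG'.isFrameOn.contMDiffAt p.proj hx' _).comp p
    (f := fun q : V.Total => (q.proj, L ((G q.proj).symm q.snd)))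
    ((contMDiff_proj V.E).contMDiffAt.prodMk h1)).congr_of_eventuallyEq ?_
  filter_upwards [hproj.continuousAt.eventually hL] with q hq
  have h3 := hq ((G q.proj).symm q.snd)
  rw [LinearIsometryEquiv.apply_symm_apply] at h3
  simp only [Function.comp_apply, h3]
  rfl

/-- In flat frames both connections are differentiation and Φ is a constant linear map; the two
commute. -/
theorem FlatHom.conn {V V' : FlatUnitaryBundle X n} {Φ : ∀ x, V.E x ≃ₗ[ℂ] V'.E x}
    (h : FlatHom V V' Φ) {s : ∀ x, V.E x} {x : X} (hs : V.DiffAt s x)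
    (v : TangentSpace 𝓘(ℝ, ℂ) x) :
    V'.conn (fun z => Φ z (s z)) x v = Φ x (V.conn s x v) := by
  obtain ⟨G, G', U, U', L, hx, hx', hG, hG', hL⟩ := h x
  have hs' := (hG.diffAt_iff hx).1 hs
  have ht : V'.DiffAt (fun z => Φ z (s z)) x :=
    ((h.smooth.mdifferentiable (by simp)) _).comp x hs
  rw [hG'.conn_eq hx' ht, hG.conn_eq hx hs, hL.self_of_nhds]
  congr 1
  have hcoord : ∀ᶠ z in 𝓝 x, (G' z).symm (Φ z (s z)) = L ((G z).symm (s z)) := by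
    filter_upwards [hL] with z hz
    have h3 := hz ((G z).symm (s z))
    rw [LinearIsometryEquiv.apply_symm_apply] at h3
    rw [h3, LinearIsometryEquiv.symm_apply_apply]
  rw [mvfderiv_congr hcoord]
  exact mvfderiv_of_hasMFDerivAt
    ((((L : ModelFiber n →L[ℂ] ModelFiber n).restrictScalars ℝ).hasMFDerivAt
      (x := (G x).symm (s x))).comp x hs'.hasMFDerivAt) v

theorem FlatHom.isIso {Φ : ∀ x, V.E x ≃ₗ[ℂ] V'.E x}
    (h : FlatHom V.toFlatUnitaryBundle V'.toFlatUnitaryBundle Φ)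
    (hlift : ∀ (x : X) (v : V.E x), Φ (σ x) (V.lift x v) = V'.lift x (Φ x v)) : IsIso V V' Φ :=
  ⟨h.smooth, h.symm.smooth, fun _ _ hs v => h.conn hs v, hlift⟩

end FlatTriple

end LocalCriteria


/-! ### The extended unitary group as the group of unitary and antiunitary maps. -/

section ExtendedUnitaryAction

variable {n : ℕ}

/-- Complex conjugation of the coordinates. -/
noncomputable def conjCoord (n : ℕ) : ModelFiber n →ₛₗ[starRingEnd ℂ] ModelFiber n where
  toFun z := WithLp.toLp 2 fun i => starRingEnd ℂ (z i)
  map_add' z w := by ext i; simp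
  map_smul' c z := by ext i; simp

theorem conjCoord_conjCoord (z : ModelFiber n) : conjCoord n (conjCoord n z) = z := by
  ext i
  simp [conjCoord]

theorem inner_conjCoord (z w : ModelFiber n) :
    inner ℂ (conjCoord n z) (conjCoord n w) = inner ℂ w z := by
  simp [conjCoord, PiLp.inner_apply, mul_comm]

/-- Unitary matrices as isometries. -/
noncomputable def unitaryIso (n : ℕ) :
    unitaryGroup (Fin n) ℂ ≃* (ModelFiber n ≃ₗᵢ[ℂ] ModelFiber n) :=
  (Unitary.mapEquiv (StarMulEquiv.mk (MulEquivClass.toMulEquiv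
    (Matrix.toEuclideanCLM (n := Fin n) (𝕜 := ℂ))) (map_star _))).toMulEquiv.trans
    Unitary.linearIsometryEquiv

theorem unitaryIso_apply (A : unitaryGroup (Fin n) ℂ) (z : ModelFiber n) :
    unitaryIso n A z = WithLp.toLp 2 ((A : Matrix (Fin n) (Fin n) ℂ) *ᵥ z.ofLp) :=
  rfl

theorem unitaryIso_conjUnitary (A : unitaryGroup (Fin n) ℂ) (z : ModelFiber n) :
    unitaryIso n (conjUnitary n A) (conjCoord n z) = conjCoord n (unitaryIso n A z) := by
  ext i
  simp [unitaryIso_apply, conjUnitary, conjCoord, Matrix.mulVec, dotProduct]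

theorem multiplicative_zmod_two (a : Multiplicative (ZMod 2)) :
    a = 1 ∨ a = Multiplicative.ofAdd 1 := by
  revert a
  decide

theorem ofAdd_one_ne_one : (Multiplicative.ofAdd (1 : ZMod 2)) ≠ 1 := by decide

namespace ExtUnitary

theorem act_of_right_eq_one {u : ExtUnitary n} (h : u.right = 1) (z : ModelFiber n) :
    u.act z = unitaryIso n u.left z := by
  rw [act, if_pos h]
  rfl

theorem act_of_right_ne_one {u : ExtUnitary n} (h : u.right = Multiplicative.ofAdd 1)
    (z : ModelFiber n) : u.act z = unitaryIso n u.left (conjCoord n z) := by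
  rw [act, if_neg (by rw [h]; exact ofAdd_one_ne_one)]
  rfl

theorem act_inl (A : unitaryGroup (Fin n) ℂ) (z : ModelFiber n) :
    act (SemidirectProduct.inl A : ExtUnitary n) z = unitaryIso n A z :=
  act_of_right_eq_one rfl z

theorem galAction_ofAdd_one (A : unitaryGroup (Fin n) ℂ) :
    galAction n (Multiplicative.ofAdd 1) A = conjUnitary n A := by
  change (conjUnitary n ^ (ZMod.val (1 : ZMod 2))) A = _
  rw [ZMod.val_one, pow_one]

/-- The semidirect product law is composition of maps: conjugation τ passes through a matrix by τA =
Āτ, which is `unitaryIso_conjUnitary`. -/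
theorem mul_act (u v : ExtUnitary n) (z : ModelFiber n) : (u * v).act z = u.act (v.act z) := by
  have hl : (u * v).left = u.left * galAction n u.right v.left := rfl
  have hr : (u * v).right = u.right * v.right := rfl
  rcases multiplicative_zmod_two u.right with hu | hu <;>
    rcases multiplicative_zmod_two v.right with hv | hv
  · rw [act_of_right_eq_one (by rw [hr, hu, hv]; rfl), act_of_right_eq_one hu,
      act_of_right_eq_one hv, hl, hu, map_mul, map_one]
    rfl
  · rw [act_of_right_ne_one (by rw [hr, hu, hv]; rfl), act_of_right_eq_one hu,
      act_of_right_ne_one hv, hl, hu, map_mul, map_one]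
    rfl
  · rw [act_of_right_ne_one (by rw [hr, hu, hv]; rfl), act_of_right_ne_one hu,
      act_of_right_eq_one hv, hl, hu, galAction_ofAdd_one, map_mul, ← unitaryIso_conjUnitary]
    rfl
  · rw [act_of_right_eq_one (by rw [hr, hu, hv]; decide), act_of_right_ne_one hu,
      act_of_right_ne_one hv, hl, hu, galAction_ofAdd_one, map_mul, ← unitaryIso_conjUnitary,
      conjCoord_conjCoord]
    rfl

/-- Equality of degrees has to be assumed: for n = 0 the action does not see it. -/
theorem ext_act {u v : ExtUnitary n} (h : u.right = v.right) (h' : ∀ z, u.act z = v.act z) :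
    u = v := by
  refine SemidirectProduct.ext ?_ h
  apply (unitaryIso n).injective
  ext1 z
  rcases multiplicative_zmod_two u.right with hu | hu
  · rw [← act_of_right_eq_one hu, ← act_of_right_eq_one (h ▸ hu), h']
  · have := h' (conjCoord n z)
    rwa [act_of_right_ne_one hu, act_of_right_ne_one (h ▸ hu), conjCoord_conjCoord] at this

/-- The isometry of an element over `0`. -/
noncomputable def toIso (u : ExtUnitary n) : ModelFiber n ≃ₗᵢ[ℂ] ModelFiber n :=
  unitaryIso n u.left

/-- The antiunitary map of an element over `1`. -/
noncomputable def toAnti (u : ExtUnitary n) : ModelFiber n →ₛₗ[starRingEnd ℂ] ModelFiber n :=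
  (unitaryIso n u.left).toLinearEquiv.toLinearMap.comp (conjCoord n)

theorem toIso_apply {u : ExtUnitary n} (h : u.right = 1) (z : ModelFiber n) :
    u.toIso z = u.act z :=
  (act_of_right_eq_one h z).symm

theorem toAnti_apply {u : ExtUnitary n} (h : u.right = Multiplicative.ofAdd 1)
    (z : ModelFiber n) : u.toAnti z = u.act z :=
  (act_of_right_ne_one h z).symm

theorem inner_toAnti (u : ExtUnitary n) (z w : ModelFiber n) :
    inner ℂ (u.toAnti z) (u.toAnti w) = inner ℂ w z :=
  ((unitaryIso n u.left).inner_map_map _ _).trans (inner_conjCoord z w)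

theorem exists_act_eq_iso (L : ModelFiber n ≃ₗᵢ[ℂ] ModelFiber n) :
    ∃ u : ExtUnitary n, u.right = 1 ∧ ∀ z, u.act z = L z :=
  ⟨SemidirectProduct.inl ((unitaryIso n).symm L), rfl, fun z => by
    rw [act_inl, MulEquiv.apply_symm_apply]⟩

theorem exists_act_eq_anti (L : ModelFiber n →ₛₗ[starRingEnd ℂ] ModelFiber n)
    (hL : ∀ z w, inner ℂ (L z) (L w) = inner ℂ w z) :
    ∃ u : ExtUnitary n, u.right = Multiplicative.ofAdd 1 ∧ ∀ z, u.act z = L z := by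
  -- Precomposing with conjugation turns the antiunitary map into a linear isometry, bijective by
  -- equality of dimensions, which supplies the matrix.
  let M : ModelFiber n →ₗ[ℂ] ModelFiber n :=
    { toFun := fun z => L (conjCoord n z)
      map_add' := fun z w => by rw [map_add, map_add]
      map_smul' := fun c z => by
        rw [LinearMap.map_smulₛₗ, LinearMap.map_smulₛₗ, Complex.conj_conj]
        rfl }
  let N : ModelFiber n →ₗᵢ[ℂ] ModelFiber n := M.isometryOfInner fun z w =>
    (hL _ _).trans (inner_conjCoord w z)
  refine ⟨⟨(unitaryIso n).symm (N.toLinearIsometryEquiv rfl), Multiplicative.ofAdd 1⟩, rfl,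
    fun z => ?_⟩
  rw [act_of_right_ne_one rfl, MulEquiv.apply_symm_apply]
  change L (conjCoord n (conjCoord n z)) = _
  rw [conjCoord_conjCoord]

end ExtUnitary

end ExtendedUnitaryAction

/-! ### Polar decomposition and its equivariance. -/

section Polar

variable {n : ℕ}

/-- The inner product is an explicit argument on a bare module, so that it can differ from the
hermitian metric already present on the fiber. -/
theorem exists_frame_of_core {E : Type*} [AddCommGroup E] [Module ℂ E] [FiniteDimensional ℂ E]
    (hE : Module.finrank ℂ E = n) (c : InnerProductSpace.Core ℂ E) :
    ∃ φ : ModelFiber n ≃ₗ[ℂ] E, ∀ z w, c.inner (φ z) (φ w) = inner ℂ z w := by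
  let _ : NormedAddCommGroup E := c.toNormedAddCommGroup
  let _ : InnerProductSpace ℂ E := InnerProductSpace.ofCore c.toCore
  let ψ : ModelFiber n ≃ₗᵢ[ℂ] E := ((stdOrthonormalBasis ℂ E).reindex (finCongr hE)).repr.symm
  exact ⟨ψ.toLinearEquiv, fun z w => ψ.inner_map_map z w⟩

/-- Uniqueness is the clause that matters: it forces the square root to commute with symmetries of
P. -/
theorem ContinuousLinearMap.IsPositive.exists_sqrt {H : Type*} [NormedAddCommGroup H]
    [InnerProductSpace ℂ H] [CompleteSpace H] {P : H →L[ℂ] H} (hP : P.IsPositive) :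
    ∃ S : H →L[ℂ] H, S.IsPositive ∧ S * S = P ∧
      ∀ T : H →L[ℂ] H, T.IsPositive → T * T = P → T = S := by
  have hP' := (ContinuousLinearMap.nonneg_iff_isPositive P).2 hP
  refine ⟨CFC.sqrt P, (ContinuousLinearMap.nonneg_iff_isPositive _).1 (CFC.sqrt_nonneg P),
    CFC.sqrt_mul_sqrt_self P hP', fun T hT hTT => ?_⟩
  exact (CFC.sqrt_unique hTT ((ContinuousLinearMap.nonneg_iff_isPositive _).2 hT)).symm

/-- The positive square root of `B* B`. -/
theorem exists_sqrt (B : ModelFiber n ≃ₗ[ℂ] ModelFiber n) :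
    ∃ S : ModelFiber n →L[ℂ] ModelFiber n, S.IsPositive ∧
      (∀ z w, inner ℂ (S (S z)) w = inner ℂ (B z) (B w)) ∧
      ∀ T : ModelFiber n →L[ℂ] ModelFiber n, T.IsPositive →
        (∀ z w, inner ℂ (T (T z)) w = inner ℂ (B z) (B w)) → T = S := by
  let B' : ModelFiber n →L[ℂ] ModelFiber n := LinearMap.toContinuousLinearMap B.toLinearMap
  have hPi : ∀ z w, inner ℂ ((B'.adjoint ∘L B') z) w = inner ℂ (B z) (B w) := fun z w =>
    ContinuousLinearMap.adjoint_inner_left B' w (B z)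
  obtain ⟨S, hS, hSS, huniq⟩ := (ContinuousLinearMap.isPositive_adjoint_comp_self B').exists_sqrt
  refine ⟨S, hS, fun z w => ?_, fun T hT hTT => huniq T hT ?_⟩
  · rw [← hPi, ← hSS]
    rfl
  · ext1 z
    exact ext_inner_right ℂ fun w => (hTT z w).trans (hPi z w).symm

/-- The unitary part of a linear isomorphism intertwines the unitary and antiunitary maps that
the isomorphism intertwines. -/
theorem exists_unitary_part (B : ModelFiber n ≃ₗ[ℂ] ModelFiber n) :
    ∃ W : ModelFiber n ≃ₗᵢ[ℂ] ModelFiber n,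
      (∀ U U' : ModelFiber n ≃ₗᵢ[ℂ] ModelFiber n, (∀ z, B (U z) = U' (B z)) →
        ∀ z, W (U z) = U' (W z)) ∧
      ∀ U U' : ModelFiber n →ₛₗ[starRingEnd ℂ] ModelFiber n,
        Function.Surjective U → (∀ z w, inner ℂ (U z) (U w) = inner ℂ w z) →
        (∀ z w, inner ℂ (U' z) (U' w) = inner ℂ w z) → (∀ z, B (U z) = U' (B z)) →
        ∀ z, W (U z) = U' (W z) := by
  obtain ⟨S, hS, hSS, huniq⟩ := exists_sqrt B
  have hsymm : ∀ z w, inner ℂ (S z) w = inner ℂ z (S w) := hS.isSymmetric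
  have hinj : Function.Injective S := by
    refine (injective_iff_map_eq_zero S).2 fun z hz => ?_
    have h := hSS z z
    rw [hz, map_zero, inner_zero_left, eq_comm, inner_self_eq_zero] at h
    exact (LinearEquiv.map_eq_zero_iff B).1 h
  let S' : ModelFiber n ≃ₗ[ℂ] ModelFiber n := LinearEquiv.ofInjectiveEndo S.toLinearMap hinj
  have hS' : ∀ z, S (S'.symm z) = z := fun z => S'.apply_symm_apply z
  -- W = B S⁻¹ is isometric because ⟨Bz, Bw⟩ = ⟨S²z, w⟩ = ⟨Sz, Sw⟩.
  let W : ModelFiber n ≃ₗᵢ[ℂ] ModelFiber n := (S'.symm.trans B).isometryOfInner fun z w => by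
    simp only [LinearEquiv.trans_apply]
    rw [← hSS, hsymm, hS', hS']
  have hW : ∀ z, W (S z) = B z := fun z => congrArg B (S'.symm_apply_apply z)
  refine ⟨W, fun U U' h z => ?_, fun U U' hU hUi hU'i h z => ?_⟩
  -- U S U⁻¹ is positive, and by B U = U' B its square is again B*B. Uniqueness of the root gives S
  -- U = U S, so W = B S⁻¹ intertwines U and U'.
  · let T : ModelFiber n →L[ℂ] ModelFiber n :=
      (U : ModelFiber n →L[ℂ] ModelFiber n) ∘L S ∘L (U.symm : ModelFiber n →L[ℂ] ModelFiber n)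
    have hT : T = S := by
      refine huniq T ?_ fun z w => ?_
      · refine (ContinuousLinearMap.isPositive_iff_complex T).2 fun z => ?_
        have h1 := (ContinuousLinearMap.isPositive_iff_complex S).1 hS (U.symm z)
        have h2 : inner ℂ (T z) z = inner ℂ (S (U.symm z)) (U.symm z) := by
          change inner ℂ (U (S (U.symm z))) z = _
          rw [← U.symm.inner_map_map, U.symm_apply_apply]
        rw [h2]
        exact h1
      · change inner ℂ (U (S (U.symm (U (S (U.symm z)))))) w = _
        rw [U.symm_apply_apply, ← U.symm.inner_map_map, U.symm_apply_apply, hSS,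
          ← U'.inner_map_map, ← h, ← h, U.apply_symm_apply, U.apply_symm_apply]
    have hc : ∀ z, S (U z) = U (S z) := fun z => by
      rw [← hT]
      change U (S (U.symm (U z))) = U (T z)
      rw [U.symm_apply_apply, hT]
    rw [← hS' z, ← hc, hW, hW, h]
  · have hUinj : Function.Injective U := by
      refine (injective_iff_map_eq_zero U).2 fun z hz => ?_
      have h1 := hUi z z
      rw [hz, inner_zero_left, eq_comm, inner_self_eq_zero] at h1
      exact h1
    -- The inverse of U is needed only as a map of sets; its additivity and antilinearity are
    -- recovered from injectivity of U.
    let e := Equiv.ofBijective U ⟨hUinj, hU⟩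
    have he : ∀ z, U (e.symm z) = z := e.apply_symm_apply
    have he' : ∀ z, e.symm (U z) = z := e.symm_apply_apply
    -- The same conjugate U S U⁻¹. It is ℂ-linear because the two antilinear factors conjugate
    -- scalars twice.
    let T : ModelFiber n →L[ℂ] ModelFiber n := LinearMap.toContinuousLinearMap
      { toFun := fun z => U (S (e.symm z))
        map_add' := fun z w => by
          have : e.symm (z + w) = e.symm z + e.symm w := hUinj (by rw [LinearMap.map_add U, he, he, he])
          rw [this, map_add, map_add]
        map_smul' := fun c z => by
          have : e.symm (c • z) = starRingEnd ℂ c • e.symm z :=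
            hUinj (by rw [LinearMap.map_smulₛₗ, he, he, Complex.conj_conj])
          rw [this, map_smul, LinearMap.map_smulₛₗ, Complex.conj_conj]
          rfl }
    have hTa : ∀ z, T z = U (S (e.symm z)) := fun z => rfl
    have hT : T = S := by
      refine huniq T ?_ fun z w => ?_
      · refine (ContinuousLinearMap.isPositive_iff_complex T).2 fun z => ?_
        have h1 := (ContinuousLinearMap.isPositive_iff_complex S).1 hS (e.symm z)
        have h2 : inner ℂ (T z) z = inner ℂ (S (e.symm z)) (e.symm z) := by
          rw [hTa]
          conv_lhs => rw [← he z, he']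
          rw [hUi, hsymm]
        rw [h2]
        exact h1
      · rw [hTa, hTa, he']
        obtain ⟨z, rfl⟩ := hU z
        obtain ⟨w, rfl⟩ := hU w
        rw [he', hUi, ← hsymm, ← hsymm, hSS, h, h, hU'i]
    have hc : ∀ z, S (U z) = U (S z) := fun z => by
      rw [← hT, hTa, he', hT]
    rw [← hS' z, ← hc, hW, hW, h]

end Polar


/-! ### Real and quaternionic representations as families of maps of ℂⁿ. -/

section RepresentationIdentities

theorem StructureKind.sign_mul_sign (k : StructureKind) : k.sign * k.sign = 1 := by
  cases k <;> simp [StructureKind.sign]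

theorem StructureKind.conj_sign (k : StructureKind) : starRingEnd ℂ k.sign = k.sign := by
  cases k <;> simp [StructureKind.sign]

theorem StructureKind.sign_smul_sign_smul (k : StructureKind) {E : Type*} [AddCommGroup E]
    [Module ℂ E] (v : E) : k.sign • k.sign • v = v := by
  rw [smul_smul, k.sign_mul_sign, one_smul]

theorem StructureKind.inner_sign_smul (k : StructureKind) {E : Type*} [NormedAddCommGroup E]
    [InnerProductSpace ℂ E] (v w : E) : inner ℂ (k.sign • v) (k.sign • w) = inner ℂ v w := by
  rw [inner_smul_left, inner_smul_right, k.conj_sign, ← mul_assoc, k.sign_mul_sign, one_mul]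

theorem unitaryIso_signU (k : StructureKind) (n : ℕ) (z : ModelFiber n) :
    unitaryIso n (k.signU n) z = k.sign • z := by
  rw [unitaryIso_apply]
  cases k
  · simp [StructureKind.sign, StructureKind.signU]
  · change WithLp.toLp 2 ((-1 : Matrix (Fin n) (Fin n) ℂ) *ᵥ z.ofLp) = _
    ext i
    simp [StructureKind.sign, Matrix.neg_mulVec]

variable {X : Type*} [TopologicalSpace X] [ChartedSpace ℂ X] {σ : AntiholInvolution X} {x₀ : X}
  {k : StructureKind} {n : ℕ}

namespace ExtUnitary

theorem sign_mul_act (u : ExtUnitary n) (z : ModelFiber n) :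
    (SemidirectProduct.inl (k.signU n) * u : ExtUnitary n).act z = k.sign • u.act z := by
  rw [mul_act, act_inl, unitaryIso_signU]

end ExtUnitary

namespace ExtRep

open OrbifoldGroup

variable (ρ : ExtRep σ x₀ k n)

theorem act_loop_mul (a : Path.Homotopic.Quotient x₀ x₀) (g : OrbifoldGroup σ x₀)
    (z : ModelFiber n) :
    (ρ.toFun (loop a)).act ((ρ.toFun g).act z) = (ρ.toFun (loop a * g)).act z := by
  rw [← ExtUnitary.mul_act, ρ.mul_eq]
  have h : (Multiplicative.toAdd (deg (loop a : OrbifoldGroup σ x₀))).val = 0 := rfl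
  rw [h, zero_mul, pow_zero, map_one, one_mul]

theorem act_mul_loop (g : OrbifoldGroup σ x₀) (a : Path.Homotopic.Quotient x₀ x₀)
    (z : ModelFiber n) :
    (ρ.toFun g).act ((ρ.toFun (loop a)).act z) = (ρ.toFun (g * loop a)).act z := by
  rw [← ExtUnitary.mul_act, ρ.mul_eq]
  have h : (Multiplicative.toAdd (deg (loop a : OrbifoldGroup σ x₀))).val = 0 := rfl
  rw [h, mul_zero, pow_zero, map_one, one_mul]

theorem act_path_mul_path (a b : Path.Homotopic.Quotient x₀ (σ x₀)) (z : ModelFiber n) :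
    (ρ.toFun (path a)).act ((ρ.toFun (path b)).act z)
      = k.sign • (ρ.toFun (path a * path b)).act z := by
  rw [← ExtUnitary.mul_act, ρ.mul_eq]
  have h : ∀ a, (Multiplicative.toAdd (deg (path a : OrbifoldGroup σ x₀))).val = 1 := fun _ => rfl
  rw [h, h, mul_one, pow_one, ExtUnitary.sign_mul_act]

theorem act_one (z : ModelFiber n) : (ρ.toFun 1).act z = z := by
  have h := ρ.mul_eq 1 1
  have h0 : (Multiplicative.toAdd (deg (1 : OrbifoldGroup σ x₀))).val = 0 := rfl
  rw [h0, zero_mul, pow_zero, map_one, one_mul, mul_one, mul_eq_left] at h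
  rw [h, ← map_one (SemidirectProduct.inl (φ := galAction n)), ExtUnitary.act_inl, map_one]
  rfl

theorem right_loop (a : Path.Homotopic.Quotient x₀ x₀) : (ρ.toFun (loop a)).right = 1 :=
  ρ.right_eq _

theorem right_path (a : Path.Homotopic.Quotient x₀ (σ x₀)) :
    (ρ.toFun (path a)).right = Multiplicative.ofAdd 1 :=
  ρ.right_eq _

/-- The isometry `ρ(γ)` for a loop `γ`. -/
noncomputable def loopIso (a : Path.Homotopic.Quotient x₀ x₀) : ModelFiber n ≃ₗᵢ[ℂ] ModelFiber n :=
  (ρ.toFun (loop a)).toIso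

theorem loopIso_apply (a : Path.Homotopic.Quotient x₀ x₀) (z : ModelFiber n) :
    ρ.loopIso a z = (ρ.toFun (loop a)).act z :=
  ExtUnitary.toIso_apply (ρ.right_loop a) z

/-- The antiunitary map `ρ(γ)` for a path `γ` from `x₀` to `σ x₀`. -/
noncomputable def pathAnti (a : Path.Homotopic.Quotient x₀ (σ x₀)) :
    ModelFiber n →ₛₗ[starRingEnd ℂ] ModelFiber n :=
  (ρ.toFun (path a)).toAnti

theorem pathAnti_apply (a : Path.Homotopic.Quotient x₀ (σ x₀)) (z : ModelFiber n) :
    ρ.pathAnti a z = (ρ.toFun (path a)).act z :=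
  ExtUnitary.toAnti_apply (ρ.right_path a) z

theorem inner_pathAnti (a : Path.Homotopic.Quotient x₀ (σ x₀)) (z w : ModelFiber n) :
    inner ℂ (ρ.pathAnti a z) (ρ.pathAnti a w) = inner ℂ w z :=
  ExtUnitary.inner_toAnti _ z w

theorem loopIso_refl (z : ModelFiber n) :
    ρ.loopIso (Path.Homotopic.Quotient.refl x₀) z = z := by
  rw [loopIso_apply]
  exact ρ.act_one z

theorem loopIso_trans (a b : Path.Homotopic.Quotient x₀ x₀) (z : ModelFiber n) :
    ρ.loopIso (a.trans b) z = ρ.loopIso b (ρ.loopIso a z) := by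
  rw [loopIso_apply, loopIso_apply, loopIso_apply, act_loop_mul, loop_mul_loop]

/-- The loop is the product of the classes b and a in Γ, both of degree 1. The twisted law puts the
sign on one side, and as its square is 1 it may be moved to the other. -/
theorem loopIso_trans_mapPath (a b : Path.Homotopic.Quotient x₀ (σ x₀)) (z : ModelFiber n) :
    ρ.loopIso (a.trans (mapPath b)) z = k.sign • ρ.pathAnti b (ρ.pathAnti a z) := by
  rw [loopIso_apply, pathAnti_apply, pathAnti_apply, act_path_mul_path, path_mul_path,
    k.sign_smul_sign_smul]

/-- Equivalence of representations from an intertwining isometry. -/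
theorem equiv_of_intertwines {ρ ρ' : ExtRep σ x₀ k n} (W : ModelFiber n ≃ₗᵢ[ℂ] ModelFiber n)
    (hW : ∀ g z, W ((ρ.toFun g).act z) = (ρ'.toFun g).act (W z)) :
    (ExtRep.setoid σ x₀ k n).r ρ ρ' := by
  have hA : ∀ z, ExtUnitary.act (SemidirectProduct.inl ((unitaryIso n).symm W)) z = W z :=
    fun z => by rw [ExtUnitary.act_inl, MulEquiv.apply_symm_apply]
  refine ⟨(unitaryIso n).symm W, fun g => ?_⟩
  rw [eq_mul_inv_iff_mul_eq]
  refine ExtUnitary.ext_act ?_ fun z => ?_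
  · rw [SemidirectProduct.mul_right, SemidirectProduct.mul_right, ρ.right_eq, ρ'.right_eq,
      SemidirectProduct.right_inl, mul_one, one_mul]
  · rw [ExtUnitary.mul_act, ExtUnitary.mul_act, hA, hA, hW]

theorem exists_intertwines_of_equiv {ρ ρ' : ExtRep σ x₀ k n}
    (h : (ExtRep.setoid σ x₀ k n).r ρ ρ') : ∃ W : ModelFiber n ≃ₗᵢ[ℂ] ModelFiber n,
      ∀ g z, W ((ρ.toFun g).act z) = (ρ'.toFun g).act (W z) := by
  obtain ⟨A, hA⟩ := h
  refine ⟨unitaryIso n A, fun g z => ?_⟩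
  rw [hA, ← ExtUnitary.act_inl, ← ExtUnitary.act_inl, ← ExtUnitary.mul_act, ← ExtUnitary.mul_act,
    inv_mul_cancel_right]

/-- A linear map that intertwines two representations can be replaced by an isometry. -/
theorem equiv_of_linear_intertwines {ρ ρ' : ExtRep σ x₀ k n}
    (B : ModelFiber n ≃ₗ[ℂ] ModelFiber n)
    (hB : ∀ g z, B ((ρ.toFun g).act z) = (ρ'.toFun g).act (B z)) :
    (ExtRep.setoid σ x₀ k n).r ρ ρ' := by
  obtain ⟨W, h1, h2⟩ := exists_unitary_part B
  refine equiv_of_intertwines W ?_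
  rintro (a | a) z
  · rw [← loopIso_apply, ← loopIso_apply]
    exact h1 _ _ (fun z => by rw [loopIso_apply, loopIso_apply, hB]) z
  · rw [← pathAnti_apply, ← pathAnti_apply]
    refine h2 _ _ (fun w => ?_) (ρ.inner_pathAnti a) (ρ'.inner_pathAnti a)
      (fun z => by rw [pathAnti_apply, pathAnti_apply, hB]) z
    -- Solves A z̄ = w, where A is the unitary part of ρ(a).
    refine ⟨conjCoord n ((unitaryIso n (ρ.toFun (path a)).left).symm w), ?_⟩
    change unitaryIso n (ρ.toFun (path a)).left (conjCoord n (conjCoord n _)) = w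
    rw [conjCoord_conjCoord, LinearIsometryEquiv.apply_symm_apply]

end ExtRep

end RepresentationIdentities

/-! ### The monodromy representation of a triple. -/

section Monodromy

variable {X : Type*} [TopologicalSpace X] [ChartedSpace ℂ X] [IsManifold 𝓘(ℂ, ℂ) ω X] {n : ℕ}
  {σ : AntiholInvolution X} {k : StructureKind}

namespace FlatTriple

open OrbifoldGroup FlatUnitaryBundle

variable (V V' : FlatTriple σ k n)

theorem exists_lift_eq (x : X) (w : V.E (σ x)) : ∃ v, V.lift x v = w := by
  have key : ∀ {a b : X} (_ : a = b) (v : V.E a), ∃ v' : V.E b, V.pt b v' = V.pt a v := by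
    rintro a b rfl v
    exact ⟨v, rfl⟩
  obtain ⟨v, hv⟩ := key (σ.involutive x) (V.lift (σ x) w)
  -- Since σ̃² = ±1, the inverse of σ̃ is ±σ̃. The vector v is σ̃w moved to the fiber over x along
  -- σ(σ x) = x.
  refine ⟨k.sign • v, ?_⟩
  have h := congrArg (fun p : V.Total => V.pt (σ p.proj) (V.lift p.proj p.snd)) hv
  have h2 : V.pt (σ x) (V.lift x v) = V.pt (σ x) (k.sign • w) := h.trans (V.lift_lift (σ x) w)
  rw [TotalSpace.mk_inj] at h2
  rw [LinearMap.map_smulₛₗ, h2, k.conj_sign, k.sign_smul_sign_smul]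

theorem lift_injective (x : X) : Function.Injective (V.lift x) := by
  refine (injective_iff_map_eq_zero (V.lift x)).2 fun v hv => ?_
  have h := V.lift_lift x v
  rw [hv, map_zero] at h
  have key : ∀ {a b : X} (_ : a = b) (v : V.E b), V.pt a 0 = V.pt b v → v = 0 := by
    rintro a b rfl v h
    rw [TotalSpace.mk_inj] at h
    exact h.symm
  have h2 := key (σ.involutive x) _ h
  rw [← k.sign_smul_sign_smul v, h2, smul_zero]

/-- The inverse of the lift on a fiber. -/
noncomputable def liftInv (x : X) : V.E (σ x) →ₛₗ[starRingEnd ℂ] V.E x where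
  toFun w := (V.exists_lift_eq x w).choose
  map_add' v w := V.lift_injective x (by
    rw [LinearMap.map_add, (V.exists_lift_eq x _).choose_spec, (V.exists_lift_eq x _).choose_spec,
      (V.exists_lift_eq x _).choose_spec])
  map_smul' c v := V.lift_injective x (by
    rw [LinearMap.map_smulₛₗ, (V.exists_lift_eq x _).choose_spec,
      (V.exists_lift_eq x _).choose_spec, Complex.conj_conj])

theorem lift_liftInv (x : X) (w : V.E (σ x)) : V.lift x (V.liftInv x w) = w :=
  (V.exists_lift_eq x w).choose_spec

variable {x₀ : X}

section

variable {V V'}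

theorem HasMonodromy.trans_isIso {φ : ModelFiber n ≃ₗ[ℂ] V.E x₀} {ρ : ExtRep σ x₀ k n}
    (h : V.HasMonodromy φ ρ) {Φ : ∀ x, V.E x ≃ₗ[ℂ] V'.E x} (hΦ : IsIso V V' Φ) :
    V'.HasMonodromy (φ.trans (Φ x₀)) ρ := by
  refine ⟨fun γ z => hΦ.transport (h.1 γ z), fun γ z => ?_⟩
  have := hΦ.transport (h.2 γ z)
  rwa [hΦ.lift] at this

theorem HasMonodromy.of_intertwines {φ : ModelFiber n ≃ₗ[ℂ] V.E x₀} {ρ ρ' : ExtRep σ x₀ k n}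
    (h : V.HasMonodromy φ ρ) (W : ModelFiber n ≃ₗᵢ[ℂ] ModelFiber n)
    (hW : ∀ g z, W ((ρ.toFun g).act z) = (ρ'.toFun g).act (W z)) :
    V.HasMonodromy (W.symm.toLinearEquiv.trans φ) ρ' := by
  have hW' : ∀ g z, W.symm ((ρ'.toFun g).act z) = (ρ.toFun g).act (W.symm z) := fun g z => by
    rw [LinearIsometryEquiv.symm_apply_eq, hW, LinearIsometryEquiv.apply_symm_apply]
  refine ⟨fun γ z => ?_, fun γ z => ?_⟩
  · have := h.1 γ (W.symm z)
    rw [← hW'] at this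
    exact this
  · have := h.2 γ (W.symm z)
    rw [← hW'] at this
    exact this

end

variable [T2Space X]

theorem pt_transportIso_cast (V : FlatUnitaryBundle X n) {x y y' : X}
    (q : Path.Homotopic.Quotient x y) (h : y' = y) (v : V.E x) :
    V.pt y' (V.transportIso (q.cast rfl h) v) = V.pt y (V.transportIso q v) := by
  subst h
  rw [Path.Homotopic.Quotient.cast_rfl_rfl]

/-- Applying σ̃ to T_a v = σ̃u gives T_{σ(a)} σ̃v = σ̃²u. This is where σ̃² = ±1 becomes the sign in
the multiplication law. -/
theorem transportIso_mapPath {a : Path.Homotopic.Quotient x₀ (σ x₀)} {v u : V.E x₀}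
    (h : V.transportIso a v = V.lift x₀ u) :
    V.transportIso (mapPath a) (V.lift x₀ v) = k.sign • u := by
  have h1 := pt_transportIso_cast V.toFlatUnitaryBundle (a.map σ.toContinuousMap)
    (σ.involutive x₀).symm (V.lift x₀ v)
  have h2 : V.pt x₀ (V.transportIso (mapPath a) (V.lift x₀ v)) = V.pt x₀ (k.sign • u) := by
    refine h1.trans (Eq.trans ?_ (V.lift_lift x₀ u))
    refine congrArg (V.pt (σ (σ x₀))) ((V.transportIso_map a v).trans ?_)
    rw [h]
  rwa [TotalSpace.mk_inj] at h2

variable {V V'}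

theorem hasMonodromy_iff {φ : ModelFiber n ≃ₗ[ℂ] V.E x₀} {ρ : ExtRep σ x₀ k n} :
    V.HasMonodromy φ ρ ↔
      (∀ γ z, V.transportIso γ (φ z) = φ ((ρ.toFun (loop γ)).act z)) ∧
      ∀ γ z, V.transportIso γ (φ z) = V.lift x₀ (φ ((ρ.toFun (path γ)).act z)) := by
  constructor
  · rintro ⟨h1, h2⟩
    refine ⟨fun γ z => ?_, fun γ z => ?_⟩
    · induction γ with | mk γ
      exact (transport_iff' _ _ _).1 (h1 γ z)
    · induction γ with | mk γ
      exact (transport_iff' _ _ _).1 (h2 γ z)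
  · rintro ⟨h1, h2⟩
    exact ⟨fun γ z => (transport_iff' _ _ _).2 (h1 _ z),
      fun γ z => (transport_iff' _ _ _).2 (h2 _ z)⟩

/-- The maps φ⁻¹T_γφ and φ⁻¹σ̃⁻¹T_γφ always satisfy the law of Γ, by functoriality of transport and
its commutation with σ̃. What remains is (anti)unitarity for the standard product of ℂⁿ. It is a
hypothesis, so that φ may be adapted to another inner product than h. -/
theorem exists_hasMonodromy (φ : ModelFiber n ≃ₗ[ℂ] V.E x₀)
    (h1 : ∀ (γ : Path.Homotopic.Quotient x₀ x₀) (z z' w w' : ModelFiber n),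
      V.transportIso γ (φ z) = φ z' → V.transportIso γ (φ w) = φ w' →
        inner ℂ z' w' = inner ℂ z w)
    (h2 : ∀ (γ : Path.Homotopic.Quotient x₀ (σ x₀)) (z z' w w' : ModelFiber n),
      V.transportIso γ (φ z) = V.lift x₀ (φ z') → V.transportIso γ (φ w) = V.lift x₀ (φ w') →
        inner ℂ z' w' = inner ℂ w z) :
    ∃ ρ : ExtRep σ x₀ k n, V.HasMonodromy φ ρ := by
  have hl : ∀ γ : Path.Homotopic.Quotient x₀ x₀, ∃ u : ExtUnitary n, u.right = 1 ∧
      ∀ z, V.transportIso γ (φ z) = φ (u.act z) := fun γ => by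
    let M : ModelFiber n ≃ₗ[ℂ] ModelFiber n :=
      (φ.trans (V.transportIso γ).toLinearEquiv).trans φ.symm
    have hM : ∀ z, V.transportIso γ (φ z) = φ (M z) := fun z => (φ.apply_symm_apply _).symm
    obtain ⟨u, hu, hz⟩ := ExtUnitary.exists_act_eq_iso
      (M.isometryOfInner fun z w => h1 γ _ _ _ _ (hM z) (hM w))
    exact ⟨u, hu, fun z => by rw [hz, hM]; rfl⟩
  have hp : ∀ γ : Path.Homotopic.Quotient x₀ (σ x₀), ∃ u : ExtUnitary n,
      u.right = Multiplicative.ofAdd 1 ∧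
      ∀ z, V.transportIso γ (φ z) = V.lift x₀ (φ (u.act z)) := fun γ => by
    let M : ModelFiber n →ₛₗ[starRingEnd ℂ] ModelFiber n :=
      φ.symm.toLinearMap.comp ((V.liftInv x₀).comp
        (φ.trans (V.transportIso γ).toLinearEquiv).toLinearMap)
    have hM : ∀ z, V.transportIso γ (φ z) = V.lift x₀ (φ (M z)) := fun z => by
      change _ = V.lift x₀ (φ (φ.symm (V.liftInv x₀ (V.transportIso γ (φ z)))))
      rw [φ.apply_symm_apply, lift_liftInv]
    obtain ⟨u, hu, hz⟩ := ExtUnitary.exists_act_eq_anti M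
      fun z w => h2 γ _ _ _ _ (hM z) (hM w)
    exact ⟨u, hu, fun z => by rw [hz, hM]⟩
  choose f hf hf' using hl
  choose g hg hg' using hp
  let F : OrbifoldGroup σ x₀ → ExtUnitary n := fun | loop γ => f γ | path γ => g γ
  have hF : ∀ a, (F a).right = deg a := by
    rintro (a | a)
    exacts [hf a, hg a]
  refine ⟨⟨F, hF, fun a b => ExtUnitary.ext_act ?_ fun z => ?_⟩, hasMonodromy_iff.2 ⟨hf', hg'⟩⟩
  · rw [SemidirectProduct.mul_right, SemidirectProduct.mul_right, hF, hF, hF,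
      SemidirectProduct.right_inl, one_mul, map_mul]
  have hdl : ∀ a, (Multiplicative.toAdd (deg (loop a : OrbifoldGroup σ x₀))).val = 0 :=
    fun _ => rfl
  have hdp : ∀ a, (Multiplicative.toAdd (deg (path a : OrbifoldGroup σ x₀))).val = 1 :=
    fun _ => rfl
  rw [ExtUnitary.mul_act]
  rcases a with a | a <;> rcases b with b | b
  · rw [hdl, zero_mul, pow_zero, map_one, one_mul]
    apply φ.injective
    change φ ((f a).act ((f b).act z)) = φ ((f (b.trans a)).act z)
    rw [← hf', ← hf', ← hf', transportIso_trans]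
  · rw [hdl, zero_mul, pow_zero, map_one, one_mul]
    apply φ.injective
    apply V.lift_injective x₀
    change V.lift x₀ (φ ((f a).act ((g b).act z))) = V.lift x₀ (φ ((g (b.trans (mapLoop a))).act z))
    rw [← hf', ← hg', transportIso_trans, hg']
    exact (V.transportIso_map a _).symm
  · rw [hdl, mul_zero, pow_zero, map_one, one_mul]
    apply φ.injective
    apply V.lift_injective x₀
    change V.lift x₀ (φ ((g a).act ((f b).act z))) = V.lift x₀ (φ ((g (b.trans a)).act z))
    rw [← hg', ← hf', ← hg', transportIso_trans]
  -- Two paths: T_{σ(a)}T_b = T_{σ(a)} σ̃ (σ̃⁻¹T_b), and moving σ̃ past the transport produces σ̃².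
  · rw [hdp, hdp, mul_one, pow_one, ExtUnitary.sign_mul_act]
    apply φ.injective
    change φ ((g a).act ((g b).act z)) = φ (k.sign • (f (b.trans (mapPath a))).act z)
    rw [map_smul, ← hf', transportIso_trans, hg', V.transportIso_mapPath (hg' a _),
      k.sign_smul_sign_smul]

theorem exists_isometry_hasMonodromy (hV : V.Antiunitary) (φ : ModelFiber n ≃ₗᵢ[ℂ] V.E x₀) :
    ∃ ρ : ExtRep σ x₀ k n, V.HasMonodromy φ.toLinearEquiv ρ := by
  refine exists_hasMonodromy φ.toLinearEquiv (fun γ z z' w w' hz hw => ?_)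
    fun γ z z' w w' hz hw => ?_
  · rw [← φ.inner_map_map z', ← φ.inner_map_map z, ← (V.transportIso γ).inner_map_map (φ z)]
    exact (congrArg₂ (Inner.inner ℂ) hz hw).symm
  · rw [← φ.inner_map_map z', ← φ.inner_map_map w, ← (V.transportIso γ).inner_map_map (φ w),
      ← hV]
    exact (congrArg₂ (Inner.inner ℂ) hw hz).symm

/-- A hermitian inner product on a fiber that is invariant under the transports and the lift. -/
@[reducible] noncomputable def invariantCore (V : FlatTriple σ k n) (x₀ : X) :
    InnerProductSpace.Core ℂ (V.E x₀) where
  inner v w := inner ℂ v w + inner ℂ (V.lift x₀ w) (V.lift x₀ v)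
  conj_inner_symm v w := by
    rw [map_add, inner_conj_symm, inner_conj_symm]
  re_inner_nonneg v := by
    rw [map_add]
    exact add_nonneg inner_self_nonneg inner_self_nonneg
  add_left u v w := by
    rw [LinearMap.map_add, inner_add_left, inner_add_right]
    ring
  smul_left v w r := by
    rw [LinearMap.map_smulₛₗ, inner_smul_left, inner_smul_right]
    ring
  definite v h := by
    have h1 := congrArg (RCLike.re (K := ℂ)) h
    rw [map_add, inner_self_eq_norm_sq, inner_self_eq_norm_sq, map_zero] at h1
    exact norm_eq_zero.1 (pow_eq_zero_iff two_ne_zero |>.1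
      (by linarith [sq_nonneg ‖v‖, sq_nonneg ‖V.lift x₀ v‖]))

/-- The frame is orthonormal for `invariantCore`, the sum of h and its conjugate pullback under σ̃,
since σ̃ alone need not preserve h. Loops preserve each summand. -/
theorem exists_frame_hasMonodromy (V : FlatTriple σ k n) (x₀ : X) :
    ∃ (φ : ModelFiber n ≃ₗ[ℂ] V.E x₀) (ρ : ExtRep σ x₀ k n), V.HasMonodromy φ ρ := by
  have := V.finiteDimensional_fiber x₀
  obtain ⟨φ, hφ⟩ := exists_frame_of_core (V.finrank_fiber x₀) (V.invariantCore x₀)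
  have hφ' : ∀ z w, Inner.inner ℂ z w
      = inner ℂ (φ z) (φ w) + inner ℂ (V.lift x₀ (φ w)) (V.lift x₀ (φ z)) :=
    fun z w => (hφ z w).symm
  refine ⟨φ, exists_hasMonodromy φ (fun γ z z' w w' hz hw => ?_) fun γ z z' w w' hz hw => ?_⟩
  · rw [hφ', hφ', ← hz, ← hw, LinearIsometryEquiv.inner_map_map]
    refine congrArg (_ + ·) ?_
    refine Eq.trans ?_ ((V.transportIso (γ.map σ.toContinuousMap)).inner_map_map _ _)
    exact (congrArg₂ (Inner.inner ℂ) (V.transportIso_map γ _) (V.transportIso_map γ _)).symm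
  -- For paths the map σ̃⁻¹T_γ exchanges the two summands; the sign of σ̃² appears in both slots and
  -- drops out.
  · rw [hφ', hφ', ← hz, ← hw, LinearIsometryEquiv.inner_map_map, add_comm,
      ← k.inner_sign_smul (φ z'), ← V.transportIso_mapPath hz, ← V.transportIso_mapPath hw,
      LinearIsometryEquiv.inner_map_map]

theorem HasMonodromy.intertwines {φ φ' : ModelFiber n ≃ₗ[ℂ] V.E x₀} {ρ ρ' : ExtRep σ x₀ k n}
    (h : V.HasMonodromy φ ρ) (h' : V.HasMonodromy φ' ρ') (g : OrbifoldGroup σ x₀)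
    (z : ModelFiber n) :
    φ.trans φ'.symm ((ρ.toFun g).act z) = (ρ'.toFun g).act (φ.trans φ'.symm z) := by
  obtain ⟨h1, h2⟩ := hasMonodromy_iff.1 h
  obtain ⟨h1', h2'⟩ := hasMonodromy_iff.1 h'
  apply φ'.injective
  rcases g with a | a
  · rw [← h1', LinearEquiv.trans_apply, LinearEquiv.trans_apply, φ'.apply_symm_apply,
      φ'.apply_symm_apply, h1]
  · apply V.lift_injective x₀
    rw [← h2', LinearEquiv.trans_apply, LinearEquiv.trans_apply, φ'.apply_symm_apply,
      φ'.apply_symm_apply, h2]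

end FlatTriple

end Monodromy


/-! ### Triples with the same monodromy are isomorphic. -/

section MonodromyIsomorphism

variable {X : Type*} [TopologicalSpace X] [ChartedSpace ℂ X] [IsManifold 𝓘(ℂ, ℂ) ω X]
  [T2Space X] {n : ℕ}

open FlatUnitaryBundle

/-- A map that is compatible with parallel transport is constant in flat frames. -/
theorem FlatTriple.flatHom_of_transport {V V' : FlatUnitaryBundle X n}
    (Φ : ∀ x, V.E x ≃ₗ[ℂ] V'.E x)
    (h : ∀ (x y : X) (δ : Path.Homotopic.Quotient x y) (v : V.E x),
      Φ y (V.transportIso δ v) = V'.transportIso δ (Φ x v)) : FlatTriple.FlatHom V V' Φ := by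
  intro x
  obtain ⟨G, U, hx, hG⟩ := V.exists_isFlatFrameOn x
  obtain ⟨G', U', hx', hG'⟩ := V'.exists_isFlatFrameOn x
  let L : ModelFiber n ≃ₗ[ℂ] ModelFiber n :=
    ((G x).toLinearEquiv.trans (Φ x)).trans (G' x).symm.toLinearEquiv
  refine ⟨G, G', U, U', L.toContinuousLinearEquiv, hx, hx', hG, hG', ?_⟩
  filter_upwards [eventually_exists_path (hG.isOpen.inter hG'.isOpen) ⟨hx, hx'⟩] with z hz w
  obtain ⟨δ, hδ⟩ := hz
  rw [← (transport_iff' δ _ _).1 (hG.transport (fun t => (hδ t).1) w), h,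
    ← (transport_iff' δ _ _).1 (hG'.transport (fun t => (hδ t).2) _)]
  refine congrArg (V'.transportIso _) ?_
  exact ((G' x).apply_symm_apply _).symm

namespace FlatTriple

open OrbifoldGroup

variable {σ : AntiholInvolution X} {k : StructureKind} {V V' : FlatTriple σ k n} {x₀ : X}

/-- Triples with the same monodromy are isomorphic. -/
theorem HasMonodromy.exists_isIso [PathConnectedSpace X] {φ : ModelFiber n ≃ₗ[ℂ] V.E x₀}
    {φ' : ModelFiber n ≃ₗ[ℂ] V'.E x₀} {ρ : ExtRep σ x₀ k n} (h : V.HasMonodromy φ ρ)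
    (h' : V'.HasMonodromy φ' ρ) : ∃ Φ : ∀ x, V.E x ≃ₗ[ℂ] V'.E x, IsIso V V' Φ ∧
      ((∀ v w, inner ℂ (φ.symm.trans φ' v) (φ.symm.trans φ' w) = inner ℂ v w) →
        IsometricOnFibers V V' Φ) := by
  obtain ⟨h1, h2⟩ := hasMonodromy_iff.1 h
  obtain ⟨h1', h2'⟩ := hasMonodromy_iff.1 h'
  let B := φ.symm.trans φ'
  have hB : ∀ z, B (φ z) = φ' z := fun z => congrArg φ' (φ.symm_apply_apply z)
  have hB1 : ∀ (γ : Path.Homotopic.Quotient x₀ x₀) v,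
      B (V.transportIso γ v) = V'.transportIso γ (B v) := fun γ v => by
    obtain ⟨z, rfl⟩ := φ.surjective v
    rw [h1, hB, hB, h1']
  have hB2 : ∀ (γ : Path.Homotopic.Quotient x₀ (σ x₀)) v u, V.transportIso γ v = V.lift x₀ u →
      V'.transportIso γ (B v) = V'.lift x₀ (B u) := fun γ v u huv => by
    obtain ⟨z, rfl⟩ := φ.surjective v
    rw [h2] at huv
    rw [← V.lift_injective x₀ huv, hB, hB, h2']
  let p : ∀ x, Path.Homotopic.Quotient x₀ x := fun x =>
    Path.Homotopic.Quotient.mk (PathConnectedSpace.joined x₀ x).somePath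
  -- Transport back to x₀, apply B = φ'φ⁻¹, and transport out again.
  let Φ : ∀ x, V.E x ≃ₗ[ℂ] V'.E x := fun x =>
    ((V.transportIso (p x)).symm.toLinearEquiv.trans B).trans (V'.transportIso (p x)).toLinearEquiv
  -- Independence of the chosen path: two choices differ by a loop, and B commutes with the
  -- monodromy of loops.
  have hΦ : ∀ {x} (q : Path.Homotopic.Quotient x₀ x) v,
      Φ x (V.transportIso q v) = V'.transportIso q (B v) := fun {x} q v => by
    change V'.transportIso (p x) (B ((V.transportIso (p x)).symm (V.transportIso q v))) = _
    rw [← transportIso_symm, ← transportIso_trans, hB1, ← transportIso_trans,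
      Path.Homotopic.Quotient.trans_assoc, Path.Homotopic.Quotient.symm_trans,
      Path.Homotopic.Quotient.trans_refl]
  have hsurj : ∀ {x} (q : Path.Homotopic.Quotient x₀ x) v, ∃ u, V.transportIso q u = v :=
    fun q v => (V.transportIso q).surjective v
  refine ⟨Φ, (flatHom_of_transport Φ fun x y δ v => ?_).isIso fun x v => ?_, fun hm x v w => ?_⟩
  · obtain ⟨u, rfl⟩ := hsurj (p x) v
    rw [← transportIso_trans, hΦ, hΦ, transportIso_trans]
  · obtain ⟨u, rfl⟩ := hsurj (p x) v
    -- The point σ x is reached from x₀ by a path to σ x₀ followed by σ(p x). The first piece is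
    -- controlled by the monodromy of paths (`hB2`), the second by equivariance of transport.
    obtain ⟨u', hu'⟩ := hsurj (p (σ x₀)) (V.lift x₀ u)
    have e1 : V.transportIso ((p (σ x₀)).trans ((p x).map σ.toContinuousMap)) u'
        = V.lift x (V.transportIso (p x) u) := by
      refine (transportIso_trans _ _ _).trans ?_
      refine (congrArg _ hu').trans (V.transportIso_map _ _)
    have e2 : V'.transportIso ((p (σ x₀)).trans ((p x).map σ.toContinuousMap)) (B u')
        = V'.lift x (V'.transportIso (p x) (B u)) := by
      refine (transportIso_trans _ _ _).trans ?_
      refine (congrArg _ (hB2 _ _ _ hu')).trans (V'.transportIso_map _ _)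
    rw [hΦ]
    exact (congrArg _ e1.symm).trans ((hΦ _ _).trans e2)
  · exact ((V'.transportIso (p x)).inner_map_map _ _).trans ((hm _ _).trans
      ((V.transportIso (p x)).symm.inner_map_map _ _))

end FlatTriple

end MonodromyIsomorphism

/-! ### Neighbourhoods whose paths are determined up to homotopy by their end points. -/

section SimplyConnectedNeighbourhoods

variable {X : Type*} [TopologicalSpace X] [ChartedSpace ℂ X]

/-- W is a coordinate ball. A ball is convex, hence contractible and simply connected, and the
inverse chart carries its homotopies to X. -/
theorem exists_nhd_paths_homotopic (a : X) : ∃ W : Set X, IsOpen W ∧ a ∈ W ∧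
    (∀ x ∈ W, ∃ δ : Path a x, ∀ t, δ t ∈ W) ∧
    ∀ (x y : X) (δ δ' : Path x y), (∀ t, δ t ∈ W) → (∀ t, δ' t ∈ W) → δ.Homotopic δ' := by
  let e := chartAt ℂ a
  have ha : a ∈ e.source := mem_chart_source ℂ a
  obtain ⟨r, hr, hball⟩ := Metric.isOpen_iff.1 e.open_target (e a) (e.map_source ha)
  let B := Metric.ball (e a) r
  have hB : Convex ℝ B := convex_ball _ _
  have hcB : ContractibleSpace B := hB.contractibleSpace ⟨e a, Metric.mem_ball_self hr⟩
  let f : C(B, X) := ⟨fun z => e.symm z,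
    (e.continuousOn_symm.mono hball).comp_continuous continuous_subtype_val fun z => z.2⟩
  let W := e.source ∩ e ⁻¹' B
  have hW : ∀ z ∈ W, e.symm (e z) = z := fun z hz => e.left_inv hz.1
  have hlift : ∀ {x y : X} (δ : Path x y), (∀ t, δ t ∈ W) →
      ∀ (hx : x ∈ W) (hy : y ∈ W), ∃ δ' : Path (⟨e x, hx.2⟩ : B) ⟨e y, hy.2⟩,
        ∀ t, f (δ' t) = δ t := by
    intro x y δ hδ hx hy
    refine ⟨⟨⟨fun t => ⟨e (δ t), (hδ t).2⟩, ?_⟩, ?_, ?_⟩, fun t => hW _ (hδ t)⟩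
    · exact (e.continuousOn.comp_continuous δ.continuous fun t => (hδ t).1).subtype_mk _
    · exact Subtype.ext (congrArg e δ.source)
    · exact Subtype.ext (congrArg e δ.target)
  refine ⟨W, e.isOpen_inter_preimage Metric.isOpen_ball, ⟨ha, Metric.mem_ball_self hr⟩,
    fun x hx => ?_, fun x y δ δ' hδ hδ' => ?_⟩
  · let γ : Path (⟨e a, Metric.mem_ball_self hr⟩ : B) ⟨e x, hx.2⟩ :=
      (PathConnectedSpace.joined _ _).somePath
    refine ⟨(γ.map f.continuous).cast (hW a ⟨ha, Metric.mem_ball_self hr⟩).symm (hW x hx).symm,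
      fun t => ⟨e.map_target (hball (γ t).2), ?_⟩⟩
    change e (e.symm (γ t)) ∈ B
    rw [e.right_inv (hball (γ t).2)]
    exact (γ t).2
  · have hx : x ∈ W := by simpa using hδ 0
    have hy : y ∈ W := by simpa using hδ 1
    obtain ⟨γ, hγ⟩ := hlift δ hδ hx hy
    obtain ⟨γ', hγ'⟩ := hlift δ' hδ' hx hy
    have h1 := ((SimplyConnectedSpace.paths_homotopic γ γ').map f).pathCast
      (hW x hx).symm (hW y hy).symm
    have e1 : (γ.map f.continuous).cast (hW x hx).symm (hW y hy).symm = δ :=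
      Path.ext (funext hγ)
    have e2 : (γ'.map f.continuous).cast (hW x hx).symm (hW y hy).symm = δ' :=
      Path.ext (funext hγ')
    rwa [e1, e2] at h1

end SimplyConnectedNeighbourhoods


/-! ### The triple of a representation. -/

section BundleOfRepresentation

theorem Path.Homotopic.Quotient.cast_trans_cast {X : Type*} [TopologicalSpace X] {x y z y' z' : X}
    (p : Path.Homotopic.Quotient x y) (q : Path.Homotopic.Quotient y z) (hy : y' = y)
    (hz : z' = z) : (p.cast rfl hy).trans (q.cast hy hz) = (p.trans q).cast rfl hz := by
  subst hy hz
  simp only [Path.Homotopic.Quotient.cast_rfl_rfl]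

/-- The interval between t and t' shrinks to t, so continuity of δ traps its image in W. -/
theorem Path.eventually_subpath_mem {X : Type*} [TopologicalSpace X] {x y : X} (δ : Path x y)
    {W : Set X} (hW : IsOpen W) {t : unitInterval} (ht : δ t ∈ W) :
    ∀ᶠ t' in 𝓝 t, ∀ s, δ.subpath t t' s ∈ W := by
  have h1 : Tendsto (fun t' : unitInterval => Set.uIcc t t') (𝓝 t) (𝓝 t).smallSets :=
    tendsto_const_nhds.uIcc tendsto_id
  have h2 : ∀ᶠ s in (𝓝 t).smallSets, s ⊆ δ ⁻¹' W :=
    eventually_smallSets_subset.2 (δ.continuous.continuousAt.preimage_mem_nhds (hW.mem_nhds ht))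
  filter_upwards [h1.eventually h2] with t' ht' s
  have h3 : δ.subpath t t' s ∈ δ '' Set.uIcc t t' := by
    rw [← Path.range_subpath]
    exact Set.mem_range_self s
  obtain ⟨u, hu, hus⟩ := h3
  rw [← hus]
  exact ht' hu

/-- An open cover indexed by the points of `X`, with classes of paths from `x₀` to the points of
its members that are compatible with the paths in the members. -/
structure PathCover (X : Type*) [TopologicalSpace X] (x₀ : X) where
  dom : X → Set X
  isOpen_dom : ∀ a, IsOpen (dom a)
  mem_dom : ∀ a, a ∈ dom a
  toClass : ∀ _ x : X, Path.Homotopic.Quotient x₀ x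
  toClass_eq : ∀ (a x y : X) (δ : Path x y), (∀ t, δ t ∈ dom a) →
    toClass a y = (toClass a x).trans (Path.Homotopic.Quotient.mk δ)

/-- The class at x goes from x₀ to the center a by a fixed path, then to x inside the ball about a.
Compatibility holds because paths inside the ball with the same ends are homotopic. -/
theorem PathCover.nonempty {X : Type*} [TopologicalSpace X] [ChartedSpace ℂ X]
    [PathConnectedSpace X] (x₀ : X) : Nonempty (PathCover X x₀) := by
  classical
  choose W hWo hW hWp hWh using exists_nhd_paths_homotopic (X := X)
  choose loc hloc using hWp
  let p : ∀ x, Path.Homotopic.Quotient x₀ x := fun x =>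
    Path.Homotopic.Quotient.mk (PathConnectedSpace.joined x₀ x).somePath
  refine ⟨PathCover.mk W hWo hW (fun a x =>
    if h : x ∈ W a then (p a).trans (Path.Homotopic.Quotient.mk (loc a x h)) else p x)
    fun a x y δ hδ => ?_⟩
  have hx : x ∈ W a := by simpa using hδ 0
  have hy : y ∈ W a := by simpa using hδ 1
  rw [dif_pos hx, dif_pos hy, Path.Homotopic.Quotient.trans_assoc]
  refine congrArg (Path.Homotopic.Quotient.trans _) (Path.Homotopic.Quotient.eq.2
    (hWh a _ _ _ ((loc a x hx).trans δ) (hloc a y hy) fun t => ?_))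
  rw [Path.trans_apply]
  split_ifs
  exacts [hloc a x hx _, hδ _]

variable {X : Type*} [TopologicalSpace X] [ChartedSpace ℂ X] {n : ℕ}
  {σ : AntiholInvolution X} {k : StructureKind} {x₀ : X}

namespace OrbifoldGroup

/-- The image under `σ` of a class of paths. -/
def mapClass (σ : AntiholInvolution X) {x y : X} (p : Path.Homotopic.Quotient x y) :
    Path.Homotopic.Quotient (σ x) (σ y) :=
  p.map σ.toContinuousMap

theorem mapClass_trans {x y z : X} (p : Path.Homotopic.Quotient x y)
    (q : Path.Homotopic.Quotient y z) :
    mapClass σ (p.trans q) = (mapClass σ p).trans (mapClass σ q) := by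
  induction p with | mk a
  induction q with | mk b
  refine congrArg Path.Homotopic.Quotient.mk (Path.ext (funext fun t => ?_))
  exact congrFun (congrArg DFunLike.coe (Path.map_trans a b σ.continuous_toFun)) t

theorem mapClass_mapClass {x y : X} (p : Path.Homotopic.Quotient x y) :
    mapClass σ (mapClass σ p) = p.cast (σ.involutive x) (σ.involutive y) := by
  induction p with | mk a
  exact congrArg Path.Homotopic.Quotient.mk (Path.ext (funext fun t => σ.involutive _))

theorem mapClass_eq_cast_mapPath (p : Path.Homotopic.Quotient x₀ (σ x₀)) :
    mapClass σ p = (mapPath p).cast rfl (σ.involutive x₀) := by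
  induction p with | mk a
  rfl

/-- The operation q ↦ bσ(q) covers σ. Done twice it prepends the loop that represents the square of
b in Γ; the cast only identifies σ(σ x) with x. -/
theorem trans_mapClass_trans_mapClass {x : X} (b : Path.Homotopic.Quotient x₀ (σ x₀))
    (q : Path.Homotopic.Quotient x₀ x) : b.trans (mapClass σ (b.trans (mapClass σ q)))
      = ((b.trans (mapPath b)).trans q).cast rfl (σ.involutive x) := by
  rw [mapClass_trans, mapClass_mapClass, mapClass_eq_cast_mapPath,
    Path.Homotopic.Quotient.cast_trans_cast, Path.Homotopic.Quotient.trans_assoc]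
  refine Eq.trans ?_ (Path.Homotopic.Quotient.cast_trans_cast b ((mapPath b).trans q) rfl
    (σ.involutive x))
  rw [Path.Homotopic.Quotient.cast_rfl_rfl]

end OrbifoldGroup

open OrbifoldGroup in
/-- Conjugation of a loop by a path, in `Γ`. -/
theorem ExtRep.pathAnti_loopIso (ρ : ExtRep σ x₀ k n) (β : Path.Homotopic.Quotient x₀ (σ x₀))
    (γ : Path.Homotopic.Quotient x₀ x₀) (z : ModelFiber n) :
    ρ.pathAnti β (ρ.loopIso γ z)
      = ρ.loopIso ((((mapPath β).symm).trans (mapLoop γ)).trans (mapPath β)) (ρ.pathAnti β z) := by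
  have h : (loop ((((mapPath β).symm).trans (mapLoop γ)).trans (mapPath β)) : OrbifoldGroup σ x₀)
      = path β * (loop γ * (path β)⁻¹) := rfl
  rw [ρ.pathAnti_apply, ρ.loopIso_apply, ρ.loopIso_apply, ρ.pathAnti_apply, ρ.act_mul_loop,
    ρ.act_loop_mul, h, mul_assoc, inv_mul_cancel_right]

namespace PathCover

open OrbifoldGroup

variable (C : PathCover X x₀) (ρ : ExtRep σ x₀ k n)

/-- The cocycle of the flat bundle of a representation. -/
noncomputable def cocycle : UnitaryCocycle X n where
  dom := C.dom
  isOpen_dom := C.isOpen_dom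
  mem_dom := C.mem_dom
  c a b x := ρ.loopIso ((C.toClass a x).trans (C.toClass b x).symm)
  c_self a x _ w := by
    rw [Path.Homotopic.Quotient.trans_symm, ρ.loopIso_refl]
  c_comp a b d x _ _ _ w := by
    rw [← ρ.loopIso_trans, Path.Homotopic.Quotient.trans_assoc,
      ← Path.Homotopic.Quotient.trans_assoc _ _ (C.toClass d x).symm,
      Path.Homotopic.Quotient.symm_trans, Path.Homotopic.Quotient.refl_trans]
  c_loc a b x ha hb := by
    filter_upwards [eventually_exists_path ((C.isOpen_dom a).inter (C.isOpen_dom b)) ⟨ha, hb⟩]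
      with z hz
    obtain ⟨δ, hδ⟩ := hz
    -- Moving from x to z extends both path classes by the same δ, which cancels in the loop. Hence
    -- the cocycle is locally constant.
    have h : ∀ p q : Path.Homotopic.Quotient x₀ x,
        (p.trans (Path.Homotopic.Quotient.mk δ)).trans (q.trans (Path.Homotopic.Quotient.mk δ)).symm
          = p.trans q.symm := fun p q => by
      induction p with | mk p
      induction q with | mk q
      have : (q.trans δ).symm = δ.symm.trans q.symm := Path.trans_symm q δ
      rw [← Path.Homotopic.Quotient.mk_trans q, ← Path.Homotopic.Quotient.mk_symm, this,
        Path.Homotopic.Quotient.mk_trans, Path.Homotopic.Quotient.mk_symm,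
        Path.Homotopic.Quotient.trans_assoc,
        ← Path.Homotopic.Quotient.trans_assoc (Path.Homotopic.Quotient.mk δ),
        Path.Homotopic.Quotient.trans_symm, Path.Homotopic.Quotient.refl_trans,
        Path.Homotopic.Quotient.mk_symm]
    rw [C.toClass_eq a x z δ fun t => (hδ t).1, C.toClass_eq b x z δ fun t => (hδ t).2, h]

variable [IsManifold 𝓘(ℂ, ℂ) ω X]

/-- The flat bundle of a representation. -/
noncomputable abbrev bundle : FlatUnitaryBundle X n := (C.cocycle ρ).flatBundle

/-- The frame of the fiber over `x` attached to a class of paths from `x₀` to `x`. -/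
noncomputable def frame {x : X} (q : Path.Homotopic.Quotient x₀ x) :
    ModelFiber n ≃ₗᵢ[ℂ] (C.bundle ρ).E x :=
  ρ.loopIso (q.trans (C.toClass x x).symm)

theorem isFlatFrameOn_frame (a : X) :
    (C.bundle ρ).IsFlatFrameOn (fun x => C.frame ρ (C.toClass a x)) (C.dom a) :=
  (C.cocycle ρ).isFlatFrameOn_frame a

theorem frame_trans {x : X} (γ : Path.Homotopic.Quotient x₀ x₀)
    (q : Path.Homotopic.Quotient x₀ x) (z : ModelFiber n) :
    C.frame ρ (γ.trans q) z = C.frame ρ q (ρ.loopIso γ z) := by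
  refine Eq.trans ?_ (ρ.loopIso_trans _ _ z)
  rw [← Path.Homotopic.Quotient.trans_assoc]
  rfl

/-- The change of frame is ρ of the loop formed by q and q' reversed, and does not depend on the
common continuation δ. This is the local constancy behind both transport and the lift. -/
theorem frame_trans_eq {x y : X} (q q' : Path.Homotopic.Quotient x₀ x)
    (δ : Path.Homotopic.Quotient x y) (z : ModelFiber n) :
    C.frame ρ (q.trans δ) z = C.frame ρ (q'.trans δ) (ρ.loopIso (q.trans q'.symm) z) := by
  rw [← frame_trans, Path.Homotopic.Quotient.trans_assoc,
    ← Path.Homotopic.Quotient.trans_assoc _ q', Path.Homotopic.Quotient.symm_trans,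
    Path.Homotopic.Quotient.refl_trans]

theorem pt_frame_cast {x x' : X} (h : x' = x) (q : Path.Homotopic.Quotient x₀ x)
    (z : ModelFiber n) :
    (C.bundle ρ).pt x' (C.frame ρ (q.cast rfl h) z) = (C.bundle ρ).pt x (C.frame ρ q z) := by
  subst h
  rw [Path.Homotopic.Quotient.cast_rfl_rfl]

/-- Parallel transport of [q, z] keeps z and lengthens q. -/
theorem transport_frame {x y : X} (q : Path.Homotopic.Quotient x₀ x) (δ : Path x y)
    (z : ModelFiber n) : (C.bundle ρ).Transport δ (C.frame ρ q z)
      (C.frame ρ (q.trans (Path.Homotopic.Quotient.mk δ)) z) := by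
  -- The class q followed by the part of δ up to time t; the parallel lift is t ↦ [r t, z].
  let r : ∀ t, Path.Homotopic.Quotient x₀ (δ t) := fun t =>
    (q.cast rfl δ.source).trans (Path.Homotopic.Quotient.mk (δ.subpath 0 t))
  have hr : ∀ t t', r t' = (r t).trans (Path.Homotopic.Quotient.mk (δ.subpath t t')) :=
    fun t t' => by
      refine Eq.trans ?_ (Path.Homotopic.Quotient.trans_assoc _ _ _).symm
      refine congrArg (Path.Homotopic.Quotient.trans _) ?_
      rw [← Path.Homotopic.Quotient.mk_trans]
      exact (Path.Homotopic.Quotient.eq.2 ⟨Path.Homotopy.subpathTransSubpath δ 0 t t'⟩).symm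
  refine ⟨fun t => C.frame ρ (r t) z, ?_, ?_, fun t => ?_⟩
  · have h0 : r 0 = q.cast rfl δ.source := by
      change (q.cast rfl δ.source).trans (Path.Homotopic.Quotient.mk (δ.subpath 0 0)) = _
      rw [Path.subpath_self, Path.Homotopic.Quotient.mk_refl, Path.Homotopic.Quotient.trans_refl]
    change (C.bundle ρ).pt (δ 0) (C.frame ρ (r 0) z) = _
    rw [h0]
    exact C.pt_frame_cast ρ δ.source q z
  · have h1 : r 1 = (q.trans (Path.Homotopic.Quotient.mk δ)).cast rfl δ.target := by
      change (q.cast rfl δ.source).trans (Path.Homotopic.Quotient.mk (δ.subpath 0 1)) = _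
      rw [Path.subpath_zero_one, ← Path.Homotopic.Quotient.cast_trans_cast,
        Path.Homotopic.Quotient.mk_cast]
    change (C.bundle ρ).pt (δ 1) (C.frame ρ (r 1) z) = _
    rw [h1]
    exact C.pt_frame_cast ρ δ.target _ z
  · have ht := C.mem_dom (δ t)
    refine ⟨fun y => C.frame ρ (C.toClass (δ t) y)
      (ρ.loopIso ((r t).trans (C.toClass (δ t) (δ t)).symm) z),
      (C.isFlatFrameOn_frame ρ (δ t)).parallelNear_apply ht _, ?_⟩
    filter_upwards [δ.eventually_subpath_mem (C.isOpen_dom (δ t)) ht] with t' ht'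
    rw [hr t t', C.toClass_eq (δ t) (δ t) (δ t') _ ht', ← frame_trans_eq]

theorem transportIso_frame [T2Space X] {x y : X} (q : Path.Homotopic.Quotient x₀ x)
    (δ : Path.Homotopic.Quotient x y) (z : ModelFiber n) :
    (C.bundle ρ).transportIso δ (C.frame ρ q z) = C.frame ρ (q.trans δ) z := by
  induction δ with | mk δ
  exact (FlatUnitaryBundle.transport_iff' _ _ _).1 (C.transport_frame ρ q δ z)

/-- The lift of `σ` to the flat bundle of a representation, computed with a path `β`. -/
noncomputable def lift (β : Path.Homotopic.Quotient x₀ (σ x₀)) (x : X) :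
    (C.bundle ρ).E x →ₛₗ[starRingEnd ℂ] (C.bundle ρ).E (σ x) :=
  (k.sign • (C.frame ρ ((mapPath β).symm.trans
    (mapClass σ (C.toClass x x)))).toLinearEquiv.toLinearMap).comp
    ((ρ.pathAnti β).comp (C.frame ρ (C.toClass x x)).symm.toLinearEquiv.toLinearMap)

variable {C ρ}

/-- The definition uses one particular class of paths to x, but another class differs by a loop γ.
The relation ρ(β)ρ(γ) = ρ(βγβ⁻¹)ρ(β) shows that every class gives the same lift. The path in front
of σ(q) represents β⁻¹ in Γ, and the sign compensates ρ(β⁻¹)ρ(β) = ±1. -/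
theorem lift_frame (β : Path.Homotopic.Quotient x₀ (σ x₀)) {x : X}
    (q : Path.Homotopic.Quotient x₀ x) (z : ModelFiber n) :
    C.lift ρ β x (C.frame ρ q z) = k.sign •
      C.frame ρ ((mapPath β).symm.trans (mapClass σ q)) (ρ.pathAnti β z) := by
  obtain ⟨γ, rfl⟩ : ∃ γ : Path.Homotopic.Quotient x₀ x₀, γ.trans (C.toClass x x) = q :=
    ⟨q.trans (C.toClass x x).symm, by
      rw [Path.Homotopic.Quotient.trans_assoc, Path.Homotopic.Quotient.symm_trans,
        Path.Homotopic.Quotient.trans_refl]⟩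
  rw [frame_trans, mapClass_trans]
  change k.sign • C.frame ρ _ (ρ.pathAnti β ((C.frame ρ (C.toClass x x)).symm
    (C.frame ρ (C.toClass x x) (ρ.loopIso γ z)))) = _
  rw [LinearIsometryEquiv.symm_apply_apply, ρ.pathAnti_loopIso, ← frame_trans]
  refine congrArg (fun q => k.sign • C.frame ρ q (ρ.pathAnti β z)) ?_
  change _ = (mapPath β).symm.trans ((mapLoop γ).trans (mapClass σ (C.toClass x x)))
  simp only [Path.Homotopic.Quotient.trans_assoc]
  rw [← Path.Homotopic.Quotient.trans_assoc (mapPath β), Path.Homotopic.Quotient.trans_symm,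
    Path.Homotopic.Quotient.refl_trans]

theorem inner_lift (β : Path.Homotopic.Quotient x₀ (σ x₀)) (x : X) (v w : (C.bundle ρ).E x) :
    inner ℂ (C.lift ρ β x v) (C.lift ρ β x w) = inner ℂ w v := by
  obtain ⟨z, rfl⟩ := (C.frame ρ (C.toClass x x)).surjective v
  obtain ⟨z', rfl⟩ := (C.frame ρ (C.toClass x x)).surjective w
  rw [lift_frame, lift_frame, k.inner_sign_smul, LinearIsometryEquiv.inner_map_map,
    LinearIsometryEquiv.inner_map_map, ρ.inner_pathAnti]

/-- The two explicit signs cancel. What is left is ρ of the loop β⁻²∈Γ applied after ρ(β)ρ(β) =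
±ρ(β²), that is ±1. -/
theorem lift_lift (β : Path.Homotopic.Quotient x₀ (σ x₀)) (x : X) (v : (C.bundle ρ).E x) :
    (C.bundle ρ).pt (σ (σ x)) (C.lift ρ β (σ x) (C.lift ρ β x v))
      = (C.bundle ρ).pt x (k.sign • v) := by
  let q := C.toClass x x
  obtain ⟨z, rfl⟩ := (C.frame ρ q).surjective v
  rw [lift_frame, LinearMap.map_smulₛₗ, k.conj_sign, lift_frame, k.sign_smul_sign_smul]
  rw [trans_mapClass_trans_mapClass]
  refine (C.pt_frame_cast ρ (σ.involutive x) _ _).trans (congrArg ((C.bundle ρ).pt x) ?_)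
  rw [frame_trans, ← map_smul]
  refine congrArg (C.frame ρ q) ?_
  have h2 : (loop ((mapPath β).symm.trans (mapPath (mapPath β).symm)) : OrbifoldGroup σ x₀)
      = (path β)⁻¹ * (path β)⁻¹ := rfl
  rw [ρ.loopIso_apply, ρ.pathAnti_apply, ρ.pathAnti_apply, ρ.act_path_mul_path, h2]
  have h3 : ∀ u : ModelFiber n, (ρ.toFun ((path β)⁻¹ * (path β)⁻¹)).act (k.sign • u)
      = k.sign • (ρ.toFun ((path β)⁻¹ * (path β)⁻¹)).act u := fun u => by
    rw [← h2, ← ρ.loopIso_apply, ← ρ.loopIso_apply, map_smul]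
  rw [h3, ← h2, ρ.act_loop_mul, h2]
  have h4 : (path β)⁻¹ * (path β)⁻¹ * (path β * path β) = (1 : OrbifoldGroup σ x₀) := by group
  rw [h4, ρ.act_one]

variable (C ρ)

/-- The triple of a representation. -/
noncomputable def triple (β : Path.Homotopic.Quotient x₀ (σ x₀)) : FlatTriple σ k n :=
  (C.bundle ρ).toTriple σ k (C.lift ρ β) (lift_lift β) fun x => by
    have hσ : σ x ∈ C.dom (σ x) := C.mem_dom (σ x)
    let l := (((mapPath β).symm.trans (mapClass σ (C.toClass x x))).trans
      (C.toClass (σ x) (σ x)).symm)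
    -- The matrix of the lift in the frames at x and σ x. It is constant because the path classes to
    -- z and σ z are extended by δ and σ(δ), leaving the loop l unchanged.
    refine ⟨_, _, _, _, (k.sign • (ρ.loopIso l).toLinearEquiv.toLinearMap).comp (ρ.pathAnti β),
      C.mem_dom x, C.mem_dom (σ x), C.isFlatFrameOn_frame ρ x, C.isFlatFrameOn_frame ρ (σ x), ?_⟩
    filter_upwards [eventually_exists_path ((C.isOpen_dom x).inter
      ((C.isOpen_dom (σ x)).preimage σ.continuous_toFun)) ⟨C.mem_dom x, hσ⟩] with z hz w
    obtain ⟨δ, hδ⟩ := hz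
    rw [lift_frame, C.toClass_eq x x z δ fun t => (hδ t).1,
      C.toClass_eq (σ x) (σ x) (σ z) (δ.map σ.continuous_toFun) fun t => (hδ t).2, mapClass_trans,
      ← Path.Homotopic.Quotient.trans_assoc]
    change k.sign • _ = C.frame ρ _ (k.sign • ρ.loopIso l (ρ.pathAnti β w))
    rw [map_smul]
    exact congrArg (k.sign • ·) (C.frame_trans_eq ρ _ _ _ _)

theorem antiunitary_triple (β : Path.Homotopic.Quotient x₀ (σ x₀)) : (C.triple ρ β).Antiunitary :=
  inner_lift β

theorem hasMonodromy_triple [T2Space X] (β : Path.Homotopic.Quotient x₀ (σ x₀)) :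
    (C.triple ρ β).HasMonodromy
      (C.frame ρ (Path.Homotopic.Quotient.refl x₀)).toLinearEquiv ρ := by
  refine FlatTriple.hasMonodromy_iff.2 ⟨fun γ z => ?_, fun γ z => ?_⟩
  · refine (C.transportIso_frame ρ _ γ z).trans ?_
    rw [← ρ.loopIso_apply]
    refine Eq.trans ?_ (C.frame_trans ρ γ _ z)
    rw [Path.Homotopic.Quotient.trans_refl, Path.Homotopic.Quotient.refl_trans]
  · refine (C.transportIso_frame ρ _ γ z).trans ?_
    rw [← ρ.pathAnti_apply]
    refine Eq.trans ?_ (lift_frame β _ _).symm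
    have h1 : mapClass σ (Path.Homotopic.Quotient.refl x₀)
      = Path.Homotopic.Quotient.refl (σ x₀) := rfl
    -- The sign produced by ρ(β)ρ(γ) cancels the one in the definition of the lift, and the loop
    -- γσ(β) cancels β⁻¹ down to γ.
    have h2 : ρ.pathAnti β (ρ.pathAnti γ z) = k.sign • ρ.loopIso (γ.trans (mapPath β)) z := by
      rw [ρ.loopIso_trans_mapPath, k.sign_smul_sign_smul]
    rw [h1, h2, map_smul, k.sign_smul_sign_smul]
    refine Eq.trans ?_ (C.frame_trans ρ _ _ z)
    congr 2
    rw [Path.Homotopic.Quotient.refl_trans, Path.Homotopic.Quotient.trans_refl,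
      Path.Homotopic.Quotient.trans_assoc, Path.Homotopic.Quotient.trans_symm,
      Path.Homotopic.Quotient.trans_refl]

end PathCover

theorem exists_triple_hasMonodromy [IsManifold 𝓘(ℂ, ℂ) ω X] [T2Space X] [PathConnectedSpace X]
    (ρ : ExtRep σ x₀ k n) : ∃ V : FlatTriple σ k n, V.Antiunitary ∧
      ∃ φ : ModelFiber n ≃ₗᵢ[ℂ] V.E x₀, V.HasMonodromy φ.toLinearEquiv ρ := by
  obtain ⟨C⟩ := PathCover.nonempty x₀
  let β : Path.Homotopic.Quotient x₀ (σ x₀) :=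
    Path.Homotopic.Quotient.mk (PathConnectedSpace.joined x₀ (σ x₀)).somePath
  exact ⟨C.triple ρ β, C.antiunitary_triple ρ β, _, C.hasMonodromy_triple ρ β⟩

end BundleOfRepresentation


/-! ### From a relation to a bijection, and the theorem. -/

section Correspondence

/-- A relation which is total, and single-valued up to equivalence, in both directions induces a
bijection of the quotients. -/
theorem exists_bijective_of_rel {P Q : Type*} (s : Setoid P) (t : Setoid Q) (R : P → Q → Prop)
    (hP : ∀ p, ∃ q, R p q) (hQ : ∀ q, ∃ p, R p q)
    (hl : ∀ p p' q, R p q → (R p' q ↔ s.r p p')) (hr : ∀ p q q', R p q → (R p q' ↔ t.r q q')) :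
    ∃ Ψ : Quotient s → Quotient t, Function.Bijective Ψ ∧
      ∀ p q, Ψ (Quotient.mk s p) = Quotient.mk t q ↔ R p q := by
  choose f hf using hP
  have hΨ : ∀ p p', s.r p p' → Quotient.mk t (f p) = Quotient.mk t (f p') := fun p p' h =>
    Quotient.sound ((hr p' _ _ ((hl _ _ _ (hf p)).2 h)).1 (hf p'))
  have hiff : ∀ p q, Quotient.mk t (f p) = Quotient.mk t q ↔ R p q := fun p q =>
    Quotient.eq.trans (hr p _ _ (hf p)).symm
  refine ⟨Quotient.lift (fun p => Quotient.mk t (f p)) hΨ, ⟨?_, ?_⟩, hiff⟩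
  · intro a b
    induction a using Quotient.ind with | _ p
    induction b using Quotient.ind with | _ p'
    intro h
    exact Quotient.sound ((hl _ _ _ ((hiff p _).1 h)).1 (hf p'))
  · intro b
    induction b using Quotient.ind with | _ q
    obtain ⟨p, hp⟩ := hQ q
    exact ⟨Quotient.mk s p, (hiff p q).2 hp⟩

end Correspondence

theorem mainTheorem7 {X : Type*} [TopologicalSpace X] [ChartedSpace ℂ X]
    [IsManifold 𝓘(ℂ, ℂ) ω X] [T2Space X] [CompactSpace X] [ConnectedSpace X]
    (σ : AntiholInvolution X) (x₀ : X) (k : StructureKind) (n : ℕ) :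
    (∃ Ψ : ExtRepClass σ x₀ k n → FlatTriple.IsoClass σ k n,
      Function.Bijective Ψ ∧
      ∀ (ρ : ExtRep σ x₀ k n) (V : FlatTriple σ k n),
        Ψ (Quotient.mk (ExtRep.setoid σ x₀ k n) ρ) = Quotient.mk (FlatTriple.setoid σ k n) V ↔
          ∃ φ : EuclideanSpace ℂ (Fin n) ≃ₗ[ℂ] V.E x₀, V.HasMonodromy φ ρ) ∧
    (∃ Ψ : ExtRepClass σ x₀ k n → FlatTriple.UnitaryIsoClass σ k n,
      Function.Bijective Ψ ∧
      ∀ (ρ : ExtRep σ x₀ k n) (V : {V : FlatTriple σ k n // V.Antiunitary}),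
        Ψ (Quotient.mk (ExtRep.setoid σ x₀ k n) ρ) =
            Quotient.mk (FlatTriple.setoidAntiunitary σ k n) V ↔
          ∃ φ : EuclideanSpace ℂ (Fin n) ≃ₗᵢ[ℂ] V.1.E x₀,
            V.1.HasMonodromy φ.toLinearEquiv ρ) := by

  have : PathConnectedSpace X := by
    have := ChartedSpace.locallyPathConnectedSpace ℂ X
    exact pathConnectedSpace_iff_connectedSpace.2 inferInstance
  constructor
  · refine exists_bijective_of_rel _ _
      (fun (ρ : ExtRep σ x₀ k n) (V : FlatTriple σ k n) =>
        ∃ φ : EuclideanSpace ℂ (Fin n) ≃ₗ[ℂ] V.E x₀, V.HasMonodromy φ ρ)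
      (fun ρ => ?_) (fun V => ?_) ?_ ?_
    · obtain ⟨V, _, φ, h⟩ := exists_triple_hasMonodromy ρ
      exact ⟨V, φ.toLinearEquiv, h⟩
    · obtain ⟨φ, ρ, h⟩ := V.exists_frame_hasMonodromy x₀
      exact ⟨ρ, φ, h⟩
    · rintro ρ ρ' V ⟨φ, h⟩
      refine ⟨?_, fun hρ => ?_⟩
      · rintro ⟨φ', h'⟩
        -- The frames are merely linear, so φ'⁻¹φ is only a linear intertwiner; its polar part
        -- supplies the unitary one.
        exact ExtRep.equiv_of_linear_intertwines _ (h.intertwines h')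
      · obtain ⟨W, hW⟩ := ExtRep.exists_intertwines_of_equiv hρ
        exact ⟨_, h.of_intertwines W hW⟩
    · rintro ρ V V' ⟨φ, h⟩
      refine ⟨?_, ?_⟩
      · rintro ⟨φ', h'⟩
        obtain ⟨Φ, hΦ, _⟩ := h.exists_isIso h'
        exact ⟨Φ, hΦ⟩
      · rintro ⟨Φ, hΦ⟩
        exact ⟨_, h.trans_isIso hΦ⟩
  · refine exists_bijective_of_rel _ _
      (fun (ρ : ExtRep σ x₀ k n) (V : {V : FlatTriple σ k n // V.Antiunitary}) =>
        ∃ φ : EuclideanSpace ℂ (Fin n) ≃ₗᵢ[ℂ] V.1.E x₀, V.1.HasMonodromy φ.toLinearEquiv ρ)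
      (fun ρ => ?_) (fun V => ?_) ?_ ?_
    · obtain ⟨V, hV, φ, h⟩ := exists_triple_hasMonodromy ρ
      exact ⟨⟨V, hV⟩, φ, h⟩
    · obtain ⟨φ⟩ := V.1.nonempty_isometry x₀
      obtain ⟨ρ, h⟩ := FlatTriple.exists_isometry_hasMonodromy V.2 φ
      exact ⟨ρ, φ, h⟩
    · rintro ρ ρ' V ⟨φ, h⟩
      refine ⟨?_, fun hρ => ?_⟩
      · rintro ⟨φ', h'⟩
        -- Here the frames are unitary, and the intertwiner is already an isometry.
        exact ExtRep.equiv_of_intertwines (φ.trans φ'.symm) (h.intertwines h')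
      · obtain ⟨W, hW⟩ := ExtRep.exists_intertwines_of_equiv hρ
        exact ⟨W.symm.trans φ, h.of_intertwines W hW⟩
    · rintro ρ V V' ⟨φ, h⟩
      refine ⟨?_, ?_⟩
      · rintro ⟨φ', h'⟩
        obtain ⟨Φ, hΦ, hm⟩ := h.exists_isIso h'
        exact ⟨Φ, hΦ, hm (φ.symm.trans φ').inner_map_map⟩
      · rintro ⟨Φ, hΦ, hm⟩
        exact ⟨φ.trans ((Φ x₀).isometryOfInner (hm x₀)), h.trans_isIso hΦ⟩
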